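/- Let $p$ be a prime and put $\kappa=1$ if $p\neq 2$, $\kappa=2$ if $p=2$. Definitions. For a group $G$ let $G^l$ be the subgroup generated by all $l$-th powers. The lower $p$-series is $P_1(G)=G$, $P_{i+1}(G)=P_i(G)^p[P_i(G),G]$. A topologically finitely generated pro-$p$ group $G$ is uniform if $[G,G]\subseteq G^p$ (resp. $[G,G]\subseteq G^4$ if $p=2$) and the index $(P_i(G):P_{i+1}(G))$ is the same for all $i\geq 1$; its dimension is the minimal number of topological generators. A $p$-valuation on a group $G$ is a function $\omega:G\setminus\{1\}\to(1/(p-1),\infty)\subset\mathbb{R}$ which, with the convention $\omega(1)=\infty$, satisfies $\omega(gh^{-1})\geq\min(\omega(g),\omega(h))$, $\omega(g^{-1}h^{-1}gh)\geq\omega(g)+\omega(h)$ and $\omega(g^p)=\omega(g)+1$ for all $g,h\in G$. The pair $(G,\omega)$ is $p$-saturated if $G$ is complete for the topology defined by the subgroups $\{g:\omega(g)\geq\nu\}$, $\nu\in\mathbb{R}$, and every $g$ with $\omega(g)>p/(p-1)$ is a $p$-th power in $G$. Let $G$ be a compact locally $\mathbb{Q}_p$-analytic group with a $p$-valuation $\omega$.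 An ordered basis of $(G,\omega)$ is a finite sequence $h_1,\dots,h_d$ of topological generators of $G$ such that $(x_1,\dots,x_d)\mapsto h_1^{x_1}\cdots h_d^{x_d}$ is a bijective global chart $\mathbb{Z}_p^d\to G$ of the analytic manifold $G$ and $\omega(h_1^{x_1}\cdots h_d^{x_d})=\min_i(\omega(h_i)+v_p(x_i))$ for all $x\in\mathbb{Z}_p^d$, where $v_p$ is the $p$-adic valuation. One says that $\omega$ satisfies (HYP) with the ordered basis $h_1,\dots,h_d$ if $(G,\omega)$ is $p$-saturated and $\omega(h_i)+\omega(h_j)>p/(p-1)$ for all $i\neq j$; and that $\omega$ satisfies (HYP) if it does so with some ordered basis. Proposition. (1) Let $G$ be a uniform pro-$p$ group of dimension $d$. Every $g\neq 1$ lies in $P_i(G)\setminus P_{i+1}(G)$ for some $i\geq 1$, and putting $\omega(g)=i$ if $p\neq 2$, resp. $\omega(g)=i+1$ if $p=2$, for $g\in P_i(G)\setminus P_{i+1}(G)$, defines an integrally valued $p$-valuation $\omega$ on $G$. There is a structure of $d$-dimensional locally $\mathbb{Q}_p$-analytic group on the topological group $G$ with respect to which $\omega$ satisfies (HYP) and every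 sequence $h_1,\dots,h_d$ of $d$ topological generators of $G$ is an ordered basis with which $\omega$ satisfies (HYP), with $\omega(h_1)=\dots=\omega(h_d)=\kappa$. (2) Conversely, if $p\neq 2$, then every compact locally $\mathbb{Q}_p$-analytic group which carries a $p$-valuation satisfying (HYP) is a uniform pro-$p$ group. -/

import Mathlib

open scoped Manifold ContDiff Topology

noncomputable section

namespace UniformPro

/-- A pro-`p` group: a profinite topological group all of whose open normal subgroups have
`p`-power index. -/
structure IsProP (p : ℕ) (G : Type*) [Group G] [TopologicalSpace G] : Prop where
  isTopologicalGroup : IsTopologicalGroup G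
  compactSpace : CompactSpace G
  t2Space : T2Space G
  totallyDisconnectedSpace : TotallyDisconnectedSpace G
  index_eq : ∀ N : Subgroup G, N.Normal → IsOpen (N : Set G) → ∃ n : ℕ, N.index = p ^ n

/-- The finite family `h` topologically generates `G`. -/
def TopGenerates {G : Type*} [Group G] [TopologicalSpace G] {n : ℕ} (h : Fin n → G) : Prop :=
  Dense (Subgroup.closure (Set.range h) : Set G)

/-- `H ^ l`: the subgroup generated by the `l`-th powers of the elements of `H`. -/
def powSubgroup {G : Type*} [Group G] (H : Subgroup G) (l : ℕ) : Subgroup G :=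
  Subgroup.closure {x | ∃ g ∈ H, g ^ l = x}

/-- The lower `p`-series `P₁ = G`, `Pᵢ₊₁ = Pᵢ ^ p [Pᵢ, G]`, indexed from `1`.
The value at index `0` is `G` by convention and is never used. -/
def lowerPSeries (p : ℕ) (G : Type*) [Group G] : ℕ → Subgroup G
  | 0 => ⊤
  | 1 => ⊤
  | (i + 2) => powSubgroup (lowerPSeries p G (i + 1)) p ⊔ ⁅lowerPSeries p G (i + 1), ⊤⁆

/-- `G` is powerful: `[G, G]` is contained in `G ^ p` (`p` odd), in `G ^ 4` (`p = 2`). -/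
def IsPowerful (p : ℕ) (G : Type*) [Group G] : Prop :=
  ⁅(⊤ : Subgroup G), (⊤ : Subgroup G)⁆ ≤ powSubgroup ⊤ (if p = 2 then 4 else p)

/-- A uniform pro-`p` group: a topologically finitely generated powerful pro-`p` group for which
the index `(Pᵢ : Pᵢ₊₁)`, `i ≥ 1`, does not depend on `i`. -/
structure IsUniform (p : ℕ) (G : Type*) [Group G] [TopologicalSpace G] : Prop where
  isProP : IsProP p G
  topFG : ∃ (n : ℕ) (h : Fin n → G), TopGenerates h
  isPowerful : IsPowerful p G
  relIndex_eq : ∀ i j : ℕ, 1 ≤ i → 1 ≤ j →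
    (lowerPSeries p G (i + 1)).relIndex (lowerPSeries p G i) =
      (lowerPSeries p G (j + 1)).relIndex (lowerPSeries p G j)

/-- The dimension of a uniform group: the minimal number of topological generators. -/
def HasDim (G : Type*) [Group G] [TopologicalSpace G] (d : ℕ) : Prop :=
  IsLeast {n : ℕ | ∃ h : Fin n → G, TopGenerates h} d

/-- A `p`-valuation on an abstract group, extended by `w 1 = ∞`. -/
structure IsPValuation (p : ℕ) {G : Type*} [Group G] (w : G → WithTop ℝ) : Prop where
  eq_top_iff : ∀ g, w g = ⊤ ↔ g = 1
  lt : ∀ g, ((1 / ((p : ℝ) - 1) : ℝ) : WithTop ℝ) < w g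
  mul_inv : ∀ g h, min (w g) (w h) ≤ w (g * h⁻¹)
  commutator : ∀ g h, w g + w h ≤ w (g⁻¹ * h⁻¹ * g * h)
  pow_p : ∀ g, w (g ^ p) = w g + 1

/-- `G` is complete for the topology given by the filtration by the subgroups `{g | C ≤ w g}`:
every Cauchy sequence converges (the filtration has a countable cofinal subfamily of normal
subgroups, so sequences suffice). -/
def IsCompleteFor {G : Type*} [Group G] (w : G → WithTop ℝ) : Prop :=
  ∀ u : ℕ → G,
    (∀ C : ℝ, ∃ N : ℕ, ∀ m ≥ N, ∀ n ≥ N, (C : WithTop ℝ) ≤ w ((u m)⁻¹ * u n)) →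
    ∃ g : G, ∀ C : ℝ, ∃ N : ℕ, ∀ n ≥ N, (C : WithTop ℝ) ≤ w (g⁻¹ * u n)

/-- A `p`-saturated group: complete, and every `g` with `w g > p / (p - 1)` is a `p`-th power. -/
structure IsPSaturated (p : ℕ) {G : Type*} [Group G] (w : G → WithTop ℝ) : Prop where
  isPValuation : IsPValuation p w
  isComplete : IsCompleteFor w
  exists_pow : ∀ g : G, (((p : ℝ) / ((p : ℝ) - 1) : ℝ) : WithTop ℝ) < w g → ∃ k : G, k ^ p = g

/-- The `p`-adic valuation on `ℤ_p` with `v_p(0) = ∞`. -/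
def vp {p : ℕ} [Fact p.Prime] (x : ℤ_[p]) : WithTop ℝ :=
  open Classical in if x = 0 then ⊤ else ((x.valuation : ℝ) : WithTop ℝ)

/-- The power `g ^ x` with a `p`-adic integer exponent `x`: the limit of the powers `g ^ aₙ`,
where `aₙ ∈ ℕ` is the residue of `x` modulo `p ^ n`. -/
def padicPow {p : ℕ} [Fact p.Prime] {G : Type*} [Group G] [TopologicalSpace G]
    (g : G) (x : ℤ_[p]) : G :=
  Filter.limUnder Filter.atTop (fun n : ℕ => g ^ (x.appr n))

/-- The ordered product `h₁ ^ x₁ ⋯ h_d ^ x_d`. -/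
def orderedProd {p : ℕ} [Fact p.Prime] {G : Type*} [Group G] [TopologicalSpace G] {d : ℕ}
    (h : Fin d → G) (x : Fin d → ℤ_[p]) : G :=
  (List.ofFn fun i => padicPow (h i) (x i)).prod

/-- A map `f : ℤ_p ^ d → M` is a bijective global chart of the locally `ℚ_p`-analytic manifold
`M`: its inverse, defined on all of `M` with image `ℤ_p ^ d ⊆ ℚ_p ^ d`, belongs to the maximal
analytic atlas of `M`. -/
def IsGlobalChart {p : ℕ} [Fact p.Prime] {M : Type*} [TopologicalSpace M] {d : ℕ}
    [ChartedSpace (Fin d → ℚ_[p]) M] (f : (Fin d → ℤ_[p]) → M) : Prop :=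
  ∃ e ∈ IsManifold.maximalAtlas 𝓘(ℚ_[p], Fin d → ℚ_[p]) ω M,
    e.source = Set.univ ∧ e.target = {y | ∀ i, ‖y i‖ ≤ 1} ∧
      ∀ x : Fin d → ℤ_[p], e.symm (fun i => (x i : ℚ_[p])) = f x

/-- An ordered basis of a locally `ℚ_p`-analytic group with respect to a `p`-valuation `w`.
The minimum over the empty family is `∞`. -/
structure IsOrderedBasis (p : ℕ) [Fact p.Prime] {G : Type*} [Group G] [TopologicalSpace G]
    {d : ℕ} [ChartedSpace (Fin d → ℚ_[p]) G] (w : G → WithTop ℝ) (h : Fin d → G) : Prop where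
  topGenerates : TopGenerates h
  isGlobalChart : IsGlobalChart (p := p) (orderedProd h)
  apply_eq : ∀ x : Fin d → ℤ_[p],
    w (orderedProd h x) = Finset.univ.inf fun i => w (h i) + vp (x i)

/-- The condition (HYP) on a `p`-valuation `w` and an ordered basis `h`. -/
structure HYP (p : ℕ) [Fact p.Prime] {G : Type*} [Group G] [TopologicalSpace G]
    {d : ℕ} [ChartedSpace (Fin d → ℚ_[p]) G] (w : G → WithTop ℝ) (h : Fin d → G) : Prop where
  isPSaturated : IsPSaturated p w
  isOrderedBasis : IsOrderedBasis p w h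
  lt_add : ∀ i j, i ≠ j →
    (((p : ℝ) / ((p : ℝ) - 1) : ℝ) : WithTop ℝ) < w (h i) + w (h j)

/-- `w` is given by the lower `p`-series: every `g ≠ 1` lies in some `Pᵢ ∖ Pᵢ₊₁`, `i ≥ 1`, and
then `w g = i` if `p ≠ 2`, and `w g = i + 1` if `p = 2`. -/
structure IsLowerPSeriesVal (p : ℕ) {G : Type*} [Group G] (w : G → WithTop ℝ) : Prop where
  exists_mem : ∀ g : G, g ≠ 1 → ∃ i : ℕ, 1 ≤ i ∧ g ∈ lowerPSeries p G i ∧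
    g ∉ lowerPSeries p G (i + 1)
  apply_eq : ∀ (g : G) (i : ℕ), 1 ≤ i → g ∈ lowerPSeries p G i → g ∉ lowerPSeries p G (i + 1) →
    w g = (((if p = 2 then i + 1 else i : ℕ) : ℝ) : WithTop ℝ)

/-- `κ = 1` for odd `p` and `κ = 2` for `p = 2`. -/
def kappa (p : ℕ) : ℕ := if p = 2 then 2 else 1

end UniformPro

end

/-! Part (1). Put D i = P_{i+1}(G) and κ = `kappa p`. Powerfulness propagates to [D i, D j] ≤ D
(i+j+κ), so the p-th power map is multiplicative up to deeper terms. Compactness turns approximate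
p-th roots into exact ones, and equality of the indices makes the p-th power map a bijection from D
i / D (i+1) to D (i+1) / D (i+2). These facts are collected in `IsUniformFiltration`. A minimal
topological generating family is then a basis of D 0 / D 1 over 𝔽_p, and successive approximation
shows that its ordered products with p-adic exponents identify ℤ_p^d with G and p^m ℤ_p^d with D m
(`orderedProd_inv_mul_mem`). The axioms for ω, its formula in coordinates and saturation follow.

Analyticity of the group operations is the hard point. It is obtained by representing G in a Banach
algebra, in the spirit of Lazard. Filter ℤ[G] by giving p weight 1 and g - 1 weight i+κ for g ∈ D i,
and let ℤ[G] act by right translation on the Banach space of functionals decaying like p^(-n) on the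
n-th step. This gives a continuous homomorphism `rep` from G to the units of a Banach algebra. A
continuous character of ℤ_p in such an algebra is locally an exponential (`analyticAt_of_map_add`),
so `rep` is analytic in the coordinates. Conversely, each coordinate extends to a continuous linear
functional on the algebra. This needs the coordinate to be divisible by p^(n-κ) on the n-th step
(`pow_dvd_groupRingLift`). The divisibility is checked on sorted words in the elements h_i - 1,
which span each step modulo the next; the remainder is harmless because deep steps annihilate finite
modules of p-power order. Products, inverses and changes of basis are thus analytic operations of
the algebra followed by a linear map.

Part (2). (HYP) puts the commutators of the generators, hence all of [G, G], into {ω > p/(p-1)}, and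
saturation makes every element of [G, G] a p-th power. As p is odd, the root lemma applies with κ =
1 and yields P_{i+1} = {ω > 1/(p-1) + i}. The p-th power map then matches successive quotients. -/

noncomputable section
namespace UniformPro

/-! ### Commutator and power calculus in the lower `p`-series -/

section LowerPSeries

open scoped commutatorElement

variable {G : Type*} [Group G]

/-- The three subgroups lemma, applied in G/N. -/
theorem commutator_commutator_le_of_rotate {N H₁ H₂ H₃ : Subgroup G} [N.Normal]
    (h1 : ⁅⁅H₂, H₃⁆, H₁⁆ ≤ N) (h2 : ⁅⁅H₃, H₁⁆, H₂⁆ ≤ N) : ⁅⁅H₁, H₂⁆, H₃⁆ ≤ N := by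
  rw [← QuotientGroup.ker_mk' N, ← Subgroup.map_eq_bot_iff, Subgroup.map_commutator,
    Subgroup.map_commutator] at h1 h2 ⊢
  exact Subgroup.commutator_commutator_eq_bot_of_rotate h1 h2

/-- Modulo N the elements commuting with C form a centralizer, which is a subgroup, so generators
suffice. -/
theorem commutator_closure_le {N C : Subgroup G} [N.Normal] {S : Set G}
    (h : ∀ s ∈ S, ∀ c ∈ C, ⁅s, c⁆ ∈ N) : ⁅Subgroup.closure S, C⁆ ≤ N := by
  rw [← QuotientGroup.ker_mk' N, ← Subgroup.map_eq_bot_iff, Subgroup.map_commutator,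
    Subgroup.commutator_eq_bot_iff_le_centralizer, Subgroup.map_le_iff_le_comap,
    Subgroup.closure_le]
  intro s hs
  simp only [Subgroup.coe_comap, Set.mem_preimage, SetLike.mem_coe,
    Subgroup.mem_centralizer_iff_commutator_eq_one]
  rintro _ ⟨c, hc, rfl⟩
  have := inv_mem (h s hs c hc)
  rw [commutatorElement_inv] at this
  rw [← map_commutatorElement, ← MonoidHom.mem_ker, QuotientGroup.ker_mk']
  exact this

theorem commutator_sup_le {N A B C : Subgroup G} [N.Normal]
    (hA : ⁅A, C⁆ ≤ N) (hB : ⁅B, C⁆ ≤ N) : ⁅A ⊔ B, C⁆ ≤ N := by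
  have : A ⊔ B = Subgroup.closure (A ∪ B : Set G) := by
    rw [Subgroup.closure_union, Subgroup.closure_eq, Subgroup.closure_eq]
  rw [this]
  refine commutator_closure_le ?_
  rintro s (hs | hs) c hc
  · exact hA (Subgroup.commutator_mem_commutator hs hc)
  · exact hB (Subgroup.commutator_mem_commutator hs hc)

/-- Collection in class two: moving one x to the left past n factors y produces c^n, and 0 + 1 + ...
+ (n-1) is the binomial coefficient. -/
theorem mul_pow_of_commute_commutator {x y c : G} (hc : y * x = x * y * c) (hx : Commute c x)
    (hy : Commute c y) (n : ℕ) : (x * y) ^ n = x ^ n * y ^ n * c ^ n.choose 2 := by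
  have key : ∀ n : ℕ, y ^ n * x = x * y ^ n * c ^ n := by
    intro n
    induction n with
    | zero => simp
    | succ n ih =>
      have h2 : Commute (c ^ n) y := hy.pow_left n
      calc y ^ (n + 1) * x = y * (y ^ n * x) := by rw [pow_succ', mul_assoc]
        _ = (y * x) * (y ^ n * c ^ n) := by rw [ih]; group
        _ = x * y * (c * y ^ n) * c ^ n := by rw [hc]; group
        _ = x * y ^ (n + 1) * c ^ (n + 1) := by
          rw [(hy.pow_right n).eq, pow_succ' y, pow_succ' c]; group
  induction n with
  | zero => simp
  | succ n ih =>
    have h1 : Commute (c ^ n.choose 2) x := hx.pow_left _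
    have h2 : Commute (c ^ n.choose 2) y := hy.pow_left _
    have h3 : Commute (c ^ n) y := hy.pow_left _
    rw [pow_succ, ih, Nat.choose_succ_succ' n 1, Nat.choose_one_right, pow_add c n]
    calc x ^ n * y ^ n * c ^ n.choose 2 * (x * y)
        = x ^ n * y ^ n * ((c ^ n.choose 2 * x) * y) := by group
      _ = x ^ n * y ^ n * x * (c ^ n.choose 2 * y) := by rw [h1.eq]; group
      _ = x ^ n * (y ^ n * x) * y * c ^ n.choose 2 := by rw [h2.eq]; group
      _ = x ^ n * x * y ^ n * (c ^ n * y) * c ^ n.choose 2 := by rw [key]; group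
      _ = x ^ (n + 1) * y ^ (n + 1) * (c ^ n * c ^ n.choose 2) := by
        rw [h3.eq, pow_succ x, pow_succ y]; group

theorem powSubgroup_normal (H : Subgroup G) [hH : H.Normal] (l : ℕ) : (powSubgroup H l).Normal := by
  have : Group.conjugatesOfSet {x | ∃ g ∈ H, g ^ l = x} = {x | ∃ g ∈ H, g ^ l = x} := by
    refine Set.Subset.antisymm ?_ Group.subset_conjugatesOfSet
    intro a ha
    simp_rw [Group.mem_conjugatesOfSet_iff, isConj_iff] at ha
    obtain ⟨_, ⟨g, hg, rfl⟩, d, rfl⟩ := ha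
    exact ⟨d * g * d⁻¹, hH.conj_mem g hg d, by rw [conj_pow]⟩
  unfold powSubgroup
  rw [← this]
  exact Subgroup.normalClosure_normal

theorem powSubgroup_le {H K : Subgroup G} {l : ℕ} (h : ∀ g ∈ H, g ^ l ∈ K) :
    powSubgroup H l ≤ K := by
  refine (Subgroup.closure_le _).mpr ?_
  rintro _ ⟨g, hg, rfl⟩
  exact h g hg

theorem pow_mem_powSubgroup {H : Subgroup G} {l : ℕ} {g : G} (hg : g ∈ H) :
    g ^ l ∈ powSubgroup H l := Subgroup.subset_closure ⟨g, hg, rfl⟩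

variable (p : ℕ)

theorem lowerPSeries_one : lowerPSeries p G 1 = ⊤ := rfl

theorem lowerPSeries_succ (i : ℕ) : lowerPSeries p G (i + 2) =
    powSubgroup (lowerPSeries p G (i + 1)) p ⊔ ⁅lowerPSeries p G (i + 1), ⊤⁆ := rfl

instance lowerPSeries_normal : ∀ i : ℕ, (lowerPSeries p G i).Normal
  | 0 => inferInstanceAs (⊤ : Subgroup G).Normal
  | 1 => inferInstanceAs (⊤ : Subgroup G).Normal
  | (i + 2) => by
    have := lowerPSeries_normal (i + 1)
    have := powSubgroup_normal (lowerPSeries p G (i + 1)) p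
    rw [lowerPSeries_succ]
    infer_instance

variable {p}

theorem pow_mem_lowerPSeries {i : ℕ} {g : G} (hg : g ∈ lowerPSeries p G (i + 1)) :
    g ^ p ∈ lowerPSeries p G (i + 2) :=
  (le_sup_left : _ ≤ lowerPSeries p G (i + 2)) (pow_mem_powSubgroup hg)

theorem commutator_top_le_lowerPSeries (i : ℕ) :
    ⁅lowerPSeries p G (i + 1), (⊤ : Subgroup G)⁆ ≤ lowerPSeries p G (i + 2) := le_sup_right

theorem lowerPSeries_succ_le (i : ℕ) : lowerPSeries p G (i + 2) ≤ lowerPSeries p G (i + 1) :=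
  sup_le (powSubgroup_le fun _ hg => pow_mem hg p) (Subgroup.commutator_le_left _ _)

theorem lowerPSeries_le {i j : ℕ} (h : i ≤ j) :
    lowerPSeries p G (j + 1) ≤ lowerPSeries p G (i + 1) := by
  induction h with
  | refl => exact le_rfl
  | step _ ih => exact (lowerPSeries_succ_le _).trans ih

theorem lowerPSeries_map_le {H : Type*} [Group H] (f : G →* H) (i : ℕ) :
    (lowerPSeries p G (i + 1)).map f ≤ lowerPSeries p H (i + 1) := by
  induction i with
  | zero => exact le_top
  | succ i ih =>
    rw [lowerPSeries_succ, lowerPSeries_succ, Subgroup.map_sup, Subgroup.map_commutator]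
    refine sup_le_sup ?_ (Subgroup.commutator_mono ih le_top)
    rw [Subgroup.map_le_iff_le_comap]
    refine powSubgroup_le fun g hg => ?_
    rw [Subgroup.mem_comap, map_pow]
    exact pow_mem_powSubgroup (ih (Subgroup.mem_map_of_mem f hg))

/-- `x ^ p` commutes with `y` as well as the `p`-th power of `[x, y]` allows. -/
theorem commutator_pow_mem {N : Subgroup G} [N.Normal] {x y : G} (n : ℕ)
    (h1 : ⁅x, y⁆ ^ n ∈ N) (h2 : ⁅⁅x, y⁆, x⁆ ∈ N) : ⁅x ^ n, y⁆ ∈ N := by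
  rw [← QuotientGroup.eq_one_iff] at h1 h2 ⊢
  have hm : ∀ a b : G, ((⁅a, b⁆ : G) : G ⧸ N) = ⁅(a : G ⧸ N), (b : G ⧸ N)⁆ :=
    fun a b => map_commutatorElement (QuotientGroup.mk' N) a b
  rw [QuotientGroup.mk_pow, hm] at h1
  rw [hm, hm, commutatorElement_eq_one_iff_commute] at h2
  rw [hm, QuotientGroup.mk_pow]
  generalize (x : G ⧸ N) = a at *
  generalize (y : G ⧸ N) = b at *
  have h3 : Commute ⁅a, b⁆⁻¹ a := h2.inv_left
  -- Conjugation by b multiplies a by a commuting element of exponent n, hence fixes a^n.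
  have h4 : b * a * b⁻¹ = ⁅a, b⁆⁻¹ * a := by simp [commutatorElement_def, mul_assoc]
  have h5 : b * a ^ n * b⁻¹ = a ^ n := by
    rw [← conj_pow, h4, h3.mul_pow, inv_pow, h1, inv_one, one_mul]
  rw [commutatorElement_eq_one_iff_mul_comm]
  rw [mul_inv_eq_iff_eq_mul] at h5
  exact h5.symm

/-- Both kinds of generators of P_{j+2} gain one step: p-th powers by `commutator_pow_mem`,
commutators by the additional bracket with G. -/
theorem commutator_lowerPSeries_top_le {κ : ℕ}
    (h0 : ⁅(⊤ : Subgroup G), (⊤ : Subgroup G)⁆ ≤ lowerPSeries p G (κ + 1)) (j : ℕ) :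
    ⁅lowerPSeries p G (j + 1), (⊤ : Subgroup G)⁆ ≤ lowerPSeries p G (j + κ + 1) := by
  induction j with
  | zero => simpa [lowerPSeries_one] using h0
  | succ j ih =>
    rw [lowerPSeries_succ]
    refine commutator_sup_le (commutator_closure_le ?_) ?_
    · rintro _ ⟨x, hx, rfl⟩ c -
      have h1 : ⁅x, c⁆ ∈ lowerPSeries p G (j + κ + 1) :=
        ih (Subgroup.commutator_mem_commutator hx (Subgroup.mem_top c))
      have e : j + 1 + κ + 1 = j + κ + 2 := by ring
      rw [e]
      exact commutator_pow_mem p (pow_mem_lowerPSeries h1)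
        (commutator_top_le_lowerPSeries _
          (Subgroup.commutator_mem_commutator h1 (Subgroup.mem_top x)))
    · have e : j + 1 + κ + 1 = j + κ + 2 := by ring
      rw [e]
      exact (Subgroup.commutator_mono ih le_rfl).trans (commutator_top_le_lowerPSeries _)

/-- Induction on i, with the three subgroups lemma for the commutator part of P_{i+2}. One of the
rotated brackets needs the case (i, j+1), so j is generalized. -/
theorem commutator_lowerPSeries_le {κ : ℕ}
    (h0 : ⁅(⊤ : Subgroup G), (⊤ : Subgroup G)⁆ ≤ lowerPSeries p G (κ + 1)) (i j : ℕ) :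
    ⁅lowerPSeries p G (i + 1), lowerPSeries p G (j + 1)⁆ ≤ lowerPSeries p G (i + j + κ + 1) := by
  induction i generalizing j with
  | zero =>
    rw [lowerPSeries_one, Subgroup.commutator_comm, zero_add]
    exact commutator_lowerPSeries_top_le h0 j
  | succ i ih =>
    have e : i + 1 + j + κ + 1 = i + j + κ + 2 := by ring
    rw [lowerPSeries_succ, e]
    refine commutator_sup_le (commutator_closure_le ?_) ?_
    · rintro _ ⟨x, hx, rfl⟩ y hy
      have h1 : ⁅x, y⁆ ∈ lowerPSeries p G (i + j + κ + 1) :=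
        ih j (Subgroup.commutator_mem_commutator hx hy)
      exact commutator_pow_mem p (pow_mem_lowerPSeries h1)
        (commutator_top_le_lowerPSeries _
          (Subgroup.commutator_mem_commutator h1 (Subgroup.mem_top x)))
    · refine commutator_commutator_le_of_rotate ?_ ?_
      · refine (Subgroup.commutator_mono (K₁ := lowerPSeries p G (j + 2)) ?_ le_rfl).trans ?_
        · rw [Subgroup.commutator_comm]; exact commutator_top_le_lowerPSeries j
        · rw [Subgroup.commutator_comm]
          have := ih (j + 1)
          rwa [show i + (j + 1) + κ + 1 = i + j + κ + 2 by ring] at this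
      · refine (Subgroup.commutator_mono (K₁ := lowerPSeries p G (i + j + κ + 1)) ?_ le_rfl).trans
          (commutator_top_le_lowerPSeries _)
        rw [Subgroup.commutator_comm]; exact ih j

/-- The commutator c of x and y is central modulo P_{j+3}, so the only error is c raised to the
binomial coefficient p(p-1)/2. For odd p this exponent is divisible by p; for p = 2 the bound κ ≥ 2
already puts c in P_{j+3}. -/
theorem mul_pow_lowerPSeries [hp : Fact p.Prime] {κ : ℕ} (hκ : 1 ≤ κ) (hκ2 : p = 2 → 2 ≤ κ)
    (h0 : ⁅(⊤ : Subgroup G), (⊤ : Subgroup G)⁆ ≤ lowerPSeries p G (κ + 1)) {i j : ℕ} {x y : G}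
    (hx : x ∈ lowerPSeries p G (i + 1)) (hy : y ∈ lowerPSeries p G (j + 1)) :
    (x ^ p * y ^ p)⁻¹ * (x * y) ^ p ∈ lowerPSeries p G (j + 3) := by
  have hc : ⁅y⁻¹, x⁻¹⁆ ∈ lowerPSeries p G (j + i + κ + 1) :=
    commutator_lowerPSeries_le h0 j i
      (Subgroup.commutator_mem_commutator (inv_mem hy) (inv_mem hx))
  have hcz : ∀ {z : G} , ⁅⁅y⁻¹, x⁻¹⁆, z⁆ ∈ lowerPSeries p G (j + 3) := fun {z} =>
    lowerPSeries_le (p := p) (by omega : j + 2 ≤ j + i + κ + 1)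
      (commutator_top_le_lowerPSeries _
        (Subgroup.commutator_mem_commutator hc (Subgroup.mem_top z)))
  have hcp : ⁅y⁻¹, x⁻¹⁆ ^ p.choose 2 ∈ lowerPSeries p G (j + 3) := by
    by_cases h2 : p = 2
    · have := hκ2 h2
      exact pow_mem (lowerPSeries_le (p := p) (by omega : j + 2 ≤ j + i + κ) hc) _
    · have h3 : 2 < p := lt_of_le_of_ne hp.out.two_le (Ne.symm h2)
      obtain ⟨k, hk⟩ := hp.out.dvd_choose_self (by norm_num) h3
      rw [hk, pow_mul]
      exact pow_mem (lowerPSeries_le (p := p) (by omega : j + 2 ≤ j + i + κ + 1)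
        (pow_mem_lowerPSeries hc)) _
  have hm : ∀ a b : G, ((⁅a, b⁆ : G) : G ⧸ lowerPSeries p G (j + 3)) =
      ⁅(a : G ⧸ lowerPSeries p G (j + 3)), (b : G ⧸ lowerPSeries p G (j + 3))⁆ :=
    fun a b => map_commutatorElement (QuotientGroup.mk' (lowerPSeries p G (j + 3))) a b
  rw [← QuotientGroup.eq]
  simp only [← QuotientGroup.eq_one_iff, QuotientGroup.mk_pow] at hcp
  have hcom : ∀ z : G, Commute ((⁅y⁻¹, x⁻¹⁆ : G) : G ⧸ lowerPSeries p G (j + 3))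
      (z : G ⧸ lowerPSeries p G (j + 3)) := fun z => by
    have := hcz (z := z)
    rwa [← QuotientGroup.eq_one_iff, hm, commutatorElement_eq_one_iff_commute] at this
  simp only [QuotientGroup.mk_mul, QuotientGroup.mk_pow]
  rw [mul_pow_of_commute_commutator (c := ((⁅y⁻¹, x⁻¹⁆ : G) : G ⧸ lowerPSeries p G (j + 3)))
    ?_ (hcom x) (hcom y), hcp, mul_one]
  rw [← QuotientGroup.mk_mul, ← QuotientGroup.mk_mul, ← QuotientGroup.mk_mul]
  congr 1
  simp [commutatorElement_def, mul_assoc]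

/-- A product formula for the set of `p`-th powers modulo a later term. -/
theorem exists_pow_lowerPSeries [hp : Fact p.Prime] {κ : ℕ} (hκ : 1 ≤ κ) (hκ2 : p = 2 → 2 ≤ κ)
    (h0 : ⁅(⊤ : Subgroup G), (⊤ : Subgroup G)⁆ ≤ lowerPSeries p G (κ + 1))
    (h1 : ⁅(⊤ : Subgroup G), (⊤ : Subgroup G)⁆ ≤ powSubgroup ⊤ p) (i : ℕ) :
    ∀ g ∈ lowerPSeries p G (i + 2), ∃ x ∈ lowerPSeries p G (i + 1),
      (x ^ p)⁻¹ * g ∈ lowerPSeries p G (i + 3) := by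
  have hmk : ∀ {i : ℕ} {x y : G}, x ∈ lowerPSeries p G (i + 1) → y ∈ lowerPSeries p G (i + 1) →
      (((x * y) ^ p : G) : G ⧸ lowerPSeries p G (i + 3)) = (x : G ⧸ _) ^ p * (y : G ⧸ _) ^ p := by
    intro i x y hx hy
    have := mul_pow_lowerPSeries hκ hκ2 h0 hx hy
    rw [← QuotientGroup.eq] at this
    simpa using this.symm
  -- By `hmk` the elements congruent to a p-th power modulo P_{i+3} form a subgroup, so only
  -- generators of P_{i+2} have to be treated.
  let S : ∀ i : ℕ, Subgroup G := fun i =>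
    { carrier := {g | ∃ x ∈ lowerPSeries p G (i + 1),
        ((x ^ p : G) : G ⧸ lowerPSeries p G (i + 3)) = g}
      one_mem' := ⟨1, one_mem _, by simp⟩
      mul_mem' := by
        rintro a b ⟨x, hx, hxa⟩ ⟨y, hy, hyb⟩
        refine ⟨x * y, mul_mem hx hy, ?_⟩
        rw [hmk hx hy, QuotientGroup.mk_mul, ← hxa, ← hyb]; simp
      inv_mem' := by
        rintro a ⟨x, hx, hxa⟩
        exact ⟨x⁻¹, inv_mem hx, by rw [inv_pow, QuotientGroup.mk_inv, QuotientGroup.mk_inv, hxa]⟩ }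
  suffices h : lowerPSeries p G (i + 2) ≤ S i by
    intro g hg
    obtain ⟨x, hx, hxg⟩ := h hg
    exact ⟨x, hx, QuotientGroup.eq.mp hxg⟩
  have hpow : ∀ i, powSubgroup (lowerPSeries p G (i + 1)) p ≤ S i := fun i =>
    powSubgroup_le fun g hg => ⟨g, hg, rfl⟩
  induction i with
  | zero => exact sup_le (hpow 0) (h1.trans (hpow 0))
  | succ i ih =>
    refine sup_le (hpow _) (Subgroup.commutator_le.mpr ?_)
    intro g hg k _
    obtain ⟨x, hx, hxg⟩ := ih hg
    have hu : ⁅x⁻¹, k⁻¹⁆ ∈ lowerPSeries p G (i + 2) := commutator_top_le_lowerPSeries _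
      (Subgroup.commutator_mem_commutator (inv_mem hx) (Subgroup.mem_top _))
    have hu' : ⁅x, k⁆ ∈ lowerPSeries p G (i + 2) := commutator_top_le_lowerPSeries _
      (Subgroup.commutator_mem_commutator hx (Subgroup.mem_top _))
    -- Write g = x^p z with z central modulo P_{i+4}. Then [g, k] ≡ x^p · k x^(-p) k⁻¹ = x^p (x⁻¹
    -- [x, k])^p ≡ [x, k]^p.
    refine ⟨⁅x, k⁆, hu', ?_⟩
    have hz : (x ^ p)⁻¹ * g ∈ lowerPSeries p G (i + 3) := QuotientGroup.eq.mp hxg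
    have hzc : Commute ((((x ^ p)⁻¹ * g : G)) : G ⧸ lowerPSeries p G (i + 4)) (k : G ⧸ _) := by
      rw [← commutatorElement_eq_one_iff_commute]
      have : ⁅(x ^ p)⁻¹ * g, k⁆ ∈ lowerPSeries p G (i + 4) := commutator_top_le_lowerPSeries _
        (Subgroup.commutator_mem_commutator hz (Subgroup.mem_top _))
      rw [← QuotientGroup.eq_one_iff] at this
      rw [← this]
      exact (map_commutatorElement (QuotientGroup.mk' (lowerPSeries p G (i + 4))) _ _).symm
    have hg' : g = x ^ p * ((x ^ p)⁻¹ * g) := by group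
    have key := mul_pow_lowerPSeries hκ hκ2 h0 (inv_mem hx) hu'
    rw [← QuotientGroup.eq] at key
    have e : x⁻¹ * ⁅x, k⁆ = k * x⁻¹ * k⁻¹ := by simp [commutatorElement_def, mul_assoc]
    rw [e, conj_pow] at key
    generalize hzd : (x ^ p)⁻¹ * g = z at *
    have e2 : ((⁅g, k⁆ : G) : G ⧸ lowerPSeries p G (i + 4)) =
        ((x ^ p * (k * (x⁻¹) ^ p * k⁻¹) : G) : G ⧸ _) := by
      rw [hg', commutatorElement_def]
      simp only [QuotientGroup.mk_mul, QuotientGroup.mk_inv, mul_inv_rev, QuotientGroup.mk_pow]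
      have h3 : (z : G ⧸ lowerPSeries p G (i + 4)) * (k : G ⧸ lowerPSeries p G (i + 4)) *
          (z : G ⧸ lowerPSeries p G (i + 4))⁻¹ = (k : G ⧸ lowerPSeries p G (i + 4)) := by
        rw [hzc.eq, mul_inv_cancel_right]
      calc _ = (x : G ⧸ lowerPSeries p G (i + 4)) ^ p *
            ((z : G ⧸ lowerPSeries p G (i + 4)) * (k : G ⧸ lowerPSeries p G (i + 4)) *
              (z : G ⧸ lowerPSeries p G (i + 4))⁻¹) *
            ((x : G ⧸ lowerPSeries p G (i + 4)) ^ p)⁻¹ * (k : G ⧸ lowerPSeries p G (i + 4))⁻¹ := by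
            group
        _ = _ := by rw [h3]; group
    rw [e2]
    rw [QuotientGroup.mk_mul _ (x ^ p), ← key]
    simp

end LowerPSeries

end UniformPro
end

/-! ### Pro-`p` groups: shrinking of the series and exact `p`-th roots -/

noncomputable section
namespace UniformPro

section CompactGroup

open scoped commutatorElement
open Topology

/-- Induction on the order: divide by a central subgroup of order p. The term that dies in the
quotient lies in this subgroup, and the next term is trivial. -/
theorem exists_lowerPSeries_eq_bot {p : ℕ} [hp : Fact p.Prime] (n : ℕ) :
    ∀ (Γ : Type*) [Group Γ] [Finite Γ], Nat.card Γ ≤ n → IsPGroup p Γ →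
      ∃ m, lowerPSeries p Γ (m + 1) = ⊥ := by
  induction n with
  | zero =>
    intro Γ _ _ h _
    have := Nat.card_pos (α := Γ)
    omega
  | succ n ih =>
    intro Γ _ _ hcard hΓ
    cases subsingleton_or_nontrivial Γ with
    | inl h => exact ⟨0, Subsingleton.elim _ _⟩
    | inr h =>
      have hc := hΓ.center_nontrivial
      have hcp : IsPGroup p (Subgroup.center Γ) := hΓ.to_subgroup _
      obtain ⟨k, hk⟩ := (IsPGroup.iff_card).mp hcp
      have hpk : p ∣ Nat.card (Subgroup.center Γ) := by
        rw [hk]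
        refine dvd_pow_self p ?_
        rintro rfl
        have := Finite.one_lt_card (α := Subgroup.center Γ)
        rw [hk, pow_zero] at this
        exact lt_irrefl _ this
      obtain ⟨z, hz⟩ := exists_prime_orderOf_dvd_card' p hpk
      have hZc : Subgroup.zpowers (z : Γ) ≤ Subgroup.center Γ :=
        (Subgroup.zpowers_le).mpr z.2
      have hZp : ∀ g ∈ Subgroup.zpowers (z : Γ), g ^ p = 1 := by
        rintro _ ⟨k, rfl⟩
        have : (z : Γ) ^ p = 1 := by
          rw [← hz, ← Subgroup.coe_pow, pow_orderOf_eq_one, Subgroup.coe_one]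
        simp only
        rw [← zpow_natCast, ← zpow_mul, mul_comm, zpow_mul, zpow_natCast, this, one_zpow]
      have : (Subgroup.zpowers (z : Γ)).Normal := by
        constructor
        intro a ha g
        have := Subgroup.mem_center_iff.mp (hZc ha) g
        rwa [this, mul_inv_cancel_right]
      have hlt : Nat.card (Γ ⧸ Subgroup.zpowers (z : Γ)) < Nat.card Γ := by
        rw [Subgroup.card_eq_card_quotient_mul_card_subgroup (Subgroup.zpowers (z : Γ)),
          Nat.card_zpowers, Subgroup.orderOf_coe, hz]
        exact lt_mul_of_one_lt_right Nat.card_pos hp.out.one_lt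
      obtain ⟨m, hm⟩ := ih (Γ ⧸ Subgroup.zpowers (z : Γ)) (by omega) (hΓ.to_quotient _)
      have hle : lowerPSeries p Γ (m + 1) ≤ Subgroup.zpowers (z : Γ) := by
        have := lowerPSeries_map_le (p := p) (QuotientGroup.mk' (Subgroup.zpowers (z : Γ))) m
        rwa [hm, le_bot_iff, Subgroup.map_eq_bot_iff, QuotientGroup.ker_mk'] at this
      refine ⟨m + 1, ?_⟩
      rw [lowerPSeries_succ, eq_bot_iff]
      refine sup_le (powSubgroup_le fun g hg => ?_) ?_
      · rw [Subgroup.mem_bot]; exact hZp g (hle hg)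
      · rw [le_bot_iff, Subgroup.commutator_top_right_eq_bot_iff_le_center]
        exact hle.trans hZc

variable {G : Type*} [Group G] [TopologicalSpace G] {p : ℕ} [hp : Fact p.Prime]

theorem IsProP.exists_lowerPSeries_subset (hG : IsProP p G) {U : Set G} (hU : U ∈ 𝓝 (1 : G)) :
    ∃ n, (lowerPSeries p G (n + 1) : Set G) ⊆ U := by
  have := hG.isTopologicalGroup
  have := hG.compactSpace
  have := hG.totallyDisconnectedSpace
  obtain ⟨V, hVU, hV, h1⟩ := mem_nhds_iff.mp hU
  obtain ⟨N, hN⟩ := ProfiniteGrp.exist_openNormalSubgroup_sub_open_nhds_of_one hV h1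
  obtain ⟨k, hk⟩ := hG.index_eq N.toSubgroup inferInstance N.isOpen
  have hfin : Finite (G ⧸ N.toSubgroup) := by
    refine Nat.finite_of_card_ne_zero ?_
    have h2 : Nat.card (G ⧸ N.toSubgroup) = p ^ k := hk
    rw [h2]
    exact pow_ne_zero _ hp.out.ne_zero
  obtain ⟨m, hm⟩ := exists_lowerPSeries_eq_bot (p := p) _ (G ⧸ N.toSubgroup) le_rfl
    (IsPGroup.iff_card.mpr ⟨k, hk⟩)
  refine ⟨m, fun g hg => hVU (hN ?_)⟩
  have := lowerPSeries_map_le (p := p) (QuotientGroup.mk' N.toSubgroup) m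
  rw [hm, le_bot_iff, Subgroup.map_eq_bot_iff, QuotientGroup.ker_mk'] at this
  exact this hg

variable {κ : ℕ}

omit [TopologicalSpace G] in
/-- Successive approximation of a `p`-th root. -/
theorem exists_pow_approx_lowerPSeries (hκ : 1 ≤ κ) (hκ2 : p = 2 → 2 ≤ κ)
    (h0 : ⁅(⊤ : Subgroup G), (⊤ : Subgroup G)⁆ ≤ lowerPSeries p G (κ + 1))
    (h1 : ⁅(⊤ : Subgroup G), (⊤ : Subgroup G)⁆ ≤ powSubgroup ⊤ p) (i n : ℕ) {g : G}
    (hg : g ∈ lowerPSeries p G (i + 2)) :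
    ∃ x ∈ lowerPSeries p G (i + 1), (x ^ p)⁻¹ * g ∈ lowerPSeries p G (i + n + 2) := by
  induction n with
  | zero => exact ⟨1, one_mem _, by simpa using hg⟩
  | succ n ih =>
    obtain ⟨x, hx, hxg⟩ := ih
    obtain ⟨y, hy, hyg⟩ := exists_pow_lowerPSeries hκ hκ2 h0 h1 (i + n) _ hxg
    refine ⟨x * y, mul_mem hx (lowerPSeries_le (by omega) hy), ?_⟩
    have h3 := mul_pow_lowerPSeries hκ hκ2 h0 hx hy
    have e : ((x * y) ^ p)⁻¹ * g = ((x ^ p * y ^ p)⁻¹ * (x * y) ^ p)⁻¹ *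
        ((y ^ p)⁻¹ * ((x ^ p)⁻¹ * g)) := by group
    rw [e]
    exact mul_mem (inv_mem h3) hyg

/-- If P_{i+1} is closed, hence compact, its p-th powers form a closed set, and approximate roots
show that P_{i+2} lies in the closure of this set. So P_{i+2} is the set of p-th powers and is
closed in turn; the two assertions therefore advance together. -/
theorem lowerPSeries_eq_image_pow [IsTopologicalGroup G] [CompactSpace G] [T2Space G]
    (hκ : 1 ≤ κ) (hκ2 : p = 2 → 2 ≤ κ)
    (h0 : ⁅(⊤ : Subgroup G), (⊤ : Subgroup G)⁆ ≤ lowerPSeries p G (κ + 1))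
    (h1 : ⁅(⊤ : Subgroup G), (⊤ : Subgroup G)⁆ ≤ powSubgroup ⊤ p)
    (hsmall : ∀ U ∈ 𝓝 (1 : G), ∃ n, (lowerPSeries p G (n + 1) : Set G) ⊆ U) (i : ℕ) :
    IsClosed (lowerPSeries p G (i + 1) : Set G) ∧
      ∀ g ∈ lowerPSeries p G (i + 2), ∃ x ∈ lowerPSeries p G (i + 1), x ^ p = g := by
  have step : ∀ i, IsClosed (lowerPSeries p G (i + 1) : Set G) →
      ∀ g ∈ lowerPSeries p G (i + 2), ∃ x ∈ lowerPSeries p G (i + 1), x ^ p = g := by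
    intro i hi g hg
    have hcl : IsClosed ((fun x : G => x ^ p) '' (lowerPSeries p G (i + 1) : Set G)) :=
      (hi.isCompact.image (continuous_pow p)).isClosed
    suffices g ∈ closure ((fun x : G => x ^ p) '' (lowerPSeries p G (i + 1) : Set G)) by
      rw [hcl.closure_eq] at this
      exact this
    rw [mem_closure_iff_nhds]
    intro U hU
    have hV : (fun z : G => g * z⁻¹) ⁻¹' U ∈ 𝓝 (1 : G) := by
      refine ContinuousAt.preimage_mem_nhds (by fun_prop) ?_
      simpa using hU
    obtain ⟨n, hn⟩ := hsmall _ hV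
    obtain ⟨x, hx, hxg⟩ := exists_pow_approx_lowerPSeries hκ hκ2 h0 h1 i n hg
    refine ⟨x ^ p, ?_, x, hx, rfl⟩
    have := hn (lowerPSeries_le (by omega : n ≤ i + n + 1) hxg)
    simpa using this
  have hclosed : IsClosed (lowerPSeries p G (i + 1) : Set G) := by
    induction i with
    | zero => exact isClosed_univ
    | succ i ih =>
      have : (lowerPSeries p G (i + 2) : Set G) =
          (fun x : G => x ^ p) '' (lowerPSeries p G (i + 1) : Set G) := by
        ext g
        constructor
        · intro hg
          obtain ⟨x, hx, hxg⟩ := step i ih g hg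
          exact ⟨x, hx, hxg⟩
        · rintro ⟨x, hx, rfl⟩
          exact pow_mem_lowerPSeries hx
      rw [this]
      exact (ih.isCompact.image (continuous_pow p)).isClosed
  exact ⟨hclosed, step i hclosed⟩

/-- In a topologically finitely generated group, a closed normal subgroup with abelian quotient of
exponent `p` has finite index. -/
theorem finite_quotient_of_topGenerates [IsTopologicalGroup G] {n : ℕ} {h : Fin n → G}
    (hh : TopGenerates h) {N : Subgroup G} [N.Normal] (hN : IsClosed (N : Set G))
    (hcomm : ⁅(⊤ : Subgroup G), (⊤ : Subgroup G)⁆ ≤ N) (hpow : ∀ g : G, g ^ p ∈ N) :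
    Finite (G ⧸ N) := by
  have hm : ∀ a b : G ⧸ N, a * b = b * a := by
    intro a b
    induction a using QuotientGroup.induction_on with | H a => ?_
    induction b using QuotientGroup.induction_on with | H b => ?_
    rw [← commutatorElement_eq_one_iff_mul_comm]
    have := hcomm (Subgroup.commutator_mem_commutator (Subgroup.mem_top a) (Subgroup.mem_top b))
    rw [← QuotientGroup.eq_one_iff] at this
    rw [← this]
    exact (map_commutatorElement (QuotientGroup.mk' N) _ _).symm
  let _ : CommGroup (G ⧸ N) := { (inferInstance : Group (G ⧸ N)) with mul_comm := hm }
  -- The image of the dense finitely generated subgroup is finitely generated, abelian and torsion,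
  -- hence finite and closed. Its preimage is closed and dense, hence everything.
  set K : Subgroup (G ⧸ N) := (Subgroup.closure (Set.range h)).map (QuotientGroup.mk' N) with hK
  have hKfg : Group.FG K := by
    rw [Group.fg_iff_subgroup_fg, hK, MonoidHom.map_closure, ← Set.range_comp]
    exact ⟨(Set.finite_range (QuotientGroup.mk' N ∘ h)).toFinset, by simp⟩
  have hKfin : Finite K := by
    refine CommGroup.finite_of_fg_isMulTorsion K ?_
    rintro ⟨⟨g⟩, hg⟩
    rw [isOfFinOrder_iff_pow_eq_one]
    refine ⟨p, hp.out.pos, Subtype.ext ?_⟩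
    exact (QuotientGroup.eq_one_iff (g ^ p)).mpr (hpow g)
  have hcl : IsClosed ((QuotientGroup.mk : G → G ⧸ N) ⁻¹' (K : Set (G ⧸ N))) := by
    have : IsClosed (N : Set G) := hN
    refine IsClosed.preimage continuous_quotient_mk' ?_
    have hT : T1Space (G ⧸ N) := by
      have := hN
      infer_instance
    exact (Set.toFinite (K : Set (G ⧸ N))).isClosed
  have huniv : ((QuotientGroup.mk : G → G ⧸ N) ⁻¹' (K : Set (G ⧸ N))) = Set.univ := by
    rw [← hcl.closure_eq]
    refine (Dense.mono ?_ hh).closure_eq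
    intro g hg
    exact Subgroup.mem_map_of_mem _ hg
  refine Finite.of_surjective (fun k : K => (k : G ⧸ N)) ?_
  rintro ⟨g⟩
  have : g ∈ ((QuotientGroup.mk : G → G ⧸ N) ⁻¹' (K : Set (G ⧸ N))) := huniv ▸ Set.mem_univ g
  exact ⟨⟨_, this⟩, rfl⟩

end CompactGroup

/-- A filtration of a topological group with the properties of the lower `p`-series of a uniform
pro-`p` group; `κ` is the initial weight. -/
structure IsUniformFiltration (p κ : ℕ) {G : Type*} [Group G] [TopologicalSpace G]
    (D : ℕ → Subgroup G) : Prop where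
  one_le : 1 ≤ κ
  two_le : p = 2 → 2 ≤ κ
  zero : D 0 = ⊤
  succ_le : ∀ i, D (i + 1) ≤ D i
  isOpen : ∀ i, IsOpen (D i : Set G)
  small : ∀ U ∈ 𝓝 (1 : G), ∃ n, (D n : Set G) ⊆ U
  normal : ∀ i, (D i).Normal
  commutator_mem : ∀ i j x y, x ∈ D i → y ∈ D j → x * y * x⁻¹ * y⁻¹ ∈ D (i + j + κ)
  pow_mem : ∀ i x, x ∈ D i → x ^ p ∈ D (i + 1)
  exists_pow : ∀ i x, x ∈ D (i + 1) → ∃ y ∈ D i, y ^ p = x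
  mul_pow : ∀ i j x y, x ∈ D i → y ∈ D j → (x ^ p * y ^ p)⁻¹ * (x * y) ^ p ∈ D (j + 2)
  of_pow_mem : ∀ i x, x ^ p ∈ D (i + 1) → x ∈ D i

/-! ### From uniform groups to uniform filtrations -/

section Uniform

open scoped commutatorElement

variable {G : Type*} [Group G] [TopologicalSpace G] {p : ℕ} [hp : Fact p.Prime]

omit [TopologicalSpace G] in
-- The p-th power map induces a surjection P_{i+1}/P_{i+2} → P_{i+2}/P_{i+3} between finite sets of
-- equal size, hence an injection. This is the only use of the constancy of the index beyond
-- finiteness.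
theorem mem_of_pow_mem_lowerPSeries {κ : ℕ} (hκ : 1 ≤ κ) (hκ2 : p = 2 → 2 ≤ κ)
    (h0 : ⁅(⊤ : Subgroup G), (⊤ : Subgroup G)⁆ ≤ lowerPSeries p G (κ + 1)) {i : ℕ}
    (hroot : ∀ g ∈ lowerPSeries p G (i + 2), ∃ x ∈ lowerPSeries p G (i + 1), x ^ p = g)
    (hne : (lowerPSeries p G (i + 2)).relIndex (lowerPSeries p G (i + 1)) ≠ 0)
    (heq : (lowerPSeries p G (i + 2)).relIndex (lowerPSeries p G (i + 1)) =
      (lowerPSeries p G (i + 3)).relIndex (lowerPSeries p G (i + 2))) {x : G}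
    (hx : x ∈ lowerPSeries p G (i + 1)) (hxp : x ^ p ∈ lowerPSeries p G (i + 3)) :
    x ∈ lowerPSeries p G (i + 2) := by
  let A := lowerPSeries p G (i + 1) ⧸ (lowerPSeries p G (i + 2)).subgroupOf (lowerPSeries p G (i + 1))
  let B := lowerPSeries p G (i + 2) ⧸ (lowerPSeries p G (i + 3)).subgroupOf (lowerPSeries p G (i + 2))
  let f₀ : lowerPSeries p G (i + 1) → lowerPSeries p G (i + 2) := fun x =>
    ⟨(x : G) ^ p, pow_mem_lowerPSeries x.2⟩
  let f : A → B := Quotient.lift (fun x => (QuotientGroup.mk (f₀ x) : B)) (by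
    rintro ⟨a, ha⟩ ⟨b, hb⟩ hab
    replace hab := QuotientGroup.eq.mp (Quotient.sound hab)
    rw [Subgroup.mem_subgroupOf] at hab
    rw [QuotientGroup.eq, Subgroup.mem_subgroupOf]
    simp only [Subgroup.coe_mul, Subgroup.coe_inv, f₀] at hab ⊢
    have h2 := mul_pow_lowerPSeries hκ hκ2 h0 ha hab
    have h3 := pow_mem_lowerPSeries hab
    rw [mul_inv_cancel_left, mul_inv_rev, mul_assoc] at h2
    have h4 := mul_mem h3 (lowerPSeries_succ_le _ h2)
    rwa [mul_inv_cancel_left] at h4)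
  have hA : Finite A := Nat.finite_of_card_ne_zero hne
  have hB : Finite B := Nat.finite_of_card_ne_zero (by rw [heq] at hne; exact hne)
  have hsurj : Function.Surjective f := by
    rintro ⟨g, hg⟩
    obtain ⟨x, hx, hxg⟩ := hroot g hg
    refine ⟨QuotientGroup.mk ⟨x, hx⟩, ?_⟩
    change (QuotientGroup.mk (f₀ ⟨x, hx⟩) : B) = QuotientGroup.mk ⟨g, hg⟩
    congr 1
    exact Subtype.ext hxg
  have hinj : Function.Injective f :=
    ((Nat.bijective_iff_surjective_and_card f).mpr ⟨hsurj, heq⟩).1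
  have h1 : f (QuotientGroup.mk ⟨x, hx⟩) = f (QuotientGroup.mk 1) := by
    change (QuotientGroup.mk (f₀ ⟨x, hx⟩) : B) = QuotientGroup.mk (f₀ 1)
    rw [QuotientGroup.eq, Subgroup.mem_subgroupOf]
    simp only [Subgroup.coe_mul, Subgroup.coe_inv, f₀, Subgroup.coe_one, one_pow, mul_one]
    exact inv_mem hxp
  have h2 := hinj h1
  rw [QuotientGroup.eq, Subgroup.mem_subgroupOf] at h2
  simpa using h2

omit [TopologicalSpace G] hp in
theorem IsPowerful.commutator_le_powSubgroup (h : IsPowerful p G) :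
    ⁅(⊤ : Subgroup G), (⊤ : Subgroup G)⁆ ≤ powSubgroup ⊤ p := by
  refine h.trans ?_
  split_ifs with h2
  · subst h2
    exact powSubgroup_le fun g _ => by
      have := pow_mem_powSubgroup (l := 2) (Subgroup.mem_top (g ^ 2))
      rwa [← pow_mul] at this
  · exact le_rfl

omit [TopologicalSpace G] hp in
theorem IsPowerful.commutator_le_lowerPSeries (h : IsPowerful p G) :
    ⁅(⊤ : Subgroup G), (⊤ : Subgroup G)⁆ ≤ lowerPSeries p G (kappa p + 1) := by
  unfold kappa
  split_ifs with h2
  · refine h.trans ?_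
    rw [if_pos h2]
    subst h2
    refine powSubgroup_le fun g hg => ?_
    have : g ^ 4 = (g ^ 2) ^ 2 := by rw [← pow_mul]
    rw [this]
    exact pow_mem_lowerPSeries (pow_mem_lowerPSeries hg)
  · exact commutator_top_le_lowerPSeries 0

theorem one_le_kappa (p : ℕ) : 1 ≤ kappa p := by unfold kappa; split_ifs <;> norm_num

theorem two_le_kappa {p : ℕ} (h : p = 2) : 2 ≤ kappa p := by simp [kappa, h]

theorem IsUniform.isUniformFiltration (hG : IsUniform p G) :
    IsUniformFiltration p (kappa p) (fun i => lowerPSeries p G (i + 1)) := by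
  have := hG.isProP.isTopologicalGroup
  have := hG.isProP.compactSpace
  have := hG.isProP.t2Space
  have hκ := one_le_kappa p
  have hκ2 := two_le_kappa (p := p)
  have h0 := hG.isPowerful.commutator_le_lowerPSeries
  have h1 := hG.isPowerful.commutator_le_powSubgroup
  have hsmall : ∀ U ∈ 𝓝 (1 : G), ∃ n, (lowerPSeries p G (n + 1) : Set G) ⊆ U :=
    fun U hU => hG.isProP.exists_lowerPSeries_subset hU
  have hcl := fun i => (lowerPSeries_eq_image_pow hκ hκ2 h0 h1 hsmall i).1
  have hroot := fun i => (lowerPSeries_eq_image_pow hκ hκ2 h0 h1 hsmall i).2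
  obtain ⟨n, h, hh⟩ := hG.topFG
  have hfin : Finite (G ⧸ lowerPSeries p G 2) := finite_quotient_of_topGenerates (p := p) hh (hcl 1)
    (commutator_top_le_lowerPSeries 0) (fun g => pow_mem_lowerPSeries (i := 0) (Subgroup.mem_top g))
  have hrel : ∀ i, (lowerPSeries p G (i + 2)).relIndex (lowerPSeries p G (i + 1)) ≠ 0 := by
    intro i
    rw [hG.relIndex_eq (i + 1) 1 (by omega) le_rfl, lowerPSeries_one, Subgroup.relIndex_top_right]
    exact Nat.card_pos.ne'
  have hidx : ∀ i, (lowerPSeries p G (i + 1)).index ≠ 0 := by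
    intro i
    induction i with
    | zero => simp [lowerPSeries_one]
    | succ i ih =>
      rw [← Subgroup.relIndex_mul_index (lowerPSeries_succ_le i)]
      exact mul_ne_zero (hrel i) ih
  have hinj : ∀ i x, x ^ p ∈ lowerPSeries p G (i + 2) → x ∈ lowerPSeries p G (i + 1) := by
    intro i x hx
    -- Climb one term at a time: if x ∈ P_{k+1} and k < i, then x^p ∈ P_{k+3}, and injectivity on
    -- the quotients gives x ∈ P_{k+2}.
    suffices ∀ k ≤ i, x ∈ lowerPSeries p G (k + 1) from this i le_rfl
    intro k
    induction k with
    | zero => intro _; exact Subgroup.mem_top x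
    | succ k ih =>
      intro hk
      exact mem_of_pow_mem_lowerPSeries hκ hκ2 h0 (hroot k) (hrel k)
        (hG.relIndex_eq _ _ (by omega) (by omega)) (ih (by omega))
        (lowerPSeries_le (by omega : k + 2 ≤ i + 1) hx)
  refine ⟨hκ, hκ2, rfl, lowerPSeries_succ_le, fun i => ?_, hsmall, fun i => inferInstance,
    fun i j x y hx hy => ?_, fun i x hx => pow_mem_lowerPSeries hx, hroot,
    fun i j x y hx hy => mul_pow_lowerPSeries hκ hκ2 h0 hx hy, hinj⟩
  · have : (lowerPSeries p G (i + 1)).FiniteIndex := ⟨hidx i⟩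
    exact Subgroup.isOpen_of_isClosed_of_finiteIndex _ (hcl i)
  · exact commutator_lowerPSeries_le h0 i j (Subgroup.commutator_mem_commutator hx hy)

end Uniform

end UniformPro
end

/-! ### Uniform filtrations and `p`-adic powers -/

noncomputable section
namespace UniformPro

/-- The quotient by a normal subgroup containing all commutators is commutative. -/
abbrev quotientCommGroup {G : Type*} [Group G] (N : Subgroup G) [N.Normal]
    (h : ∀ x y : G, x * y * x⁻¹ * y⁻¹ ∈ N) : CommGroup (G ⧸ N) :=
  { (inferInstance : Group (G ⧸ N)) with
    mul_comm := fun a b => by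
      induction a using QuotientGroup.induction_on with | H a => ?_
      induction b using QuotientGroup.induction_on with | H b => ?_
      rw [← QuotientGroup.mk_mul, ← QuotientGroup.mk_mul, eq_comm, QuotientGroup.eq]
      have := h a⁻¹ b⁻¹
      simpa [mul_assoc] using h a⁻¹ b⁻¹ }

theorem prod_ofFn_mul_of_commute {M : Type*} [Monoid M] {d : ℕ} (a c : Fin d → M)
    (hc : ∀ i x, Commute (c i) x) : (List.ofFn fun i => a i * c i).prod =
      (List.ofFn a).prod * (List.ofFn c).prod := by
  induction d with
  | zero => simp
  | succ d ih =>
    simp only [List.ofFn_succ, List.prod_cons]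
    rw [ih _ _ (fun i => hc i.succ), mul_assoc, mul_assoc, ← mul_assoc (c 0), (hc 0 _).eq,
      mul_assoc]

namespace IsUniformFiltration

variable {G : Type*} [Group G] [TopologicalSpace G] {p κ : ℕ} {D : ℕ → Subgroup G}

section Basic

theorem le_of_le (hD : IsUniformFiltration p κ D) {i j : ℕ} (h : i ≤ j) : D j ≤ D i := by
  induction h with
  | refl => exact le_rfl
  | step _ ih => exact (hD.succ_le _).trans ih

theorem mem_zero (hD : IsUniformFiltration p κ D) (x : G) : x ∈ D 0 := by
  rw [hD.zero]; exact Subgroup.mem_top x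

theorem pow_pow_mem (hD : IsUniformFiltration p κ D) {i : ℕ} {x : G} (hx : x ∈ D i) (n : ℕ) :
    x ^ p ^ n ∈ D (i + n) := by
  induction n with
  | zero => simpa using hx
  | succ n ih => rw [pow_succ, pow_mul]; exact hD.pow_mem _ _ ih

theorem exists_pow_pow (hD : IsUniformFiltration p κ D) {i n : ℕ} {x : G} (hx : x ∈ D (i + n)) :
    ∃ y ∈ D i, y ^ p ^ n = x := by
  induction n generalizing x with
  | zero => exact ⟨x, hx, by simp⟩
  | succ n ih =>
    obtain ⟨y, hy, rfl⟩ := hD.exists_pow _ _ hx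
    obtain ⟨z, hz, rfl⟩ := ih hy
    exact ⟨z, hz, by rw [pow_succ, pow_mul]⟩

theorem of_pow_pow_mem (hD : IsUniformFiltration p κ D) {i n : ℕ} {x : G}
    (hx : x ^ p ^ n ∈ D (i + n)) : x ∈ D i := by
  induction n with
  | zero => simpa using hx
  | succ n ih =>
    rw [pow_succ, pow_mul] at hx
    exact ih (hD.of_pow_mem _ _ hx)

/-- Write (xy)^(p^n) = XYe with e ∈ D (n+1). Raising to the p-th power moves e one step deeper, and
the errors of multiplicativity lie in D (n+2). -/
theorem mul_pow_pow (hD : IsUniformFiltration p κ D) (x y : G) (n : ℕ) :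
    (x ^ p ^ n * y ^ p ^ n)⁻¹ * (x * y) ^ p ^ n ∈ D (n + 1) := by
  induction n with
  | zero => simp
  | succ n ih =>
    set X := x ^ p ^ n with hX
    set Y := y ^ p ^ n with hY
    set e := (X * Y)⁻¹ * (x * y) ^ p ^ n with he
    have hXm : X ∈ D n := by simpa using hD.pow_pow_mem (hD.mem_zero x) n
    have hYm : Y ∈ D n := by simpa using hD.pow_pow_mem (hD.mem_zero y) n
    have h1 := hD.mul_pow n (n + 1) (X * Y) e (mul_mem hXm hYm) ih
    have h2 := hD.mul_pow n n X Y hXm hYm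
    have h3 := hD.pow_mem _ _ ih
    rw [pow_succ, pow_mul, pow_mul, pow_mul, ← hX, ← hY]
    have h4 : (x * y) ^ p ^ n = X * Y * e := by rw [he]; group
    rw [h4]
    have h5 : (X ^ p * Y ^ p)⁻¹ * (X * Y * e) ^ p = ((X ^ p * Y ^ p)⁻¹ * (X * Y) ^ p) * (e ^ p) *
        (((X * Y) ^ p * e ^ p)⁻¹ * (X * Y * e) ^ p) := by group
    rw [h5]
    exact mul_mem (mul_mem h2 h3) (hD.succ_le _ h1)

theorem mk_mul_pow_pow (hD : IsUniformFiltration p κ D) (x y : G) (n : ℕ) :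
    ((((x * y) ^ p ^ n : G)) : G ⧸ D (n + 1)) = ((x ^ p ^ n * y ^ p ^ n : G) : G ⧸ D (n + 1)) :=
  (QuotientGroup.eq.mpr (hD.mul_pow_pow x y n)).symm

theorem mk_list_prod_pow_pow (hD : IsUniformFiltration p κ D) (l : List G) (n : ℕ) :
    ((l.prod ^ p ^ n : G) : G ⧸ D (n + 1)) =
      (((l.map fun x => x ^ p ^ n).prod : G) : G ⧸ D (n + 1)) := by
  have := hD.normal (n + 1)
  induction l with
  | nil => simp
  | cons a l ih =>
    rw [List.prod_cons, hD.mk_mul_pow_pow, QuotientGroup.mk_mul, ih, List.map_cons, List.prod_cons,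
      QuotientGroup.mk_mul]

theorem mk_commute (hD : IsUniformFiltration p κ D) {i n : ℕ} (hn : n ≤ i + κ)
    [(D n).Normal] {x : G} (hx : x ∈ D i) (y : G ⧸ D n) : Commute (x : G ⧸ D n) y := by
  induction y using QuotientGroup.induction_on with | H y => ?_
  have h := hD.commutator_mem i 0 x⁻¹ y⁻¹ (inv_mem hx) (hD.mem_zero _)
  have h2 := hD.le_of_le (by omega : n ≤ i + 0 + κ) h
  refine Eq.symm ?_
  change ((y * x : G) : G ⧸ D n) = ((x * y : G) : G ⧸ D n)
  rw [QuotientGroup.eq]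
  simpa [mul_assoc] using h2

theorem commutator_mem_one (hD : IsUniformFiltration p κ D) (x y : G) :
    x * y * x⁻¹ * y⁻¹ ∈ D 1 :=
  hD.le_of_le (by have := hD.one_le; omega)
    (hD.commutator_mem 0 0 x y (hD.mem_zero _) (hD.mem_zero _))

theorem eq_of_forall_mem [T2Space G] [IsTopologicalGroup G] (hD : IsUniformFiltration p κ D)
    {x y : G} (h : ∀ n, x⁻¹ * y ∈ D n) : x = y := by
  by_contra hne
  have h1 : x⁻¹ * y ≠ 1 := fun h => hne (inv_mul_eq_one.mp h)
  obtain ⟨n, hn⟩ := hD.small {x⁻¹ * y}ᶜ (isOpen_compl_singleton.mem_nhds (Ne.symm h1))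
  exact hn (h n) rfl

theorem isClosed [IsTopologicalGroup G] (hD : IsUniformFiltration p κ D) (n : ℕ) :
    IsClosed (D n : Set G) := Subgroup.isClosed_of_isOpen _ (hD.isOpen n)

theorem mem_nhds_one (hD : IsUniformFiltration p κ D) (n : ℕ) : (D n : Set G) ∈ 𝓝 (1 : G) :=
  (hD.isOpen n).mem_nhds (one_mem _)

theorem mk_pow_eq (hD : IsUniformFiltration p κ D) {i n : ℕ} {g : G} (hg : g ∈ D i) {a b : ℤ}
    (h : (p ^ n : ℤ) ∣ b - a) : (g ^ a)⁻¹ * g ^ b ∈ D (i + n) := by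
  obtain ⟨k, hk⟩ := h
  have : (g ^ a)⁻¹ * g ^ b = (g ^ p ^ n) ^ k := by
    rw [← zpow_neg, ← zpow_add, ← zpow_natCast, ← zpow_mul, Nat.cast_pow, ← hk]
    congr 1; ring
  rw [this]
  exact zpow_mem (hD.pow_pow_mem hg n) k

/-- Compactness supplies a cluster point, and the Cauchy hypothesis turns it into a limit. -/
theorem tendsto_of_approx [IsTopologicalGroup G] [CompactSpace G]
    (hD : IsUniformFiltration p κ D) (u : ℕ → G) (hu : ∀ m n, n ≤ m → (u n)⁻¹ * u m ∈ D n) :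
    ∃ c, Filter.Tendsto u Filter.atTop (𝓝 c) := by
  obtain ⟨c, hc⟩ := exists_clusterPt_of_compactSpace (Filter.map u Filter.atTop)
  refine ⟨c, ?_⟩
  rw [Filter.tendsto_iff_forall_eventually_mem]
  intro U hU
  have hV : (fun z : G => c * z) ⁻¹' U ∈ 𝓝 (1 : G) :=
    ContinuousAt.preimage_mem_nhds (by fun_prop) (by simpa using hU)
  obtain ⟨k, hk⟩ := hD.small _ hV
  have hck : {z : G | c⁻¹ * z ∈ D k} ∈ 𝓝 c :=
    ContinuousAt.preimage_mem_nhds (f := fun z : G => c⁻¹ * z) (by fun_prop)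
      (by simpa using hD.mem_nhds_one k)
  obtain ⟨n, hn, hnk⟩ := (Filter.frequently_atTop.mp (mapClusterPt_iff_frequently.mp hc _ hck)) k
  refine Filter.eventually_atTop.mpr ⟨n, fun m hm => ?_⟩
  have h1 : c⁻¹ * u m ∈ D k := by
    have := mul_mem hnk (hD.le_of_le hn (hu m n hm))
    simpa [mul_assoc] using this
  have := hk h1
  simpa using this

end Basic

section PadicPow

variable [hp : Fact p.Prime] [IsTopologicalGroup G] [CompactSpace G] [T2Space G]

omit [T2Space G] in
theorem tendsto_padicPow (hD : IsUniformFiltration p κ D) (g : G) (x : ℤ_[p]) :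
    Filter.Tendsto (fun n : ℕ => g ^ x.appr n) Filter.atTop (𝓝 (padicPow g x)) := by
  refine tendsto_nhds_limUnder ?_
  refine hD.tendsto_of_approx _ fun m n hnm => ?_
  have h := hD.mk_pow_eq (hD.mem_zero g) (a := x.appr n) (b := x.appr m) (n := n) ?_
  · simpa using h
  · have := PadicInt.dvd_appr_sub_appr x n m hnm
    have h2 := PadicInt.appr_mono x hnm
    obtain ⟨k, hk⟩ := this
    refine ⟨k, ?_⟩
    rw [← Nat.cast_sub h2, hk]; push_cast; ring

omit [T2Space G] in
-- Source of the laws of p-adic powers: modulo each D n the exponent may be replaced by an integer,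
-- and in a Hausdorff group the D n separate points.
theorem padicPow_approx (hD : IsUniformFiltration p κ D) {i n : ℕ} {g : G} (hg : g ∈ D i)
    {x : ℤ_[p]} {a : ℤ} (h : x - a ∈ Ideal.span {(p : ℤ_[p]) ^ n}) :
    (g ^ a)⁻¹ * padicPow g x ∈ D (i + n) := by
  have ht : Filter.Tendsto (fun m : ℕ => (g ^ a)⁻¹ * g ^ x.appr m) Filter.atTop
      (𝓝 ((g ^ a)⁻¹ * padicPow g x)) := (hD.tendsto_padicPow g x).const_mul _
  refine (hD.isClosed (i + n)).mem_of_tendsto ht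
    (Filter.eventually_atTop.mpr ⟨n, fun m hm => ?_⟩)
  have key := hD.mk_pow_eq hg (a := a) (b := x.appr m) (n := n) ?_
  · simpa using key
  · have h1 := PadicInt.appr_spec m x
    have h2 : x - x.appr m ∈ Ideal.span {(p : ℤ_[p]) ^ n} :=
      Ideal.span_singleton_le_span_singleton.mpr (pow_dvd_pow _ hm) h1
    have h3 := sub_mem h h2
    rw [sub_sub_sub_cancel_left, Ideal.mem_span_singleton] at h3
    rw [← PadicInt.pow_p_dvd_int_iff]
    push_cast
    exact h3

theorem exists_nat_approx (x : ℤ_[p]) (n : ℕ) :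
    ∃ a : ℕ, x - (a : ℤ) ∈ Ideal.span {(p : ℤ_[p]) ^ n} :=
  ⟨x.appr n, by simpa using PadicInt.appr_spec n x⟩

omit [T2Space G] in
theorem padicPow_mk (hD : IsUniformFiltration p κ D) {n : ℕ} (g : G)
    {x : ℤ_[p]} {a : ℤ} (h : x - a ∈ Ideal.span {(p : ℤ_[p]) ^ n}) :
    ((padicPow g x : G) : G ⧸ D n) = ((g ^ a : G) : G ⧸ D n) :=
  (QuotientGroup.eq.mpr (by simpa using hD.padicPow_approx (hD.mem_zero g) h)).symm

theorem padicPow_intCast (hD : IsUniformFiltration p κ D) (g : G) (a : ℤ) :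
    padicPow g (a : ℤ_[p]) = g ^ a := by
  refine (hD.eq_of_forall_mem fun n => ?_).symm
  have := hD.padicPow_approx (n := n) (hD.mem_zero g) (x := (a : ℤ_[p])) (a := a) (by simp)
  simpa using this

theorem padicPow_natCast (hD : IsUniformFiltration p κ D) (g : G) (a : ℕ) :
    padicPow g (a : ℤ_[p]) = g ^ a := by
  simpa using hD.padicPow_intCast g a

theorem padicPow_add (hD : IsUniformFiltration p κ D) (g : G) (x y : ℤ_[p]) :
    padicPow g (x + y) = padicPow g x * padicPow g y := by
  refine hD.eq_of_forall_mem fun n => ?_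
  rw [← QuotientGroup.eq]
  have := hD.normal n
  obtain ⟨a, ha⟩ := exists_nat_approx x n
  obtain ⟨b, hb⟩ := exists_nat_approx y n
  have hab : x + y - ((a + b : ℤ) : ℤ_[p]) ∈ Ideal.span {(p : ℤ_[p]) ^ n} := by
    have := add_mem ha hb
    push_cast at this ⊢
    rwa [add_sub_add_comm]
  have h1 := hD.padicPow_mk g ha
  have h2 := hD.padicPow_mk g hb
  have h3 := hD.padicPow_mk g hab
  rw [QuotientGroup.mk_mul, h1, h2, h3, zpow_add, QuotientGroup.mk_mul]

theorem padicPow_mul_natCast (hD : IsUniformFiltration p κ D) (g : G) (a : ℕ) (x : ℤ_[p]) :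
    padicPow g ((a : ℤ_[p]) * x) = padicPow g x ^ a := by
  induction a with
  | zero => simpa using hD.padicPow_natCast g 0
  | succ a ih => rw [Nat.cast_succ, add_mul, one_mul, hD.padicPow_add, ih, pow_succ]

omit [T2Space G] in
theorem padicPow_mem (hD : IsUniformFiltration p κ D) {i n : ℕ} {g : G} (hg : g ∈ D i)
    {x : ℤ_[p]} (h : x ∈ Ideal.span {(p : ℤ_[p]) ^ n}) : padicPow g x ∈ D (i + n) := by
  simpa using hD.padicPow_approx hg (x := x) (a := 0) (by simpa using h)

end PadicPow

end IsUniformFiltration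

end UniformPro
end

/-! ### Frattini bases and ordered products -/

noncomputable section
namespace UniformPro

/-- The elements `h i` form a basis of the quotient by the second term of a filtration. -/
structure IsFrattiniBasis (p : ℕ) {G : Type*} [Group G] (D : ℕ → Subgroup G) {d : ℕ}
    (h : Fin d → G) : Prop where
  span : ∀ g : G, ∃ c : Fin d → ℕ, ((List.ofFn fun i => h i ^ c i).prod)⁻¹ * g ∈ D 1
  indep : ∀ c : Fin d → ℕ, (List.ofFn fun i => h i ^ c i).prod ∈ D 1 → ∀ i, p ∣ c i

theorem mk_prod_ofFn {G : Type*} [Group G] (N : Subgroup G) [N.Normal] {d : ℕ} (a : Fin d → G) :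
    (((List.ofFn a).prod : G) : G ⧸ N) = (List.ofFn fun i => (a i : G ⧸ N)).prod := by
  have := map_list_prod (QuotientGroup.mk' N) (List.ofFn a)
  rw [List.map_ofFn] at this
  exact this

namespace IsUniformFiltration

variable {G : Type*} [Group G] [TopologicalSpace G] {p κ : ℕ} {D : ℕ → Subgroup G} {d : ℕ}

/-- An error in D n is a p^n-th power of some y. If z ∈ H approximates y modulo D 1, then z^(p^n)
removes the error modulo D (n+1). -/
theorem exists_mem_approx (hD : IsUniformFiltration p κ D) {H : Subgroup G}
    (hH : ∀ g, ∃ k ∈ H, k⁻¹ * g ∈ D 1) (n : ℕ) (g : G) : ∃ k ∈ H, k⁻¹ * g ∈ D n := by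
  induction n with
  | zero => exact ⟨1, one_mem _, hD.mem_zero _⟩
  | succ n ih =>
    obtain ⟨k, hk, hkg⟩ := ih
    obtain ⟨y, -, hy⟩ := hD.exists_pow_pow (i := 0) (n := n) (by simpa using hkg)
    obtain ⟨z, hz, hzy⟩ := hH y
    refine ⟨k * z ^ p ^ n, mul_mem hk (_root_.pow_mem hz _), ?_⟩
    have h1 := hD.mul_pow_pow z (z⁻¹ * y) n
    have h2 := hD.pow_pow_mem hzy n
    rw [add_comm] at h2
    rw [mul_inv_cancel_left, hy] at h1
    have := mul_mem h2 h1
    simpa [mul_assoc] using this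

theorem topGenerates_of_approx [IsTopologicalGroup G] (hD : IsUniformFiltration p κ D)
    {h : Fin d → G} (hh : ∀ g, ∃ k ∈ Subgroup.closure (Set.range h), k⁻¹ * g ∈ D 1) :
    TopGenerates h := by
  intro g
  rw [mem_closure_iff_nhds]
  intro U hU
  have hV : (fun z : G => g * z⁻¹) ⁻¹' U ∈ 𝓝 (1 : G) :=
    ContinuousAt.preimage_mem_nhds (by fun_prop) (by simpa using hU)
  obtain ⟨n, hn⟩ := hD.small _ hV
  obtain ⟨k, hk, hkg⟩ := hD.exists_mem_approx hh n g
  exact ⟨k, by simpa using hn hkg, hk⟩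

theorem exists_closure_approx [IsTopologicalGroup G] (hD : IsUniformFiltration p κ D)
    {h : Fin d → G} (hh : TopGenerates h) (g : G) :
    ∃ k ∈ Subgroup.closure (Set.range h), k⁻¹ * g ∈ D 1 := by
  have hV : {z : G | z⁻¹ * g ∈ D 1} ∈ 𝓝 g :=
    ContinuousAt.preimage_mem_nhds (f := fun z : G => z⁻¹ * g) (by fun_prop)
      (by simpa using hD.mem_nhds_one 1)
  obtain ⟨k, hk, hk2⟩ := mem_closure_iff_nhds.mp (hh g) _ hV
  exact ⟨k, hk2, hk⟩

/-- In the abelian quotient G/D 1 of exponent p, a relation with exponent c j prime to p can be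
solved for h j by Bézout. -/
theorem mem_closure_of_prod_mem (hD : IsUniformFiltration p κ D) [hp : Fact p.Prime]
    {h : Fin d → G} {c : Fin d → ℕ} (hc : (List.ofFn fun i => h i ^ c i).prod ∈ D 1)
    {j : Fin d} (hj : ¬ p ∣ c j) {K : Subgroup G} (hK : D 1 ≤ K) (hjK : ∀ i ≠ j, h i ∈ K) :
    h j ∈ K := by
  have := hD.normal 1
  let _ := quotientCommGroup (D 1) hD.commutator_mem_one
  have h1 : ∏ i, (h i : G ⧸ D 1) ^ c i = 1 := by
    rw [← QuotientGroup.eq_one_iff, mk_prod_ofFn, List.prod_ofFn] at hc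
    simpa using hc
  have hmem : ∀ g : G, (g : G ⧸ D 1) ∈ K.map (QuotientGroup.mk' (D 1)) → g ∈ K := by
    rintro g ⟨k, hk, hkg⟩
    have : k⁻¹ * g ∈ D 1 := QuotientGroup.eq.mp hkg
    simpa using mul_mem hk (hK this)
  apply hmem
  have h2 : (h j : G ⧸ D 1) ^ c j ∈ K.map (QuotientGroup.mk' (D 1)) := by
    rw [← Finset.mul_prod_erase _ _ (Finset.mem_univ j)] at h1
    rw [eq_inv_of_mul_eq_one_left h1]
    refine inv_mem (Subgroup.prod_mem _ fun i hi => _root_.pow_mem ?_ _)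
    exact ⟨h i, hjK i (Finset.ne_of_mem_erase hi), rfl⟩
  have h3 : (h j : G ⧸ D 1) ^ p = 1 :=
    (QuotientGroup.eq_one_iff (h j ^ p)).mpr (hD.pow_mem 0 _ (hD.mem_zero _))
  have hcop : IsCoprime (c j : ℤ) (p : ℤ) :=
    Nat.isCoprime_iff_coprime.mpr ((Nat.Prime.coprime_iff_not_dvd hp.out).mpr hj).symm
  obtain ⟨a, b, hab⟩ := hcop
  have h4 : (h j : G ⧸ D 1) = ((h j : G ⧸ D 1) ^ c j) ^ a * ((h j : G ⧸ D 1) ^ p) ^ b := by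
    rw [← zpow_natCast, ← zpow_natCast, ← zpow_mul, ← zpow_mul, ← zpow_add, mul_comm _ a,
      mul_comm _ b, hab, zpow_one]
  rw [h4, h3, one_zpow, mul_one]
  exact zpow_mem h2 a

theorem isFrattiniBasis [hp : Fact p.Prime] [IsTopologicalGroup G]
    (hD : IsUniformFiltration p κ D) (hd : HasDim G d) {h : Fin d → G} (hh : TopGenerates h) :
    IsFrattiniBasis p D h := by
  constructor
  · intro g
    obtain ⟨k, hk, hkg⟩ := hD.exists_closure_approx hh g
    have := hD.normal 1
    let _ := quotientCommGroup (D 1) hD.commutator_mem_one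
    have hprod : ∀ c : Fin d → ℕ, (((List.ofFn fun i => h i ^ c i).prod : G) : G ⧸ D 1) =
        ∏ i, (h i : G ⧸ D 1) ^ c i := fun c => by
      rw [mk_prod_ofFn, List.prod_ofFn]; simp
    suffices H : ∃ c : Fin d → ℕ, ∏ i, (h i : G ⧸ D 1) ^ c i = (k : G ⧸ D 1) by
      obtain ⟨c, hc⟩ := H
      refine ⟨c, ?_⟩
      rw [← QuotientGroup.eq, hprod, hc, QuotientGroup.eq]
      exact hkg
    clear hkg
    induction hk using Subgroup.closure_induction with
    | mem x hx =>
      obtain ⟨j, rfl⟩ := hx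
      refine ⟨Pi.single j 1, ?_⟩
      rw [Finset.prod_eq_single j]
      · simp
      · intro i _ hi; simp [hi]
      · simp
    | one => exact ⟨0, by simp⟩
    | mul x y _ _ hx hy =>
      obtain ⟨a, ha⟩ := hx
      obtain ⟨b, hb⟩ := hy
      refine ⟨a + b, ?_⟩
      rw [QuotientGroup.mk_mul, ← ha, ← hb, ← Finset.prod_mul_distrib]
      simp [pow_add]
    | inv x _ hx =>
      obtain ⟨a, ha⟩ := hx
      refine ⟨(p - 1) • a, ?_⟩
      have h3 : (x : G ⧸ D 1) ^ p = 1 :=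
        (QuotientGroup.eq_one_iff (x ^ p)).mpr (hD.pow_mem 0 _ (hD.mem_zero _))
      have h4 : (x : G ⧸ D 1)⁻¹ = (x : G ⧸ D 1) ^ (p - 1) := by
        rw [eq_comm, ← mul_eq_one_iff_eq_inv, ← pow_succ, Nat.sub_add_cancel hp.out.one_le, h3]
      rw [QuotientGroup.mk_inv, h4, ← ha, ← Finset.prod_pow]
      refine Finset.prod_congr rfl fun i _ => ?_
      rw [← pow_mul, Pi.smul_apply, smul_eq_mul, mul_comm]
  · intro c hc j
    by_contra hj
    cases d with
    | zero => exact j.elim0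
    | succ d =>
      -- A relation with p ∤ c j makes h j redundant modulo D 1, so the remaining elements still
      -- generate topologically, against the minimality of the number of generators.
      have hgen : TopGenerates (h ∘ j.succAbove) := by
        apply hD.topGenerates_of_approx
        have := hD.normal 1
        have hK : Subgroup.closure (Set.range (h ∘ j.succAbove)) ⊔ D 1 = ⊤ := by
          rw [eq_top_iff]
          intro g _
          set K := Subgroup.closure (Set.range (h ∘ j.succAbove)) ⊔ D 1 with hKdef
          obtain ⟨k, hk, hkg⟩ := hD.exists_closure_approx hh g
          have hKi : ∀ i ≠ j, h i ∈ K := by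
            intro i hi
            obtain ⟨l, rfl⟩ := Fin.exists_succAbove_eq hi
            exact (le_sup_left : _ ≤ K) (Subgroup.subset_closure ⟨l, rfl⟩)
          have hKj : h j ∈ K := hD.mem_closure_of_prod_mem hc hj le_sup_right hKi
          have hle : Subgroup.closure (Set.range h) ≤ K := by
            rw [Subgroup.closure_le]
            rintro _ ⟨i, rfl⟩
            by_cases hi : i = j
            · exact hi ▸ hKj
            · exact hKi i hi
          have := mul_mem (hle hk) ((le_sup_right : _ ≤ K) hkg)
          simpa using this
        intro g
        have hg : g ∈ Subgroup.closure (Set.range (h ∘ j.succAbove)) ⊔ D 1 := by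
          rw [hK]; trivial
        rw [Subgroup.mem_sup_of_normal_right] at hg
        obtain ⟨y, hy, z, hz, rfl⟩ := hg
        exact ⟨y, hy, by simpa using hz⟩
      have := hd.2 ⟨_, hgen⟩
      omega

section OrderedProd

variable [hp : Fact p.Prime] [IsTopologicalGroup G] [CompactSpace G] [T2Space G]
  {h : Fin d → G}

theorem orderedProd_natCast (hD : IsUniformFiltration p κ D) (c : Fin d → ℕ) :
    orderedProd h (fun i => (c i : ℤ_[p])) = (List.ofFn fun i => h i ^ c i).prod := by
  simp only [orderedProd, hD.padicPow_natCast]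

theorem orderedProd_zero (hD : IsUniformFiltration p κ D) :
    orderedProd h (0 : Fin d → ℤ_[p]) = 1 := by
  have := hD.orderedProd_natCast (h := h) 0
  change orderedProd h (fun _ => (0 : ℤ_[p])) = 1
  simpa using this

/-- Modulo D (m+1) all p^m-th powers are central, so the corrections can be collected on the right,
where their product is the p^m-th power of an ordered product. -/
theorem mk_orderedProd_add (hD : IsUniformFiltration p κ D) (m : ℕ) (x z : Fin d → ℤ_[p]) :
    ((orderedProd h (fun i => x i + (p : ℤ_[p]) ^ m * z i) : G) : G ⧸ D (m + 1)) =
      ((orderedProd h x * orderedProd h z ^ p ^ m : G) : G ⧸ D (m + 1)) := by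
  have := hD.normal (m + 1)
  have e : ∀ i, padicPow (h i) (x i + (p : ℤ_[p]) ^ m * z i) =
      padicPow (h i) (x i) * padicPow (h i) (z i) ^ p ^ m := fun i => by
    rw [hD.padicPow_add, ← Nat.cast_pow, hD.padicPow_mul_natCast]
  rw [QuotientGroup.mk_mul, orderedProd, orderedProd, orderedProd, hD.mk_list_prod_pow_pow,
    List.map_ofFn, mk_prod_ofFn, mk_prod_ofFn, mk_prod_ofFn, ← prod_ofFn_mul_of_commute]
  · simp only [e, QuotientGroup.mk_mul]
    rfl
  · intro i y
    exact hD.mk_commute (i := m) (by have := hD.one_le; omega)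
      (by simpa using hD.pow_pow_mem (hD.mem_zero (padicPow (h i) (z i))) m) y

omit [T2Space G] in
theorem orderedProd_mem_one (hD : IsUniformFiltration p κ D) (hb : IsFrattiniBasis p D h)
    {z : Fin d → ℤ_[p]} (hz : orderedProd h z ∈ D 1) (i : Fin d) : (p : ℤ_[p]) ∣ z i := by
  have := hD.normal 1
  have h1 : ((orderedProd h z : G) : G ⧸ D 1) =
      (((List.ofFn fun i => h i ^ (z i).appr 1).prod : G) : G ⧸ D 1) := by
    rw [orderedProd, mk_prod_ofFn, mk_prod_ofFn]
    congr 2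
    funext i
    have h2 : z i - (((z i).appr 1 : ℤ) : ℤ_[p]) ∈ Ideal.span {(p : ℤ_[p]) ^ 1} := by
      simpa using PadicInt.appr_spec 1 (z i)
    have := hD.padicPow_mk (h i) h2
    simpa using this
  rw [(QuotientGroup.eq_one_iff _).mpr hz, eq_comm, QuotientGroup.eq_one_iff] at h1
  have h3 := hb.indep _ h1 i
  have h4 := PadicInt.appr_spec 1 (z i)
  rw [Ideal.mem_span_singleton, pow_one] at h4
  have h5 : (p : ℤ_[p]) ∣ ((z i).appr 1 : ℤ_[p]) := by exact_mod_cast (Nat.cast_dvd_cast h3)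
  simpa using dvd_add h4 h5

/-- The ordered product carries congruence modulo p^m to congruence modulo D m; injectivity and
continuity are consequences. If y = x + p^m z, the quotient is congruent to the p^m-th power of the
ordered product of z modulo D (m+1). It lies there only if that product lies in D 1, which by
independence means p ∣ z. -/
theorem orderedProd_inv_mul_mem (hD : IsUniformFiltration p κ D) (hb : IsFrattiniBasis p D h)
    {x y : Fin d → ℤ_[p]} {m : ℕ} :
    (orderedProd h x)⁻¹ * orderedProd h y ∈ D m ↔ ∀ i, (p : ℤ_[p]) ^ m ∣ y i - x i := by
  have key : ∀ (m : ℕ) (z : Fin d → ℤ_[p]), (∀ i, y i = x i + (p : ℤ_[p]) ^ m * z i) →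
      ((orderedProd h z ^ p ^ m)⁻¹ * ((orderedProd h x)⁻¹ * orderedProd h y) ∈ D (m + 1)) := by
    intro m z hz
    have h1 := hD.mk_orderedProd_add (h := h) m x z
    rw [← funext hz, eq_comm, QuotientGroup.eq] at h1
    simpa [mul_assoc] using h1
  constructor
  · induction m with
    | zero => intro _ i; simp
    | succ m ih =>
      intro hm
      have hdvd := ih (hD.succ_le _ hm)
      choose z hz using hdvd
      have hz' : ∀ i, y i = x i + (p : ℤ_[p]) ^ m * z i := fun i => by rw [← hz i]; ring
      have h1 := key m z hz'
      have h2 : orderedProd h z ^ p ^ m ∈ D (m + 1) := by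
        have := mul_mem hm (inv_mem h1)
        simpa [mul_assoc] using this
      rw [add_comm] at h2
      have h3 := hD.orderedProd_mem_one hb (hD.of_pow_pow_mem h2)
      intro i
      obtain ⟨t, ht⟩ := h3 i
      exact ⟨t, by rw [hz i, ht, pow_succ]; ring⟩
  · intro hdvd
    choose z hz using hdvd
    have hz' : ∀ i, y i = x i + (p : ℤ_[p]) ^ m * z i := fun i => by rw [← hz i]; ring
    have h1 := hD.succ_le _ (key m z hz')
    have h2 : orderedProd h z ^ p ^ m ∈ D m := by
      simpa using hD.pow_pow_mem (hD.mem_zero (orderedProd h z)) m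
    simpa using mul_mem h2 h1

theorem orderedProd_mem_iff (hD : IsUniformFiltration p κ D) (hb : IsFrattiniBasis p D h)
    {x : Fin d → ℤ_[p]} {m : ℕ} :
    orderedProd h x ∈ D m ↔ ∀ i, (p : ℤ_[p]) ^ m ∣ x i := by
  have := hD.orderedProd_inv_mul_mem hb (x := 0) (y := x) (m := m)
  simpa [hD.orderedProd_zero] using this

theorem orderedProd_injective (hD : IsUniformFiltration p κ D) (hb : IsFrattiniBasis p D h) :
    Function.Injective (orderedProd (p := p) h) := by
  intro x y hxy
  funext i
  have h1 : ∀ m : ℕ, (p : ℤ_[p]) ^ m ∣ y i - x i := fun m =>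
    (hD.orderedProd_inv_mul_mem hb).mp (by rw [hxy]; simp) i
  rw [← PadicInt.ext_of_toZModPow]
  intro n
  rw [eq_comm, ← sub_eq_zero, ← map_sub, ← RingHom.mem_ker, PadicInt.ker_toZModPow,
    Ideal.mem_span_singleton]
  exact h1 n

theorem exists_orderedProd_approx (hD : IsUniformFiltration p κ D) (hb : IsFrattiniBasis p D h)
    (g : G) (n : ℕ) : ∃ x : Fin d → ℤ_[p], (orderedProd h x)⁻¹ * g ∈ D n := by
  induction n with
  | zero => exact ⟨0, hD.mem_zero _⟩
  | succ n ih =>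
    obtain ⟨x, hx⟩ := ih
    obtain ⟨y, -, hy⟩ := hD.exists_pow_pow (i := 0) (n := n) (by simpa using hx)
    obtain ⟨c, hc⟩ := hb.span y
    rw [← hD.orderedProd_natCast] at hc
    refine ⟨fun i => x i + (p : ℤ_[p]) ^ n * (c i : ℤ_[p]), ?_⟩
    have := hD.normal (n + 1)
    rw [← QuotientGroup.eq, hD.mk_orderedProd_add, QuotientGroup.mk_mul]
    set F := orderedProd h fun i => (c i : ℤ_[p]) with hF
    have h1 := hD.mul_pow_pow F (F⁻¹ * y) n
    have h2 := hD.pow_pow_mem hc n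
    rw [add_comm] at h2
    rw [mul_inv_cancel_left, hy] at h1
    have h3 := mul_mem h2 h1
    rw [← QuotientGroup.mk_mul, QuotientGroup.eq]
    simpa [mul_assoc] using h3

theorem continuous_orderedProd (hD : IsUniformFiltration p κ D) (hb : IsFrattiniBasis p D h) :
    Continuous (orderedProd (p := p) h) := by
  rw [continuous_iff_continuousAt]
  intro x
  rw [ContinuousAt, Filter.tendsto_iff_forall_eventually_mem]
  intro U hU
  have hV : (fun z : G => orderedProd h x * z) ⁻¹' U ∈ 𝓝 (1 : G) :=
    ContinuousAt.preimage_mem_nhds (by fun_prop) (by simpa using hU)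
  obtain ⟨n, hn⟩ := hD.small _ hV
  have hpos : (0 : ℝ) < (p : ℝ) ^ (-n : ℤ) := zpow_pos (by exact_mod_cast hp.out.pos) _
  filter_upwards [Metric.ball_mem_nhds x hpos] with y hy
  have : (orderedProd h x)⁻¹ * orderedProd h y ∈ D n := by
    rw [hD.orderedProd_inv_mul_mem hb]
    intro i
    rw [← Ideal.mem_span_singleton, ← PadicInt.norm_le_pow_iff_mem_span_pow]
    have h1 := (dist_le_pi_dist y x i).trans (Metric.mem_ball.mp hy).le
    rwa [dist_eq_norm] at h1
  simpa using hn this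

theorem orderedProd_surjective (hD : IsUniformFiltration p κ D) (hb : IsFrattiniBasis p D h) :
    Function.Surjective (orderedProd (p := p) h) := by
  have hcl : IsClosed (Set.range (orderedProd (p := p) h)) :=
    (isCompact_range (hD.continuous_orderedProd hb)).isClosed
  intro g
  suffices g ∈ closure (Set.range (orderedProd (p := p) h)) by
    rwa [hcl.closure_eq] at this
  rw [mem_closure_iff_nhds]
  intro U hU
  have hV : (fun z : G => g * z⁻¹) ⁻¹' U ∈ 𝓝 (1 : G) :=
    ContinuousAt.preimage_mem_nhds (by fun_prop) (by simpa using hU)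
  obtain ⟨n, hn⟩ := hD.small _ hV
  obtain ⟨x, hx⟩ := hD.exists_orderedProd_approx hb g n
  exact ⟨_, by simpa using hn hx, x, rfl⟩

/-- The ordered product as a homeomorphism. -/
def orderedProdHomeomorph (hD : IsUniformFiltration p κ D) (hb : IsFrattiniBasis p D h) :
    (Fin d → ℤ_[p]) ≃ₜ G :=
  Continuous.homeoOfEquivCompactToT2
    (f := Equiv.ofBijective (orderedProd (p := p) h)
      ⟨hD.orderedProd_injective hb, hD.orderedProd_surjective hb⟩)
    (hD.continuous_orderedProd hb)

end OrderedProd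

end IsUniformFiltration

end UniformPro
end

/-! ### The `p`-valuation of a uniform filtration -/

noncomputable section
namespace UniformPro

theorem prod_ofFn_pow_single {M : Type*} [Monoid M] {d : ℕ} (h : Fin d → M) (i : Fin d) :
    (List.ofFn fun j => h j ^ (Pi.single i 1 : Fin d → ℕ) j).prod = h i := by
  induction d with
  | zero => exact i.elim0
  | succ d ih =>
    rw [List.ofFn_succ, List.prod_cons]
    cases i using Fin.cases with
    | zero => simp
    | succ i =>
      have : ∀ j : Fin d, (Pi.single i.succ 1 : Fin (d + 1) → ℕ) j.succ =
          (Pi.single i 1 : Fin d → ℕ) j := fun j => by simp [Pi.single_apply]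
      simp only [this, ih]
      simp

section Valuation

variable {G : Type*} [Group G]

open Classical in
/-- The function `w` with `w g = κ + n` for `g ∈ D n ∖ D (n + 1)`. -/
def filtrationVal (κ : ℕ) (D : ℕ → Subgroup G) (g : G) : WithTop ℝ :=
  if h : ∃ n, g ∉ D (n + 1) then (((κ + Nat.find h : ℕ) : ℝ) : WithTop ℝ) else ⊤

end Valuation

namespace IsUniformFiltration

variable {G : Type*} [Group G] [TopologicalSpace G] {p κ : ℕ} {D : ℕ → Subgroup G} {d : ℕ}

theorem filtrationVal_eq (hD : IsUniformFiltration p κ D) {g : G} {n : ℕ} (h1 : g ∈ D n)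
    (h2 : g ∉ D (n + 1)) : filtrationVal κ D g = (((κ + n : ℕ) : ℝ) : WithTop ℝ) := by
  classical
  have h : ∃ n, g ∉ D (n + 1) := ⟨n, h2⟩
  have : Nat.find h = n := by
    rw [Nat.find_eq_iff]
    exact ⟨h2, fun m hm => not_not.mpr (hD.le_of_le (by omega) h1)⟩
  rw [filtrationVal, dif_pos h, this]

theorem exists_mem_notMem [T2Space G] [IsTopologicalGroup G] (hD : IsUniformFiltration p κ D)
    {g : G} (hg : g ≠ 1) : ∃ n, g ∈ D n ∧ g ∉ D (n + 1) := by
  classical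
  have h : ∃ n, g ∉ D n := by
    by_contra! h
    exact hg (hD.eq_of_forall_mem (x := 1) (y := g) (fun n => by simpa using h n)).symm
  have h0 : Nat.find h ≠ 0 := by
    rw [Ne, Nat.find_eq_zero]
    exact not_not.mpr (hD.mem_zero g)
  obtain ⟨k, hk⟩ := Nat.exists_eq_succ_of_ne_zero h0
  refine ⟨k, ?_, ?_⟩
  · have := Nat.find_min h (m := k) (by omega)
    exact not_not.mp this
  · have := Nat.find_spec h
    rwa [hk] at this

theorem filtrationVal_one (_hD : IsUniformFiltration p κ D) : filtrationVal κ D (1 : G) = ⊤ := by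
  rw [filtrationVal, dif_neg]
  simp

section

variable [T2Space G] [IsTopologicalGroup G]

theorem filtrationVal_cases (hD : IsUniformFiltration p κ D) (g : G) :
    (g = 1 ∧ filtrationVal κ D g = ⊤) ∨ (g ≠ 1 ∧ ∃ n, g ∈ D n ∧ g ∉ D (n + 1) ∧
      filtrationVal κ D g = (((κ + n : ℕ) : ℝ) : WithTop ℝ)) := by
  by_cases hg : g = 1
  · exact Or.inl ⟨hg, hg ▸ hD.filtrationVal_one⟩
  · obtain ⟨n, h1, h2⟩ := hD.exists_mem_notMem hg
    exact Or.inr ⟨hg, n, h1, h2, hD.filtrationVal_eq h1 h2⟩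

theorem le_filtrationVal_iff (hD : IsUniformFiltration p κ D) {g : G} {n : ℕ} :
    (((κ + n : ℕ) : ℝ) : WithTop ℝ) ≤ filtrationVal κ D g ↔ g ∈ D n := by
  rcases hD.filtrationVal_cases g with ⟨rfl, h⟩ | ⟨-, m, h1, h2, h⟩
  · simp [h]
  · rw [h, WithTop.coe_le_coe, Nat.cast_le, Nat.add_le_add_iff_left]
    constructor
    · intro hnm; exact hD.le_of_le hnm h1
    · intro hg
      by_contra hlt
      exact h2 (hD.le_of_le (by omega) hg)

theorem filtrationVal_le (hD : IsUniformFiltration p κ D) {g : G} {n : ℕ} (hg : g ∉ D (n + 1)) :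
    filtrationVal κ D g ≤ (((κ + n : ℕ) : ℝ) : WithTop ℝ) := by
  rcases hD.filtrationVal_cases g with ⟨rfl, h⟩ | ⟨-, m, h1, h2, h⟩
  · exact absurd (one_mem _) hg
  · rw [h, WithTop.coe_le_coe, Nat.cast_le, Nat.add_le_add_iff_left]
    by_contra hlt
    exact hg (hD.le_of_le (by omega) h1)

theorem isPValuation [hp : Fact p.Prime] (hD : IsUniformFiltration p κ D) :
    IsPValuation p (filtrationVal κ D) := by
  constructor
  · intro g
    rcases hD.filtrationVal_cases g with ⟨h, hg⟩ | ⟨h, m, h1, -, hg⟩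
    · simp [h, hD.filtrationVal_one]
    · simp [h, hg]
  · intro g
    -- For p = 2 the left side is 1, so κ = 1 would not do; this explains the shift in the
    -- definition of ω.
    have hlt : (1 / ((p : ℝ) - 1) : ℝ) < κ := by
      have h2 : (2 : ℝ) ≤ p := by exact_mod_cast hp.out.two_le
      have h1 : (1 : ℝ) ≤ κ := by exact_mod_cast hD.one_le
      rw [div_lt_iff₀ (by linarith)]
      by_cases hp2 : p = 2
      · have : (2 : ℝ) ≤ κ := by exact_mod_cast hD.two_le hp2
        nlinarith
      · have : (3 : ℝ) ≤ p := by
          have : 3 ≤ p := by have := hp.out.two_le; omega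
          exact_mod_cast this
        nlinarith
    refine lt_of_lt_of_le (WithTop.coe_lt_coe.mpr hlt) ?_
    simpa using (hD.le_filtrationVal_iff (n := 0)).mpr (hD.mem_zero g)
  · intro g h
    rcases le_total (filtrationVal κ D g) (filtrationVal κ D h) with hle | hle
    · rw [min_eq_left hle]
      rcases hD.filtrationVal_cases g with ⟨rfl, hg⟩ | ⟨-, m, h1, -, hg⟩
      · rw [hg, top_le_iff] at hle
        rcases hD.filtrationVal_cases h with ⟨rfl, hh⟩ | ⟨-, m, h1, -, hh⟩
        · simp
        · simp [hh] at hle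
      · rw [hg, hD.le_filtrationVal_iff] at hle ⊢
        exact mul_mem h1 (inv_mem hle)
    · rw [min_eq_right hle]
      rcases hD.filtrationVal_cases h with ⟨rfl, hg⟩ | ⟨-, m, h1, -, hg⟩
      · simpa using hle
      · rw [hg, hD.le_filtrationVal_iff] at hle ⊢
        exact mul_mem hle (inv_mem h1)
  · intro g h
    rcases hD.filtrationVal_cases g with ⟨rfl, hg⟩ | ⟨-, m, h1, -, hg⟩
    · simp [hg]
    rcases hD.filtrationVal_cases h with ⟨rfl, hh⟩ | ⟨-, n, h2, -, hh⟩
    · simp [hh]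
    rw [hg, hh, ← WithTop.coe_add, ← Nat.cast_add,
      show κ + m + (κ + n) = κ + (m + n + κ) by ring, hD.le_filtrationVal_iff]
    have := hD.commutator_mem m n _ _ (inv_mem h1) (inv_mem h2)
    simpa using this
  · intro g
    rcases hD.filtrationVal_cases g with ⟨rfl, hg⟩ | ⟨-, m, h1, h2, hg⟩
    · simp [hg]
    rw [hg, hD.filtrationVal_eq (hD.pow_mem _ _ h1) (fun h => h2 (hD.of_pow_mem _ _ h))]
    rw [← WithTop.coe_one, ← WithTop.coe_add]
    push_cast; rw [add_assoc]

theorem isPSaturated [hp : Fact p.Prime] [CompactSpace G] (hD : IsUniformFiltration p κ D)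
    (hκ : κ = kappa p) :
    IsPSaturated p (filtrationVal κ D) := by
  refine ⟨hD.isPValuation, ?_, ?_⟩
  · intro u hu
    have hu' : ∀ k : ℕ, ∃ N : ℕ, ∀ m ≥ N, ∀ n ≥ N, (u m)⁻¹ * u n ∈ D k := by
      intro k
      obtain ⟨N, hN⟩ := hu ((κ + k : ℕ) : ℝ)
      exact ⟨N, fun m hm n hn => hD.le_filtrationVal_iff.mp (hN m hm n hn)⟩
    choose N hN using hu'
    -- Taking maxima of the moduli gives a sequence u (M k) of the shape required by
    -- `tendsto_of_approx`.
    let M : ℕ → ℕ := fun k => (Finset.range (k + 1)).sup N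
    have hMN : ∀ {j k}, j ≤ k → N j ≤ M k := fun {j k} h =>
      Finset.le_sup (f := N) (Finset.mem_range.mpr (by omega))
    obtain ⟨c, hc⟩ := hD.tendsto_of_approx (fun k => u (M k)) fun m n hnm =>
      hN n _ (hMN le_rfl) _ (hMN hnm)
    have hck : ∀ n, (u (M n))⁻¹ * c ∈ D n := by
      intro n
      refine (hD.isClosed n).mem_of_tendsto (hc.const_mul ((u (M n))⁻¹))
        (Filter.eventually_atTop.mpr ⟨n, fun m hm => ?_⟩)
      exact hN n _ (hMN le_rfl) _ (hMN hm)
    refine ⟨c, fun C => ?_⟩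
    obtain ⟨n, hn⟩ := exists_nat_ge C
    refine ⟨N n, fun m hm => ?_⟩
    have h1 : c⁻¹ * u m ∈ D n := by
      have := mul_mem (inv_mem (hck n)) (hN n (M n) (hMN le_rfl) m hm)
      simpa [mul_assoc] using this
    refine le_trans (WithTop.coe_le_coe.mpr ?_) (hD.le_filtrationVal_iff.mpr h1)
    push_cast
    linarith [(Nat.cast_nonneg κ : (0 : ℝ) ≤ κ)]
  · intro g hg
    suffices g ∈ D 1 by
      obtain ⟨y, -, hy⟩ := hD.exists_pow 0 g this
      exact ⟨y, hy⟩
    -- Outside D 1 the valuation is at most κ, and κ ≤ p/(p-1) with equality for p = 2, where the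
    -- strict inequality in the definition of saturation is needed.
    by_contra hg1
    have h1 := lt_of_lt_of_le hg (hD.filtrationVal_le (n := 0) hg1)
    rw [WithTop.coe_lt_coe, add_zero] at h1
    have h2 : (2 : ℝ) ≤ p := by exact_mod_cast hp.out.two_le
    rw [div_lt_iff₀ (by linarith), hκ, kappa] at h1
    split_ifs at h1 with hp2
    · subst hp2; norm_num at h1
    · push_cast at h1; linarith

theorem filtrationVal_orderedProd [hp : Fact p.Prime] [CompactSpace G]
    (hD : IsUniformFiltration p κ D) {h : Fin d → G} (hb : IsFrattiniBasis p D h)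
    (x : Fin d → ℤ_[p]) :
    filtrationVal κ D (orderedProd h x) =
      Finset.univ.inf fun i => ((κ : ℝ) : WithTop ℝ) + vp (x i) := by
  refine le_antisymm (Finset.le_inf fun i _ => ?_) ?_
  · by_cases hxi : x i = 0
    · simp [vp, hxi]
    · rw [vp, if_neg hxi, ← WithTop.coe_add, ← Nat.cast_add]
      refine hD.filtrationVal_le ?_
      rw [hD.orderedProd_mem_iff hb]
      intro hx
      have := (PadicInt.mem_span_pow_iff_le_valuation _ hxi _).mp
        (Ideal.mem_span_singleton.mpr (hx i))
      omega
  · rcases hD.filtrationVal_cases (orderedProd h x) with ⟨-, hw⟩ | ⟨-, m, -, h2, hw⟩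
    · rw [hw]; exact le_top
    · rw [hw]
      rw [hD.orderedProd_mem_iff hb] at h2
      push Not at h2
      obtain ⟨i, hi⟩ := h2
      refine (Finset.inf_le (Finset.mem_univ i)).trans ?_
      have hxi : x i ≠ 0 := fun h0 => hi (h0 ▸ dvd_zero _)
      rw [vp, if_neg hxi, ← WithTop.coe_add, ← Nat.cast_add, WithTop.coe_le_coe, Nat.cast_le,
        Nat.add_le_add_iff_left]
      by_contra hlt
      exact hi (Ideal.mem_span_singleton.mp
        ((PadicInt.mem_span_pow_iff_le_valuation _ hxi _).mpr (by omega)))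

omit [TopologicalSpace G] [T2Space G] [IsTopologicalGroup G] in
theorem notMem_one_of_isFrattiniBasis [hp : Fact p.Prime]
    {h : Fin d → G} (hb : IsFrattiniBasis p D h) (i : Fin d) : h i ∉ D 1 := by
  intro hi
  have := hb.indep (Pi.single i 1) ((prod_ofFn_pow_single h i).symm ▸ hi) i
  simp only [Pi.single_eq_same] at this
  exact hp.out.one_lt.ne' (Nat.dvd_one.mp this)

omit [T2Space G] [IsTopologicalGroup G] in
theorem filtrationVal_basis [hp : Fact p.Prime]
    (hD : IsUniformFiltration p κ D) {h : Fin d → G} (hb : IsFrattiniBasis p D h) (i : Fin d) :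
    filtrationVal κ D (h i) = ((κ : ℝ) : WithTop ℝ) :=
  hD.filtrationVal_eq (n := 0) (hD.mem_zero _) (notMem_one_of_isFrattiniBasis hb i)

theorem lt_kappa_add_kappa [hp : Fact p.Prime] :
    (((p : ℝ) / ((p : ℝ) - 1) : ℝ) : WithTop ℝ) <
      ((kappa p : ℝ) : WithTop ℝ) + ((kappa p : ℝ) : WithTop ℝ) := by
  rw [← WithTop.coe_add, WithTop.coe_lt_coe]
  have h2 : (2 : ℝ) ≤ p := by exact_mod_cast hp.out.two_le
  rw [div_lt_iff₀ (by linarith), kappa]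
  split_ifs with hp2
  · subst hp2; norm_num
  · have : (3 : ℝ) ≤ p := by
      have : 3 ≤ p := by have := hp.out.two_le; omega
      exact_mod_cast this
    push_cast; linarith

end

end IsUniformFiltration

end UniformPro
end

/-! ### The weight filtration of the group ring and its sorted words -/

noncomputable section
namespace UniformPro

section AugFilt

variable {G : Type*} [Group G]

/-- The filtration of the integral group ring for which `p` has weight `1` and `g - 1` has weight
`i + κ` for `g ∈ D i`. -/
inductive AugFilt (p κ : ℕ) (D : ℕ → Subgroup G) : ℕ → MonoidAlgebra ℤ G → Prop
  | all (x) : AugFilt p κ D 0 x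
  | p_mul {n x} : AugFilt p κ D n x → AugFilt p κ D (n + 1) ((p : MonoidAlgebra ℤ G) * x)
  | sub_one_mul {n i g x} : g ∈ D i → AugFilt p κ D n x →
      AugFilt p κ D (n + (i + κ)) ((MonoidAlgebra.of ℤ G g - 1) * x)
  | add {n x y} : AugFilt p κ D n x → AugFilt p κ D n y → AugFilt p κ D n (x + y)
  | of_succ {n x} : AugFilt p κ D (n + 1) x → AugFilt p κ D n x

theorem AugFilt.zero_mem {p κ : ℕ} {D : ℕ → Subgroup G} (n : ℕ) :
    AugFilt p κ D n (0 : MonoidAlgebra ℤ G) := by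
  induction n with
  | zero => exact .all 0
  | succ n ih => simpa using AugFilt.p_mul ih

theorem AugFilt.neg {p κ : ℕ} {D : ℕ → Subgroup G} {n : ℕ} {x : MonoidAlgebra ℤ G}
    (h : AugFilt p κ D n x) : AugFilt p κ D n (-x) := by
  induction h with
  | all x => exact .all _
  | p_mul _ ih => rw [← mul_neg]; exact .p_mul ih
  | sub_one_mul hg _ ih => rw [← mul_neg]; exact .sub_one_mul hg ih
  | add _ _ h1 h2 => rw [neg_add]; exact .add h1 h2
  | of_succ _ ih => exact .of_succ ih

/-- The terms of `AugFilt` as additive subgroups. -/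
def augFilt (p κ : ℕ) (D : ℕ → Subgroup G) (n : ℕ) : AddSubgroup (MonoidAlgebra ℤ G) where
  carrier := {x | AugFilt p κ D n x}
  zero_mem' := AugFilt.zero_mem n
  add_mem' := AugFilt.add
  neg_mem' := AugFilt.neg

variable {p κ : ℕ} {D : ℕ → Subgroup G}

theorem augFilt_antitone {m n : ℕ} (h : m ≤ n) : augFilt p κ D n ≤ augFilt p κ D m := by
  induction h with
  | refl => exact le_rfl
  | step _ ih => exact fun x hx => ih (AugFilt.of_succ hx)

theorem mem_augFilt_zero (x : MonoidAlgebra ℤ G) : x ∈ augFilt p κ D 0 := AugFilt.all x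

theorem p_mul_mem_augFilt {n : ℕ} {x : MonoidAlgebra ℤ G} (hx : x ∈ augFilt p κ D n) :
    (p : MonoidAlgebra ℤ G) * x ∈ augFilt p κ D (n + 1) := AugFilt.p_mul hx

theorem p_pow_mul_mem_augFilt {n : ℕ} {x : MonoidAlgebra ℤ G} (hx : x ∈ augFilt p κ D n) (a : ℕ) :
    (p : MonoidAlgebra ℤ G) ^ a * x ∈ augFilt p κ D (n + a) := by
  induction a with
  | zero => simpa using hx
  | succ a ih => rw [pow_succ', mul_assoc]; exact p_mul_mem_augFilt ih

theorem sub_one_mem_augFilt {i : ℕ} {g : G} (hg : g ∈ D i) :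
    MonoidAlgebra.of ℤ G g - 1 ∈ augFilt p κ D (i + κ) := by
  have := AugFilt.sub_one_mul (p := p) (κ := κ) hg (AugFilt.all 1)
  rwa [mul_one, zero_add] at this

theorem mul_mem_augFilt_right (h0 : D 0 = ⊤) {n : ℕ} (r : MonoidAlgebra ℤ G)
    {x : MonoidAlgebra ℤ G} (hx : x ∈ augFilt p κ D n) : r * x ∈ augFilt p κ D n := by
  induction r using MonoidAlgebra.induction_on with
  | of g =>
    have h1 : (MonoidAlgebra.of ℤ G g - 1) * x ∈ augFilt p κ D n :=
      augFilt_antitone (by omega)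
        (AugFilt.sub_one_mul (p := p) (κ := κ) (i := 0) (by rw [h0]; trivial) hx)
    have := add_mem h1 hx
    rwa [sub_mul, one_mul, sub_add_cancel] at this
  | add a b ha hb => rw [add_mul]; exact add_mem ha hb
  | smul c a ha => rw [smul_mul_assoc]; exact zsmul_mem ha c

theorem mul_mem_augFilt (h0 : D 0 = ⊤) {m n : ℕ} {x y : MonoidAlgebra ℤ G}
    (hx : x ∈ augFilt p κ D m) (hy : y ∈ augFilt p κ D n) : x * y ∈ augFilt p κ D (m + n) := by
  have hx' : AugFilt p κ D m x := hx
  clear hx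
  induction hx' with
  | all x => rw [zero_add]; exact mul_mem_augFilt_right h0 x hy
  | @p_mul m x _ ih => rw [mul_assoc, add_right_comm]; exact AugFilt.p_mul ih
  | @sub_one_mul m i g x hg _ ih => rw [mul_assoc, add_right_comm]; exact AugFilt.sub_one_mul hg ih
  | add _ _ h1 h2 => rw [add_mul]; exact add_mem h1 h2
  | of_succ _ ih => exact augFilt_antitone (by omega) ih

theorem pow_mem_augFilt (h0 : D 0 = ⊤) {m : ℕ} {x : MonoidAlgebra ℤ G}
    (hx : x ∈ augFilt p κ D m) (k : ℕ) : x ^ k ∈ augFilt p κ D (k * m) := by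
  induction k with
  | zero => exact mem_augFilt_zero _ |> fun h => by simpa using h
  | succ k ih => rw [pow_succ, add_mul, one_mul]; exact mul_mem_augFilt h0 ih hx

/-- In the binomial expansion the terms with 2 ≤ j < p contain a factor p and have weight at least
2m+1. The last term has weight pm, and pm ≥ m+2 requires m ≥ 2 when p = 2. -/
theorem add_one_pow_sub_mem_augFilt [hp : Fact p.Prime] (h0 : D 0 = ⊤) {m : ℕ} (hm : 1 ≤ m)
    (hm2 : p = 2 → 2 ≤ m) {x : MonoidAlgebra ℤ G} (hx : x ∈ augFilt p κ D m) :
    (x + 1) ^ p - 1 - (p : MonoidAlgebra ℤ G) * x ∈ augFilt p κ D (m + 2) := by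
  obtain ⟨q, hq⟩ : ∃ q, p = q + 2 := ⟨p - 2, by have := hp.out.two_le; omega⟩
  have hexp : (x + 1) ^ p - 1 - (p : MonoidAlgebra ℤ G) * x =
      ∑ j ∈ Finset.range (q + 1), x ^ (j + 2) * (p.choose (j + 2) : MonoidAlgebra ℤ G) := by
    rw [(Commute.one_right x).add_pow, show p + 1 = q + 1 + 1 + 1 by omega,
      Finset.sum_range_succ', Finset.sum_range_succ']
    simp only [one_pow, mul_one, zero_add, pow_one, pow_zero, Nat.choose_zero_right, Nat.cast_one,
      Nat.choose_one_right]
    rw [(Nat.cast_commute p x).eq]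
    abel
  rw [hexp]
  refine sum_mem fun j hj => ?_
  have hj' := Finset.mem_range.mp hj
  have hpow := pow_mem_augFilt h0 hx (j + 2)
  rw [← (Nat.cast_commute _ _).eq]
  by_cases hjp : j + 2 = p
  · rw [hjp, Nat.choose_self, Nat.cast_one, one_mul]
    rw [hjp] at hpow
    refine augFilt_antitone ?_ hpow
    by_cases h2 : p = 2
    · have := hm2 h2; rw [h2]; omega
    · have : 3 ≤ p := by have := hp.out.two_le; omega
      calc m + 2 ≤ 3 * m := by omega
        _ ≤ p * m := Nat.mul_le_mul_right m this
  · obtain ⟨c, hc⟩ := hp.out.dvd_choose_self (k := j + 2) (by omega) (by omega)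
    rw [hc, Nat.cast_mul, mul_assoc]
    refine augFilt_antitone ?_ (p_mul_mem_augFilt (mul_mem_augFilt_right h0 _ hpow))
    have : 2 * m ≤ (j + 2) * m := Nat.mul_le_mul_right m (by omega)
    omega

end AugFilt

section Words

variable {G : Type*} [Group G] {p κ : ℕ} {D : ℕ → Subgroup G} {d : ℕ}

/-- The product of the elements `h i - 1` of the group ring, for `i` running through a list. -/
def augWord (h : Fin d → G) (l : List (Fin d)) : MonoidAlgebra ℤ G :=
  (l.map fun i => MonoidAlgebra.of ℤ G (h i) - 1).prod

theorem augWord_nil (h : Fin d → G) : augWord h [] = 1 := rfl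

theorem augWord_cons (h : Fin d → G) (i : Fin d) (l : List (Fin d)) :
    augWord h (i :: l) = (MonoidAlgebra.of ℤ G (h i) - 1) * augWord h l := by
  simp [augWord]

/-- The additive group spanned by the multiples of weight `n` of words in a given set. -/
def wordSpan (p κ : ℕ) (h : Fin d → G) (S : Set (List (Fin d))) (n : ℕ) :
    AddSubgroup (MonoidAlgebra ℤ G) :=
  AddSubgroup.closure {x | ∃ a l, l ∈ S ∧ a + κ * l.length = n ∧
    (p : MonoidAlgebra ℤ G) ^ a * augWord h l = x}

theorem mem_wordSpan {h : Fin d → G} {S : Set (List (Fin d))} {l : List (Fin d)} (hl : l ∈ S)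
    {a n : ℕ} (hn : a + κ * l.length = n) :
    (p : MonoidAlgebra ℤ G) ^ a * augWord h l ∈ wordSpan p κ h S n :=
  AddSubgroup.subset_closure ⟨a, l, hl, hn, rfl⟩

theorem augWord_mem_augFilt (h0 : D 0 = ⊤) (h : Fin d → G) (l : List (Fin d)) :
    augWord h l ∈ augFilt p κ D (κ * l.length) := by
  induction l with
  | nil => simpa using mem_augFilt_zero _
  | cons i l ih =>
    rw [augWord_cons, List.length_cons, mul_add, mul_one, add_comm]
    have := sub_one_mem_augFilt (p := p) (κ := κ) (D := D) (i := 0) (g := h i) (by rw [h0]; trivial)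
    rw [zero_add] at this
    exact mul_mem_augFilt h0 this ih

theorem wordSpan_le_augFilt (h0 : D 0 = ⊤) (h : Fin d → G) (S : Set (List (Fin d))) (n : ℕ) :
    wordSpan p κ h S n ≤ augFilt p κ D n := by
  rw [wordSpan, AddSubgroup.closure_le]
  rintro _ ⟨a, l, -, rfl, rfl⟩
  rw [add_comm]
  exact p_pow_mul_mem_augFilt (augWord_mem_augFilt h0 h l) a

/-- An additive map sends sums to sums of images. -/
theorem map_mem_sup {A B : Type*} [AddCommGroup A] [AddCommGroup B] (f : A →+ B)
    {H K : AddSubgroup A} {H' K' : AddSubgroup B} (hH : ∀ x ∈ H, f x ∈ H' ⊔ K')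
    (hK : ∀ x ∈ K, f x ∈ H' ⊔ K') {x : A} (hx : x ∈ H ⊔ K) : f x ∈ H' ⊔ K' := by
  have : H ⊔ K ≤ (H' ⊔ K').comap f := sup_le hH hK
  exact this hx

theorem p_pow_mul_mem_wordSpan {h : Fin d → G} {S : Set (List (Fin d))} {n : ℕ}
    {x : MonoidAlgebra ℤ G} (hx : x ∈ wordSpan p κ h S n) (b : ℕ) :
    (p : MonoidAlgebra ℤ G) ^ b * x ∈ wordSpan p κ h S (n + b) := by
  have : wordSpan p κ h S n ≤ (wordSpan p κ h S (n + b)).comap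
      (AddMonoidHom.mulLeft ((p : MonoidAlgebra ℤ G) ^ b)) := by
    refine (AddSubgroup.closure_le _).mpr ?_
    rintro _ ⟨a, l, hl, rfl, rfl⟩
    simp only [AddSubgroup.coe_comap, AddMonoidHom.coe_mulLeft, Set.mem_preimage, SetLike.mem_coe]
    rw [← mul_assoc, ← pow_add]
    exact mem_wordSpan hl (by ring)
  exact this hx

theorem p_pow_mul_mem_sup {h : Fin d → G} {S : Set (List (Fin d))} {n m : ℕ}
    {x : MonoidAlgebra ℤ G} (hx : x ∈ wordSpan p κ h S n ⊔ augFilt p κ D m) (b : ℕ) :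
    (p : MonoidAlgebra ℤ G) ^ b * x ∈ wordSpan p κ h S (n + b) ⊔ augFilt p κ D (m + b) :=
  map_mem_sup (AddMonoidHom.mulLeft ((p : MonoidAlgebra ℤ G) ^ b))
    (fun _ hy => AddSubgroup.mem_sup_left (p_pow_mul_mem_wordSpan hy b))
    (fun _ hy => AddSubgroup.mem_sup_right (p_pow_mul_mem_augFilt hy b)) hx

/-- Multiplication of spans of words, when concatenation maps `S` and `T` to `U`. -/
theorem mul_mem_wordSpan {h : Fin d → G} {S T U : Set (List (Fin d))}
    (hU : ∀ s ∈ S, ∀ t ∈ T, s ++ t ∈ U) {m n : ℕ} {x y : MonoidAlgebra ℤ G}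
    (hx : x ∈ wordSpan p κ h S m) (hy : y ∈ wordSpan p κ h T n) :
    x * y ∈ wordSpan p κ h U (m + n) := by
  have h1 : ∀ z, z ∈ {x | ∃ a l, l ∈ S ∧ a + κ * l.length = m ∧
      (p : MonoidAlgebra ℤ G) ^ a * augWord h l = x} → wordSpan p κ h T n ≤
        (wordSpan p κ h U (m + n)).comap (AddMonoidHom.mulLeft z) := by
    rintro _ ⟨a, l, hl, rfl, rfl⟩
    refine (AddSubgroup.closure_le _).mpr ?_
    rintro _ ⟨b, t, ht, rfl, rfl⟩
    simp only [AddSubgroup.coe_comap, AddMonoidHom.coe_mulLeft, Set.mem_preimage, SetLike.mem_coe]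
    have hc : augWord h l * (p : MonoidAlgebra ℤ G) ^ b =
        (p : MonoidAlgebra ℤ G) ^ b * augWord h l := by
      rw [← Nat.cast_pow]; exact (Nat.cast_commute _ _).eq.symm
    have : (p : MonoidAlgebra ℤ G) ^ a * augWord h l * ((p : MonoidAlgebra ℤ G) ^ b * augWord h t) =
        (p : MonoidAlgebra ℤ G) ^ (a + b) * augWord h (l ++ t) := by
      rw [mul_assoc, ← mul_assoc (augWord h l), hc, pow_add, augWord, augWord, augWord,
        List.map_append, List.prod_append]
      simp only [mul_assoc]
    rw [this]
    exact mem_wordSpan (hU l hl t ht) (by rw [List.length_append]; ring)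
  have h2 : wordSpan p κ h S m ≤ (wordSpan p κ h U (m + n)).comap (AddMonoidHom.mulRight y) :=
    (AddSubgroup.closure_le _).mpr fun z hz => h1 z hz hy
  exact h2 hx

theorem mul_mem_sup (h0 : D 0 = ⊤) {h : Fin d → G} {S T U : Set (List (Fin d))}
    (hU : ∀ s ∈ S, ∀ t ∈ T, s ++ t ∈ U) {m n : ℕ} {x y : MonoidAlgebra ℤ G}
    (hx : x ∈ wordSpan p κ h S m ⊔ augFilt p κ D (m + 1))
    (hy : y ∈ wordSpan p κ h T n ⊔ augFilt p κ D (n + 1)) :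
    x * y ∈ wordSpan p κ h U (m + n) ⊔ augFilt p κ D (m + n + 1) := by
  obtain ⟨x1, hx1, x2, hx2, rfl⟩ := AddSubgroup.mem_sup.mp hx
  obtain ⟨y1, hy1, y2, hy2, rfl⟩ := AddSubgroup.mem_sup.mp hy
  have e : (x1 + x2) * (y1 + y2) = x1 * y1 + (x1 * y2 + x2 * (y1 + y2)) := by
    rw [add_mul, mul_add]; abel
  have hx1' : x1 ∈ augFilt p κ D m := wordSpan_le_augFilt h0 h S m hx1
  have hy1' : y1 ∈ augFilt p κ D n := wordSpan_le_augFilt h0 h T n hy1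
  have hy2' : y2 ∈ augFilt p κ D n := augFilt_antitone (Nat.le_succ n) hy2
  have h1 : x1 * y1 ∈ wordSpan p κ h U (m + n) := mul_mem_wordSpan hU hx1 hy1
  have h2 : x1 * y2 ∈ augFilt p κ D (m + (n + 1)) := mul_mem_augFilt h0 hx1' hy2
  have h3 : x2 * (y1 + y2) ∈ augFilt p κ D (m + 1 + n) :=
    mul_mem_augFilt h0 hx2 (add_mem hy1' hy2')
  rw [add_right_comm] at h3
  rw [e]
  exact add_mem (AddSubgroup.mem_sup_left h1) (AddSubgroup.mem_sup_right (add_mem h2 h3))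

end Words

namespace IsUniformFiltration

variable {G : Type*} [Group G] [TopologicalSpace G] {p κ : ℕ} [hp : Fact p.Prime]
  {D : ℕ → Subgroup G} {d : ℕ} {h : Fin d → G}

/-- Iterates (1 + x)^p ≡ 1 + px: in the graded ring, the p^i-th power in G becomes multiplication by
p^i. -/
theorem pow_pow_sub_mem_augFilt (hD : IsUniformFiltration p κ D) (k : G) (i : ℕ) :
    (MonoidAlgebra.of ℤ G (k ^ p ^ i) - 1) -
      (p : MonoidAlgebra ℤ G) ^ i * (MonoidAlgebra.of ℤ G k - 1) ∈ augFilt p κ D (i + κ + 1) := by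
  induction i with
  | zero => simp
  | succ i ih =>
    have hk : k ^ p ^ i ∈ D i := by simpa using hD.pow_pow_mem (hD.mem_zero k) i
    have h1 := add_one_pow_sub_mem_augFilt (p := p) hD.zero (m := i + κ)
      (by have := hD.one_le; omega) (fun h => by have := hD.two_le h; omega)
      (sub_one_mem_augFilt hk)
    rw [sub_add_cancel, ← map_pow, ← pow_mul, ← pow_succ] at h1
    have h2 := p_mul_mem_augFilt ih
    have h3 := add_mem (augFilt_antitone (by omega : i + 1 + κ + 1 ≤ _) h1)
      (augFilt_antitone (by omega : i + 1 + κ + 1 ≤ _) h2)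
    rw [mul_sub (p : MonoidAlgebra ℤ G) (_ - 1), ← mul_assoc, ← pow_succ', sub_add_sub_cancel] at h3
    exact h3

omit hp in
-- From xy - 1 = (x-1) + (y-1) + (x-1)(y-1), with last term of weight 2κ > κ, the map g ↦ g - 1 is
-- additive in degree κ, and the h i span G modulo D 1.
theorem sub_one_mem_wordSpan_zero (hD : IsUniformFiltration p κ D) (hb : IsFrattiniBasis p D h)
    (k : G) : MonoidAlgebra.of ℤ G k - 1 ∈
      wordSpan p κ h {l | l.length = 1} κ ⊔ augFilt p κ D (κ + 1) := by
  set T := wordSpan p κ h {l | l.length = 1} κ ⊔ augFilt p κ D (κ + 1) with hT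
  have hmul : ∀ x y : G, MonoidAlgebra.of ℤ G x - 1 ∈ T → MonoidAlgebra.of ℤ G y - 1 ∈ T →
      MonoidAlgebra.of ℤ G (x * y) - 1 ∈ T := by
    intro x y hx hy
    have e : MonoidAlgebra.of ℤ G (x * y) - 1 = (MonoidAlgebra.of ℤ G x - 1) +
        (MonoidAlgebra.of ℤ G y - 1) +
        (MonoidAlgebra.of ℤ G x - 1) * (MonoidAlgebra.of ℤ G y - 1) := by
      rw [map_mul, sub_mul, mul_sub, one_mul, mul_one]; abel
    rw [e]
    refine add_mem (add_mem hx hy) (AddSubgroup.mem_sup_right ?_)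
    exact augFilt_antitone (by have := hD.one_le; omega)
      (mul_mem_augFilt hD.zero (sub_one_mem_augFilt (hD.mem_zero x))
        (sub_one_mem_augFilt (hD.mem_zero y)))
  have hone : MonoidAlgebra.of ℤ G (1 : G) - 1 ∈ T := by
    rw [map_one, sub_self]; exact zero_mem _
  have hlist : ∀ l : List G, (∀ x ∈ l, MonoidAlgebra.of ℤ G x - 1 ∈ T) →
      MonoidAlgebra.of ℤ G l.prod - 1 ∈ T := by
    intro l
    induction l with
    | nil => intro _; exact hone
    | cons a l ih =>
      intro hl
      rw [List.prod_cons]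
      exact hmul _ _ (hl a (by simp)) (ih fun x hx => hl x (by simp [hx]))
  have hpow : ∀ (x : G) (n : ℕ), MonoidAlgebra.of ℤ G x - 1 ∈ T →
      MonoidAlgebra.of ℤ G (x ^ n) - 1 ∈ T := by
    intro x n hx
    rw [← List.prod_replicate]
    exact hlist _ fun y hy => (List.eq_of_mem_replicate hy) ▸ hx
  obtain ⟨c, hc⟩ := hb.span k
  have hk : k = (List.ofFn fun i => h i ^ c i).prod *
      (((List.ofFn fun i => h i ^ c i).prod)⁻¹ * k) := by group
  rw [hk]
  refine hmul _ _ (hlist _ fun x hx => ?_) ?_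
  · obtain ⟨i, rfl⟩ := List.mem_ofFn.mp hx
    refine hpow _ _ (AddSubgroup.mem_sup_left ?_)
    have := mem_wordSpan (p := p) (κ := κ) (h := h) (S := {l | l.length = 1}) (l := [i]) rfl
      (a := 0) (n := κ) (by simp)
    simpa [augWord] using this
  · refine AddSubgroup.mem_sup_right ?_
    rw [add_comm]
    exact sub_one_mem_augFilt hc

theorem sub_one_mem_wordSpan (hD : IsUniformFiltration p κ D) (hb : IsFrattiniBasis p D h)
    {i : ℕ} {g : G} (hg : g ∈ D i) : MonoidAlgebra.of ℤ G g - 1 ∈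
      wordSpan p κ h {l | l.length = 1} (i + κ) ⊔ augFilt p κ D (i + κ + 1) := by
  obtain ⟨k, -, rfl⟩ := hD.exists_pow_pow (i := 0) (n := i) (by simpa using hg)
  have h1 := hD.pow_pow_sub_mem_augFilt k i
  have h2 := p_pow_mul_mem_sup (hD.sub_one_mem_wordSpan_zero hb k) i
  have h3 := add_mem (AddSubgroup.mem_sup_right (S := wordSpan p κ h {l | l.length = 1} (i + κ)) h1)
    (by rwa [add_comm κ i, show κ + 1 + i = i + κ + 1 by ring] at h2)
  rwa [sub_add_cancel] at h3

theorem augFilt_le_wordSpan (hD : IsUniformFiltration p κ D) (hb : IsFrattiniBasis p D h) (n : ℕ) :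
    augFilt p κ D n ≤ wordSpan p κ h Set.univ n ⊔ augFilt p κ D (n + 1) := by
  intro x hx
  have hx' : AugFilt p κ D n x := hx
  clear hx
  induction hx' with
  | all x =>
    induction x using MonoidAlgebra.induction_on with
    | of g =>
      rw [← sub_add_cancel (MonoidAlgebra.of ℤ G g) 1]
      refine add_mem (AddSubgroup.mem_sup_right ?_) (AddSubgroup.mem_sup_left ?_)
      · exact augFilt_antitone (by have := hD.one_le; omega) (sub_one_mem_augFilt (hD.mem_zero g))
      · have := mem_wordSpan (p := p) (κ := κ) (h := h) (S := Set.univ) (l := []) trivial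
          (a := 0) (n := 0) (by simp)
        simpa [augWord] using this
    | add a b ha hb => exact add_mem ha hb
    | smul c a ha => exact zsmul_mem ha c
  | @p_mul n x _ ih =>
    have := p_pow_mul_mem_sup ih 1
    rwa [pow_one] at this
  | @sub_one_mul n i g x hg _ ih =>
    rw [add_comm]
    exact mul_mem_sup hD.zero (fun _ _ _ _ => Set.mem_univ _) (hD.sub_one_mem_wordSpan hb hg) ih
  | add _ _ h1 h2 => exact add_mem h1 h2
  | of_succ hx _ => exact AddSubgroup.mem_sup_right hx

/-- Exchanging two neighbours costs a commutator c ∈ D κ. Here c - 1 has weight 2κ and, modulo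
higher weight, is p^κ times a combination of words of length one; so two letters are replaced by
one. -/
theorem augWord_perm (hD : IsUniformFiltration p κ D) (hb : IsFrattiniBasis p D h)
    {l l' : List (Fin d)} (hl : l.Perm l') : augWord h l - augWord h l' ∈
      wordSpan p κ h {m | m.length < l.length} (κ * l.length) ⊔
        augFilt p κ D (κ * l.length + 1) := by
  induction hl with
  | nil => simp
  | @cons i l l' hll ih =>
    rw [augWord_cons, augWord_cons, ← mul_sub, List.length_cons, mul_add, mul_one, add_comm _ κ]
    refine mul_mem_sup hD.zero (S := {l | l.length = 1}) ?_ ?_ ih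
    · intro s hs t ht
      simp only [Set.mem_ofPred_eq, List.length_append] at hs ht ⊢
      omega
    · exact hD.sub_one_mem_wordSpan_zero hb _
  | swap i j l =>
    -- With a = h j, b = h i and c = [a, b], this is ab - ba = (c-1)ba = (c-1) + (c-1)(ba-1). The
    -- last summand has higher weight.
    have e : augWord h (j :: i :: l) - augWord h (i :: j :: l) =
        ((MonoidAlgebra.of ℤ G (h j * h i * (h j)⁻¹ * (h i)⁻¹) - 1) +
        (MonoidAlgebra.of ℤ G (h j * h i * (h j)⁻¹ * (h i)⁻¹) - 1) *
          (MonoidAlgebra.of ℤ G (h i * h j) - 1)) * augWord h l := by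
      have e1 : MonoidAlgebra.of ℤ G (h j * h i * (h j)⁻¹ * (h i)⁻¹) *
          MonoidAlgebra.of ℤ G (h i * h j) = MonoidAlgebra.of ℤ G (h j) *
            MonoidAlgebra.of ℤ G (h i) := by
        rw [← map_mul, ← map_mul]; congr 1; group
      have e2 : (MonoidAlgebra.of ℤ G (h j * h i * (h j)⁻¹ * (h i)⁻¹) - 1) +
        (MonoidAlgebra.of ℤ G (h j * h i * (h j)⁻¹ * (h i)⁻¹) - 1) *
          (MonoidAlgebra.of ℤ G (h i * h j) - 1) = MonoidAlgebra.of ℤ G (h j) *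
            MonoidAlgebra.of ℤ G (h i) - MonoidAlgebra.of ℤ G (h i) *
            MonoidAlgebra.of ℤ G (h j) := by
        rw [mul_sub, mul_one, sub_mul, e1, one_mul, map_mul ((MonoidAlgebra.of ℤ G)) (h i) (h j)]
        abel
      rw [e2, augWord_cons, augWord_cons, augWord_cons, augWord_cons, ← mul_assoc, ← mul_assoc,
        ← sub_mul]
      congr 1
      noncomm_ring
    have hc : h j * h i * (h j)⁻¹ * (h i)⁻¹ ∈ D κ := by
      simpa using hD.commutator_mem 0 0 (h j) (h i) (hD.mem_zero _) (hD.mem_zero _)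
    rw [e, List.length_cons, List.length_cons,
      show κ * (l.length + 1 + 1) = (κ + κ) + κ * l.length by ring]
    refine mul_mem_sup hD.zero (S := {l | l.length = 1}) (T := {m | m = l}) ?_ (add_mem ?_ ?_) ?_
    · intro s hs t ht
      simp only [Set.mem_ofPred_eq, List.length_append] at hs ht ⊢
      subst ht
      omega
    · exact hD.sub_one_mem_wordSpan hb hc
    · exact AddSubgroup.mem_sup_right (augFilt_antitone (by have := hD.one_le; omega)
        (mul_mem_augFilt hD.zero (sub_one_mem_augFilt hc)
          (sub_one_mem_augFilt (hD.mem_zero (h i * h j)))))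
    · refine AddSubgroup.mem_sup_left ?_
      have := mem_wordSpan (p := p) (κ := κ) (h := h) (S := {m | m = l}) (l := l) rfl (a := 0) rfl
      simpa using this
  | @trans l₁ l₂ l₃ h12 _ h1 h2 =>
    rw [← h12.length_eq] at h2
    have := add_mem h1 h2
    rwa [sub_add_sub_cancel] at this

/-- The set of weakly increasing lists. -/
def sortedLists (d : ℕ) : Set (List (Fin d)) := {l | l.Pairwise (· ≤ ·)}

/-- Sorting changes a word only by shorter words of the same total weight, whence the strong
induction on length. -/
theorem augWord_mem_sorted (hD : IsUniformFiltration p κ D) (hb : IsFrattiniBasis p D h) (k : ℕ) :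
    ∀ (l : List (Fin d)) (a : ℕ), l.length = k → (p : MonoidAlgebra ℤ G) ^ a * augWord h l ∈
      wordSpan p κ h (sortedLists d) (a + κ * k) ⊔ augFilt p κ D (a + κ * k + 1) := by
  induction k using Nat.strong_induction_on with
  | _ k ih =>
    intro l a hl
    set l' := l.insertionSort (· ≤ ·) with hl'
    have hperm : l.Perm l' := (List.perm_insertionSort _ l).symm
    have h1 := p_pow_mul_mem_sup (hD.augWord_perm hb hperm) a
    rw [hl] at h1
    rw [← sub_add_cancel (augWord h l) (augWord h l'), mul_add]
    refine add_mem ?_ ?_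
    · rw [add_comm (κ * k), add_right_comm, add_comm (κ * k)] at h1
      refine (sup_le ?_ le_sup_right : wordSpan p κ h {m | m.length < k} (a + κ * k) ⊔
        augFilt p κ D (a + κ * k + 1) ≤ _) h1
      refine (AddSubgroup.closure_le _).mpr ?_
      rintro _ ⟨b, m, hm, hbm, rfl⟩
      have := ih m.length hm m b rfl
      rwa [hbm] at this
    · refine AddSubgroup.mem_sup_left (mem_wordSpan ?_ ?_)
      · exact List.pairwise_insertionSort _ _
      · rw [← hperm.length_eq, hl]

theorem augFilt_le_sorted (hD : IsUniformFiltration p κ D) (hb : IsFrattiniBasis p D h) (n : ℕ) :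
    augFilt p κ D n ≤ wordSpan p κ h (sortedLists d) n ⊔ augFilt p κ D (n + 1) := by
  refine (hD.augFilt_le_wordSpan hb n).trans (sup_le ?_ le_sup_right)
  refine (AddSubgroup.closure_le _).mpr ?_
  rintro _ ⟨a, l, -, rfl, rfl⟩
  exact hD.augWord_mem_sorted hb _ l a rfl

end IsUniformFiltration

end UniformPro
end

/-! ### Nilpotent action on finite modules and growth of the coordinates -/

noncomputable section
namespace UniformPro

section Nilpotency

variable {G : Type*} [Group G] {p κ : ℕ} [hp : Fact p.Prime] {D : ℕ → Subgroup G}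

/-- A finite nonzero module of `p`-power exponent, on which a `p`-power of every group element acts
trivially, has a nonzero fixed vector of order `p`. -/
theorem exists_fixed_vector {m : ℕ} (V : Type*) [AddCommGroup V] [Module (MonoidAlgebra ℤ G) V]
    [Finite V] [Nontrivial V] (hV : ∀ v : V, p ^ m • v = 0)
    (hG : ∀ (g : G) (v : V), MonoidAlgebra.of ℤ G (g ^ p ^ m) • v = v) :
    ∃ v : V, v ≠ 0 ∧ p • v = 0 ∧ ∀ g : G, MonoidAlgebra.of ℤ G g • v = v := by
  let _ : MulAction G V := MulAction.compHom V (MonoidAlgebra.of ℤ G)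
  have hsmul : ∀ (g : G) (v : V), g • v = MonoidAlgebra.of ℤ G g • v := fun _ _ => rfl
  let Γ := (MulAction.toPermHom G V).range
  have hΓ : IsPGroup p Γ := by
    rintro ⟨_, g, rfl⟩
    refine ⟨m, Subtype.ext ?_⟩
    simp only [Subgroup.coe_pow, Subgroup.coe_one, ← map_pow]
    ext v
    exact hG g v
  have hpV : p ∣ Nat.card V := by
    have hVp : IsPGroup p (Multiplicative V) := fun v => ⟨m, by
      have := hV v.toAdd
      rwa [← toAdd_pow] at this⟩
    obtain ⟨k, hk⟩ := IsPGroup.iff_card.mp hVp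
    have hk' : Nat.card V = p ^ k := hk
    rw [hk']
    refine dvd_pow_self p ?_
    rintro rfl
    have := Finite.one_lt_card (α := V)
    rw [hk', pow_zero] at this
    exact lt_irrefl _ this
  have hmod := hΓ.card_modEq_card_fixedPoints V
  have hdvd : p ∣ Nat.card (MulAction.fixedPoints Γ V) :=
    (Nat.modEq_zero_iff_dvd).mp (hmod.symm.trans ((Nat.modEq_zero_iff_dvd).mpr hpV))
  have h0 : (0 : V) ∈ MulAction.fixedPoints Γ V := by
    rintro ⟨_, g, rfl⟩
    exact smul_zero (MonoidAlgebra.of ℤ G g)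
  have : Nontrivial (MulAction.fixedPoints Γ V) := by
    rw [← Finite.one_lt_card_iff_nontrivial]
    have hpos : 0 < Nat.card (MulAction.fixedPoints Γ V) := by
      have : Nonempty (MulAction.fixedPoints Γ V) := ⟨⟨0, h0⟩⟩
      exact Nat.card_pos
    exact lt_of_lt_of_le hp.out.one_lt (Nat.le_of_dvd hpos hdvd)
  obtain ⟨⟨v, hv⟩, hne⟩ := exists_ne (⟨0, h0⟩ : MulAction.fixedPoints Γ V)
  have hv0 : v ≠ 0 := fun h => hne (Subtype.ext h)
  have hfix : ∀ g : G, MonoidAlgebra.of ℤ G g • v = v := fun g => hv ⟨_, g, rfl⟩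
  classical
  have hex : ∃ k, p ^ k • v = 0 := ⟨m, hV v⟩
  have hk0 : Nat.find hex ≠ 0 := by
    intro h
    have := Nat.find_spec hex
    rw [h, pow_zero, one_smul] at this
    exact hv0 this
  obtain ⟨k, hk⟩ := Nat.exists_eq_succ_of_ne_zero hk0
  refine ⟨p ^ k • v, Nat.find_min hex (by omega), ?_, fun g => ?_⟩
  · have := Nat.find_spec hex
    rwa [hk, Nat.succ_eq_add_one, pow_succ', mul_smul] at this
  · rw [smul_comm, hfix]

omit hp in
-- Once step N maps V into vectors fixed by G and killed by p, one further factor p or g - 1 gives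
-- zero. Elements of D m act trivially anyway, and any other factor has weight less than m + κ + 1.
theorem augFilt_smul_eq_zero_of_le {m N n : ℕ} {V : Type*} [AddCommGroup V]
    [Module (MonoidAlgebra ℤ G) V] (hanti : ∀ i j, i ≤ j → D j ≤ D i)
    (hDm : ∀ g ∈ D m, ∀ v : V, MonoidAlgebra.of ℤ G g • v = v)
    (hN : ∀ x ∈ augFilt p κ D N, ∀ v : V, p • (x • v) = 0 ∧
      ∀ g, MonoidAlgebra.of ℤ G g • (x • v) = x • v) {x : MonoidAlgebra ℤ G}
    (hx : AugFilt p κ D n x) : N + m + κ + 1 ≤ n → ∀ v : V, x • v = 0 := by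
  induction hx with
  | all x => intro h; omega
  | @p_mul n x hx ih =>
    intro h v
    have := (hN x (augFilt_antitone (by omega) hx) v).1
    rw [mul_smul, Nat.cast_smul_eq_nsmul, this]
  | @sub_one_mul n i g x hg hx ih =>
    intro h v
    rw [mul_smul, sub_smul, one_smul, sub_eq_zero]
    by_cases him : m ≤ i
    · exact hDm g (hanti _ _ him hg) _
    · exact (hN x (augFilt_antitone (by omega) hx) v).2 g
  | add _ _ h1 h2 => intro h v; rw [add_smul, h1 h, h2 h, add_zero]
  | of_succ _ ih => intro h v; exact ih (by omega) v

/-- Induction on the order of V: a fixed vector of order p spans a submodule fixed by G and killed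
by p, and some step annihilates the quotient by it. -/
theorem exists_augFilt_smul_eq_zero {m : ℕ} (hanti : ∀ i j, i ≤ j → D j ≤ D i)
    (hpow : ∀ g : G, g ^ p ^ m ∈ D m) (n : ℕ) :
    ∀ (V : Type*) [AddCommGroup V] [Module (MonoidAlgebra ℤ G) V] [Finite V], Nat.card V ≤ n →
      (∀ v : V, p ^ m • v = 0) → (∀ g ∈ D m, ∀ v : V, MonoidAlgebra.of ℤ G g • v = v) →
      ∃ N, ∀ x ∈ augFilt p κ D N, ∀ v : V, x • v = 0 := by
  induction n with
  | zero =>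
    intro V _ _ _ h
    have := Nat.card_pos (α := V)
    omega
  | succ n ih =>
    intro V _ _ _ hcard hV hDm
    cases subsingleton_or_nontrivial V with
    | inl h => exact ⟨0, fun x _ v => Subsingleton.elim _ _⟩
    | inr h =>
      obtain ⟨v₀, hv0, hpv, hfix⟩ := exists_fixed_vector (p := p) (m := m) V hV
        (fun g v => hDm _ (hpow g) v)
      let U : Submodule (MonoidAlgebra ℤ G) V := Submodule.span _ {v₀}
      have hUfix : ∀ u ∈ U, p • u = 0 ∧ ∀ g, MonoidAlgebra.of ℤ G g • u = u := by
        intro u hu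
        obtain ⟨r, rfl⟩ := Submodule.mem_span_singleton.mp hu
        obtain ⟨c, hc⟩ : ∃ c : ℤ, r • v₀ = c • v₀ := by
          clear hu
          induction r using MonoidAlgebra.induction_on with
          | of g => exact ⟨1, by rw [hfix, one_smul]⟩
          | add a b ha hb =>
            obtain ⟨c, hc⟩ := ha
            obtain ⟨e, he⟩ := hb
            exact ⟨c + e, by rw [add_smul, hc, he, add_smul]⟩
          | smul c a ha =>
            obtain ⟨e, he⟩ := ha
            exact ⟨c * e, by rw [smul_assoc, he, mul_smul]⟩
        rw [hc]
        exact ⟨by rw [smul_comm, hpv, smul_zero], fun g => by rw [smul_comm, hfix]⟩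
      have hUnt : Nontrivial U :=
        ⟨⟨⟨v₀, Submodule.mem_span_singleton_self _⟩, 0, fun h => hv0 (congrArg Subtype.val h)⟩⟩
      have hfin : Finite (V ⧸ U) :=
        @Finite.of_surjective _ _ ‹_› (Submodule.mkQ U) (Submodule.mkQ_surjective U)
      have hlt : Nat.card (V ⧸ U) < Nat.card V := by
        rw [Submodule.card_eq_card_quotient_mul_card U]
        exact lt_mul_of_one_lt_left Nat.card_pos Finite.one_lt_card
      obtain ⟨N, hN⟩ := ih (V ⧸ U) (by omega)
        (fun v => by
          induction v using Submodule.Quotient.induction_on with | H v => ?_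
          rw [← Submodule.Quotient.mk_smul, hV, Submodule.Quotient.mk_zero])
        (fun g hg v => by
          induction v using Submodule.Quotient.induction_on with | H v => ?_
          rw [← Submodule.Quotient.mk_smul, hDm g hg])
      refine ⟨N + m + κ + 1, fun x hx v => ?_⟩
      refine augFilt_smul_eq_zero_of_le hanti hDm (N := N) (fun y hy w => hUfix _ ?_) hx le_rfl v
      rw [← Submodule.Quotient.mk_eq_zero, Submodule.Quotient.mk_smul]
      exact hN y hy _

/-- The additive functional on the group ring defined by a function on the group. -/
def groupRingLift {A : Type*} [AddCommGroup A] (c : G → A) : MonoidAlgebra ℤ G →+ A :=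
  (Finsupp.liftAddHom fun g => zmultiplesHom A (c g)).comp
    MonoidAlgebra.coeffAddEquiv.toAddMonoidHom

omit hp in
theorem groupRingLift_of {A : Type*} [AddCommGroup A] (c : G → A) (g : G) :
    groupRingLift c (MonoidAlgebra.of ℤ G g) = c g := by
  simp [groupRingLift, MonoidAlgebra.coeffAddEquiv]

/-- The functional is a matrix coefficient: let G act by right translation on the functions from G/D
m to ℤ/p^m, apply the ring element to c and evaluate at 1. -/
theorem exists_augFilt_groupRingLift_eq_zero {m : ℕ} (hanti : ∀ i j, i ≤ j → D j ≤ D i)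
    (hpow : ∀ g : G, g ^ p ^ m ∈ D m) [hn : (D m).Normal] [Finite (G ⧸ D m)] {c : G → ZMod (p ^ m)}
    (hc : ∀ g, ∀ k ∈ D m, c (g * k) = c g) :
    ∃ N, ∀ x ∈ augFilt p κ D N, groupRingLift c x = 0 := by
  have : NeZero (p ^ m) := ⟨pow_ne_zero _ hp.out.ne_zero⟩
  let V := (G ⧸ D m) → ZMod (p ^ m)
  let ρ : Representation ℤ G V :=
    { toFun := fun g => LinearMap.funLeft ℤ (ZMod (p ^ m)) fun y => y * (g : G ⧸ D m)
      map_one' := by ext1 f; funext y; simp [LinearMap.funLeft_apply]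
      map_mul' := fun a b => by
        ext1 f; funext y; simp [LinearMap.funLeft_apply, mul_assoc] }
  let _ : Module (MonoidAlgebra ℤ G) V := Module.compHom V (Representation.asAlgebraHom ρ).toRingHom
  have hof : ∀ (g : G) (f : V) (y : G ⧸ D m),
      (MonoidAlgebra.of ℤ G g • f) y = f (y * (g : G ⧸ D m)) := by
    intro g f y
    change (Representation.asAlgebraHom ρ (MonoidAlgebra.of ℤ G g)) f y = _
    rw [Representation.asAlgebraHom_of]
    rfl
  obtain ⟨N, hN⟩ := exists_augFilt_smul_eq_zero (p := p) (κ := κ) (m := m) hanti hpow _ V le_rfl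
    (fun v => by
      funext y
      rw [Pi.smul_apply, Pi.zero_apply, nsmul_eq_mul, ZMod.natCast_self, zero_mul])
    (fun g hg v => by
      funext y
      rw [hof, (QuotientGroup.eq_one_iff g).mpr hg, mul_one])
  let cbar : V := Quotient.lift c fun a b hab => by
    have := QuotientGroup.eq.mp (Quotient.sound hab)
    have h2 := hc a _ this
    rw [mul_inv_cancel_left] at h2
    exact h2.symm
  have hval : ∀ x : MonoidAlgebra ℤ G, groupRingLift c x = (x • cbar) 1 := by
    intro x
    induction x using MonoidAlgebra.induction_on with
    | of g => rw [groupRingLift_of, hof, one_mul]; rfl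
    | add a b ha hb => rw [map_add, ha, hb, add_smul]; rfl
    | smul r a ha => rw [map_zsmul, ha, smul_assoc]; rfl
  exact ⟨N, fun x hx => by rw [hval, hN x hx]; rfl⟩

end Nilpotency

section Coordinates

variable {G : Type*} [Group G] {d : ℕ}

theorem prod_map_sorted {M : Type*} [Monoid M] (h : Fin d → M) {s : List (Fin d)}
    (hs : s.Pairwise (· ≤ ·)) :
    (s.map h).prod = (List.ofFn fun i => h i ^ s.count i).prod := by
  set t := (List.finRange d).flatMap fun i => List.replicate (s.count i) i with ht
  have hst : s = t := by
    refine List.Perm.eq_of_pairwise (le := (· ≤ ·)) (fun a b _ _ => le_antisymm) hs ?_ ?_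
    · rw [ht, List.pairwise_flatMap]
      refine ⟨fun a _ => List.pairwise_replicate.mpr (Or.inr le_rfl), ?_⟩
      refine (List.pairwise_lt_finRange d).imp fun {a b} hab x hx y hy => ?_
      rw [List.eq_of_mem_replicate hx, List.eq_of_mem_replicate hy]
      exact hab.le
    · rw [List.perm_iff_count]
      intro a
      rw [ht, List.count_flatMap]
      have : (List.map (List.count a ∘ fun i => List.replicate (s.count i) i) (List.finRange d)).sum
          = ∑ i : Fin d, if i = a then s.count i else 0 := by
        rw [← List.ofFn_eq_map, List.sum_ofFn]
        refine Finset.sum_congr rfl fun i _ => ?_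
        simp [List.count_replicate]
      rw [this]
      simp
  rw [List.ofFn_eq_map]
  conv_lhs => rw [hst, ht]
  generalize List.finRange d = l
  induction l with
  | nil => simp
  | cons a l ih => simp [ih]

/-- A function on the group whose values on sorted products of the `h i` are the exponents, takes
the value zero on all sorted words except those of length one. -/
theorem groupRingLift_word {A : Type*} [AddCommGroupWithOne A] {h : Fin d → G} {c : G → A}
    {i : Fin d}
    (hc : ∀ s : List (Fin d), s.Pairwise (· ≤ ·) → c (s.map h).prod = (s.count i : A))
    (l : List (Fin d)) : ∀ s : List (Fin d), (s ++ l).Pairwise (· ≤ ·) →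
      groupRingLift c (MonoidAlgebra.of ℤ G (s.map h).prod * augWord h l) =
        match l with
        | [] => (s.count i : A)
        | [j] => if j = i then 1 else 0
        | _ => 0 := by
  induction l with
  | nil =>
    intro s hs
    rw [List.append_nil] at hs
    rw [augWord_nil, mul_one, groupRingLift_of, hc s hs]
  | cons j l ih =>
    intro s hs
    have h1 := ih (s ++ [j]) (by simpa using hs)
    have h2 := ih s (hs.sublist (List.Sublist.append_left (List.sublist_cons_self j l) s))
    -- Expanding the factor h j - 1 gives a difference of two values on the same shorter word with
    -- different sorted prefixes. These values depend on the prefix only when the shorter word is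
    -- empty.
    have e : MonoidAlgebra.of ℤ G (s.map h).prod * augWord h (j :: l) =
        MonoidAlgebra.of ℤ G ((s ++ [j]).map h).prod * augWord h l -
          MonoidAlgebra.of ℤ G (s.map h).prod * augWord h l := by
      rw [augWord_cons, ← mul_assoc, mul_sub, mul_one, sub_mul, ← map_mul]
      simp
    rw [e, map_sub, h1, h2]
    rcases l with - | ⟨j', - | ⟨j'', l⟩⟩
    · simp [List.count_singleton]
    · simp
    · simp

end Coordinates

namespace IsUniformFiltration

variable {G : Type*} [Group G] [TopologicalSpace G] [IsTopologicalGroup G] [CompactSpace G]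
  {p κ : ℕ} [hp : Fact p.Prime] {D : ℕ → Subgroup G} {d : ℕ} {h : Fin d → G}

/-- A continuous `ℤ_p`-valued function which is a coordinate on sorted products is strictly
decreasing along the filtration of the group ring. -/
theorem pow_dvd_groupRingLift (hD : IsUniformFiltration p κ D) (hb : IsFrattiniBasis p D h)
    {c : G → ℤ_[p]} {i : Fin d}
    (hc : ∀ s : List (Fin d), s.Pairwise (· ≤ ·) → c (s.map h).prod = (s.count i : ℤ_[p]))
    (hcont : ∀ m g, ∀ k ∈ D m, (p : ℤ_[p]) ^ m ∣ c (g * k) - c g) {n : ℕ} {x : MonoidAlgebra ℤ G}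
    (hx : x ∈ augFilt p κ D n) : (p : ℤ_[p]) ^ (n - κ) ∣ groupRingLift c x := by
  -- Only words of length one have a nonzero value; there the exponent of p is exactly k - κ.
  have hsorted : ∀ k, ∀ y ∈ wordSpan p κ h (sortedLists d) k,
      (p : ℤ_[p]) ^ (k - κ) ∣ groupRingLift c y := by
    intro k y hy
    refine AddSubgroup.closure_induction
      (p := fun y _ => (p : ℤ_[p]) ^ (k - κ) ∣ groupRingLift c y) ?_ ?_ ?_ ?_ hy
    · rintro _ ⟨a, l, hl, rfl, rfl⟩
      have hw := groupRingLift_word hc l [] (by simpa [sortedLists] using hl)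
      simp only [List.map_nil, List.prod_nil, map_one, one_mul] at hw
      have e : (p : MonoidAlgebra ℤ G) ^ a * augWord h l = (p ^ a : ℕ) • augWord h l := by
        rw [nsmul_eq_mul, Nat.cast_pow]
      rw [e, map_nsmul, hw, nsmul_eq_mul, Nat.cast_pow]
      rcases l with - | ⟨j', - | ⟨j'', l⟩⟩
      · simp
      · simp only [List.length_singleton]
        split_ifs <;> simp_all
      · simp
    · simp
    · intro a b _ _ ha hb
      rw [map_add]; exact dvd_add ha hb
    · intro a _ ha
      rw [map_neg]; exact (dvd_neg).mpr ha
  -- Removing sorted combinations pushes x arbitrarily deep without changing its value modulo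
  -- p^(n-κ).
  have happrox : ∀ k, ∃ v ∈ augFilt p κ D (n + k),
      (p : ℤ_[p]) ^ (n - κ) ∣ groupRingLift c x - groupRingLift c v := by
    intro k
    induction k with
    | zero => exact ⟨x, hx, by simp⟩
    | succ k ih =>
      obtain ⟨v, hv, hvx⟩ := ih
      obtain ⟨y, hy, z, hz, rfl⟩ := AddSubgroup.mem_sup.mp (hD.augFilt_le_sorted hb _ hv)
      refine ⟨z, hz, ?_⟩
      have h1 := hsorted _ y hy
      have h2 : (p : ℤ_[p]) ^ (n - κ) ∣ groupRingLift c y :=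
        (pow_dvd_pow _ (by omega)).trans h1
      have := dvd_add hvx h2
      rw [map_add] at this
      convert this using 1
      ring
  have := hD.normal (n - κ)
  have hfin : Finite (G ⧸ D (n - κ)) := Subgroup.quotient_finite_of_isOpen _ (hD.isOpen _)
  -- Modulo p^(n-κ) the function c factors through a finite quotient, so its functional vanishes on
  -- a deep step.
  obtain ⟨N, hN⟩ := exists_augFilt_groupRingLift_eq_zero (p := p) (κ := κ) (m := n - κ)
    (fun i j hij => hD.le_of_le hij)
    (fun g => by simpa using hD.pow_pow_mem (hD.mem_zero g) (n - κ))
    (c := fun g => PadicInt.toZModPow (n - κ) (c g))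
    (fun g k hk => by
      rw [← sub_eq_zero, ← map_sub, ← RingHom.mem_ker, PadicInt.ker_toZModPow,
        Ideal.mem_span_singleton]
      exact hcont _ g k hk)
  have hcomp : ∀ y, groupRingLift (fun g => PadicInt.toZModPow (n - κ) (c g)) y =
      PadicInt.toZModPow (n - κ) (groupRingLift c y) := by
    intro y
    induction y using MonoidAlgebra.induction_on with
    | of g => rw [groupRingLift_of, groupRingLift_of]
    | add a b ha hb => rw [map_add, map_add, ha, hb, map_add]
    | smul r a ha => rw [map_zsmul, map_zsmul, ha, map_zsmul]
  obtain ⟨v, hv, hvx⟩ := happrox N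
  have h1 := hN v (augFilt_antitone (by omega) hv)
  rw [hcomp, ← RingHom.mem_ker, PadicInt.ker_toZModPow, Ideal.mem_span_singleton] at h1
  have := dvd_add hvx h1
  rwa [sub_add_cancel] at this

end IsUniformFiltration

end UniformPro
end

/-! ### The Banach dual of the filtered group ring and the representation of `G` -/

noncomputable section
namespace UniformPro

section FiltrationDual

open scoped BoundedContinuousFunction

variable {R : Type*} [Ring R]

/-- A decreasing multiplicative filtration of a ring, exhausting it in degree `0`. -/
structure IsRingFiltration (J : ℕ → AddSubgroup R) : Prop where
  mem_zero : ∀ x, x ∈ J 0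
  mul_mem : ∀ {m n x y}, x ∈ J m → y ∈ J n → x * y ∈ J (m + n)

/-- The elements of a filtered ring together with a degree, as a discrete space. -/
def FiltPoint (J : ℕ → AddSubgroup R) : Type _ := (n : ℕ) × J n

instance (J : ℕ → AddSubgroup R) : TopologicalSpace (FiltPoint J) := ⊥

instance (J : ℕ → AddSubgroup R) : DiscreteTopology (FiltPoint J) := ⟨rfl⟩

/-- An element of the `n`-th step of the filtration, in degree `n`. -/
def FiltPoint.mk {J : ℕ → AddSubgroup R} (n : ℕ) (u : R) (hu : u ∈ J n) : FiltPoint J := ⟨n, u, hu⟩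

/-- The additive functionals `f` on a filtered ring with `p ^ n * f` bounded on the `n`-th step,
uniformly in `n`, encoded by the bounded functions `(n, u) ↦ p ^ (-n) * f u`. -/
def filtDual (p : ℕ) [Fact p.Prime] (J : ℕ → AddSubgroup R) :
    Submodule ℚ_[p] (FiltPoint J →ᵇ ℚ_[p]) where
  carrier := {b | (∀ n u v hu hv, b (.mk n (u + v) (add_mem hu hv)) =
      b (.mk n u hu) + b (.mk n v hv)) ∧
    ∀ n u h0 hn, b (.mk 0 u h0) = (p : ℚ_[p]) ^ n * b (.mk n u hn)}
  add_mem' := by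
    rintro a b ⟨ha, ha'⟩ ⟨hb, hb'⟩
    refine ⟨fun n u v hu hv => ?_, fun n u h0 hn => ?_⟩
    · simp only [BoundedContinuousFunction.coe_add, Pi.add_apply]
      rw [ha n u v hu hv, hb n u v hu hv]; ring
    · simp only [BoundedContinuousFunction.coe_add, Pi.add_apply, ha' n u h0 hn, hb' n u h0 hn]
      ring
  zero_mem' := by simp
  smul_mem' := by
    rintro c b ⟨hb, hb'⟩
    refine ⟨fun n u v hu hv => ?_, fun n u h0 hn => ?_⟩
    · simp only [BoundedContinuousFunction.coe_smul, smul_eq_mul]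
      rw [hb n u v hu hv]; ring
    · simp only [BoundedContinuousFunction.coe_smul, smul_eq_mul, hb' n u h0 hn]
      ring

variable {p : ℕ} [hp : Fact p.Prime] {J : ℕ → AddSubgroup R}

theorem isClosed_filtDual : IsClosed (filtDual p J : Set (FiltPoint J →ᵇ ℚ_[p])) := by
  have hc : ∀ x : FiltPoint J, Continuous fun b : FiltPoint J →ᵇ ℚ_[p] => b x :=
    fun x => (BoundedContinuousFunction.lipschitz_eval_const x).continuous
  have e : (filtDual p J : Set (FiltPoint J →ᵇ ℚ_[p])) =
      (⋂ n, ⋂ u, ⋂ v, ⋂ hu, ⋂ hv, {b | b (.mk n (u + v) (add_mem hu hv)) =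
        b (.mk n u hu) + b (.mk n v hv)}) ∩
      ⋂ n, ⋂ u, ⋂ h0, ⋂ hn, {b | b (.mk 0 u h0) = (p : ℚ_[p]) ^ n * b (.mk n u hn)} := by
    ext b
    simp only [filtDual, Set.mem_inter_iff, Set.mem_iInter]
    rfl
  rw [e]
  refine IsClosed.inter ?_ ?_
  · exact isClosed_iInter fun n => isClosed_iInter fun u => isClosed_iInter fun v =>
      isClosed_iInter fun hu => isClosed_iInter fun hv =>
        isClosed_eq (hc _) ((hc _).add (hc _))
  · exact isClosed_iInter fun n => isClosed_iInter fun u => isClosed_iInter fun h0 =>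
      isClosed_iInter fun hn => isClosed_eq (hc _) (continuous_const.mul (hc _))

instance : CompleteSpace (filtDual p J) := isClosed_filtDual.completeSpace_coe

theorem filtDual_apply_add (b : filtDual p J) (n : ℕ) (u v : R) (hu : u ∈ J n) (hv : v ∈ J n) :
    b.1 (.mk n (u + v) (add_mem hu hv)) = b.1 (.mk n u hu) + b.1 (.mk n v hv) :=
  b.2.1 n u v hu hv

theorem filtDual_apply_zero (b : filtDual p J) (n : ℕ) (u : R) (h0 : u ∈ J 0) (hn : u ∈ J n) :
    b.1 (.mk 0 u h0) = (p : ℚ_[p]) ^ n * b.1 (.mk n u hn) :=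
  b.2.2 n u h0 hn

theorem norm_filtDual_apply_le (b : filtDual p J) (x : FiltPoint J) : ‖b.1 x‖ ≤ ‖b‖ :=
  b.1.norm_coe_le_norm x

/-- A functional with the right growth as an element of the dual. -/
def filtDualMk (f : R →+ ℚ_[p]) (C : ℝ)
    (hf : ∀ n, ∀ u ∈ J n, ‖((p : ℚ_[p]) ^ n)⁻¹ * f u‖ ≤ C) : filtDual p J :=
  ⟨BoundedContinuousFunction.ofNormedAddCommGroupDiscrete
    (fun x : FiltPoint J => ((p : ℚ_[p]) ^ x.1)⁻¹ * f x.2.1) C (fun x => hf x.1 x.2.1 x.2.2), by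
    have hp0 : (p : ℚ_[p]) ≠ 0 := by exact_mod_cast hp.out.ne_zero
    refine ⟨fun n u v hu hv => ?_, fun n u h0 hn => ?_⟩
    · simp [FiltPoint.mk, mul_add]
    · simp only [FiltPoint.mk, BoundedContinuousFunction.coe_ofNormedAddCommGroupDiscrete]
      field_simp⟩

theorem filtDualMk_apply_zero (f : R →+ ℚ_[p]) (C : ℝ)
    (hf : ∀ n, ∀ u ∈ J n, ‖((p : ℚ_[p]) ^ n)⁻¹ * f u‖ ≤ C) (u : R) (h0 : u ∈ J 0) :
    (filtDualMk f C hf).1 (.mk 0 u h0) = f u := by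
  simp [filtDualMk, FiltPoint.mk]

/-- The Banach algebra of operators on the dual of a filtered ring. -/
def OperatorAlgebra (p : ℕ) [Fact p.Prime] (J : ℕ → AddSubgroup R) : Type _ :=
  filtDual p J →L[ℚ_[p]] filtDual p J

instance : NormedRing (OperatorAlgebra p J) :=
  inferInstanceAs (NormedRing (filtDual p J →L[ℚ_[p]] filtDual p J))

instance : NormedAlgebra ℚ_[p] (OperatorAlgebra p J) :=
  inferInstanceAs (NormedAlgebra ℚ_[p] (filtDual p J →L[ℚ_[p]] filtDual p J))

instance : CompleteSpace (OperatorAlgebra p J) :=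
  inferInstanceAs (CompleteSpace (filtDual p J →L[ℚ_[p]] filtDual p J))

namespace IsRingFiltration

theorem mul_mem_left (hJ : IsRingFiltration J) {n : ℕ} {u : R} (hu : u ∈ J n) (r : R) :
    u * r ∈ J n := hJ.mul_mem hu (hJ.mem_zero r)

/-- The right translation operators on the dual. -/
def opCLM (hJ : IsRingFiltration J) (r : R) : filtDual p J →L[ℚ_[p]] filtDual p J :=
  LinearMap.mkContinuous
    { toFun := fun b => ⟨BoundedContinuousFunction.ofNormedAddCommGroupDiscrete
        (fun x : FiltPoint J => b.1 (.mk x.1 (x.2.1 * r) (hJ.mul_mem_left x.2.2 r))) ‖b‖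
        (fun _ => norm_filtDual_apply_le b _), by
        refine ⟨fun n u v hu hv => ?_, fun n u h0 hn => ?_⟩
        · have := filtDual_apply_add b n (u * r) (v * r) (hJ.mul_mem_left hu r)
            (hJ.mul_mem_left hv r)
          simp only [← add_mul] at this
          exact this
        · exact filtDual_apply_zero b n (u * r) _ _⟩
      map_add' := fun _ _ => rfl
      map_smul' := fun _ _ => rfl } 1
    (fun b => by
      rw [one_mul]
      exact (BoundedContinuousFunction.norm_le (norm_nonneg b)).mpr
        fun _ => norm_filtDual_apply_le b _)

theorem opCLM_apply (hJ : IsRingFiltration J) (r : R) (b : filtDual p J) (n : ℕ) (u : R)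
    (hu : u ∈ J n) : (hJ.opCLM r b).1 (.mk n u hu) = b.1 (.mk n (u * r) (hJ.mul_mem_left hu r)) :=
  rfl

/-- The ring homomorphism from a filtered ring to the operators on its dual. -/
def opHom (hJ : IsRingFiltration J) : R →+* OperatorAlgebra p J where
  toFun := hJ.opCLM
  map_one' := by
    refine ContinuousLinearMap.ext fun b => Subtype.ext (BoundedContinuousFunction.ext ?_)
    rintro ⟨n, u, hu⟩
    refine (hJ.opCLM_apply 1 b n u hu).trans ?_
    simp only [mul_one]; rfl
  map_mul' r s := by
    refine ContinuousLinearMap.ext fun b => Subtype.ext (BoundedContinuousFunction.ext ?_)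
    rintro ⟨n, u, hu⟩
    refine (hJ.opCLM_apply (r * s) b n u hu).trans ?_
    simp only [← mul_assoc]; rfl
  map_zero' := by
    refine ContinuousLinearMap.ext fun b => Subtype.ext (BoundedContinuousFunction.ext ?_)
    rintro ⟨n, u, hu⟩
    refine (hJ.opCLM_apply 0 b n u hu).trans ?_
    have := filtDual_apply_add b n 0 0 (zero_mem _) (zero_mem _)
    simp only [mul_zero]
    simp only [add_zero, left_eq_add] at this
    exact this
  map_add' r s := by
    refine ContinuousLinearMap.ext fun b => Subtype.ext (BoundedContinuousFunction.ext ?_)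
    rintro ⟨n, u, hu⟩
    refine (hJ.opCLM_apply (r + s) b n u hu).trans ?_
    simp only [mul_add]
    exact filtDual_apply_add b n _ _ _ _

/-- For u in degree n the product u r already lies in degree n + m; evaluating there instead of in
degree n brings out the factor p^m. -/
theorem norm_opHom_le (hJ : IsRingFiltration J) {m : ℕ} {r : R} (hr : r ∈ J m) :
    ‖hJ.opHom (p := p) r‖ ≤ ((p : ℝ) ^ m)⁻¹ := by
  change ‖hJ.opCLM (p := p) r‖ ≤ _
  have hp0 : (p : ℚ_[p]) ≠ 0 := by exact_mod_cast hp.out.ne_zero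
  refine ContinuousLinearMap.opNorm_le_bound _ (by positivity) fun b => ?_
  refine (BoundedContinuousFunction.norm_le (by positivity)).mpr ?_
  rintro ⟨n, u, hu⟩
  have e : (hJ.opCLM r b).1 (.mk n u hu) =
      (p : ℚ_[p]) ^ m * b.1 (.mk (n + m) (u * r) (hJ.mul_mem hu hr)) := by
    have h1 := filtDual_apply_zero b n (u * r) (hJ.mem_zero _) (hJ.mul_mem_left hu r)
    have h2 := filtDual_apply_zero b (n + m) (u * r) (hJ.mem_zero _) (hJ.mul_mem hu hr)
    rw [h1, pow_add, mul_assoc] at h2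
    exact mul_left_cancel₀ (pow_ne_zero n hp0) h2
  refine (congrArg norm e).trans_le ?_
  rw [norm_mul, norm_pow, Padic.norm_p, inv_pow]
  exact mul_le_mul_of_nonneg_left (norm_filtDual_apply_le b _) (by positivity)

end IsRingFiltration

end FiltrationDual

section GroupOperators

variable {G : Type*} [Group G] [TopologicalSpace G] {p κ : ℕ} [hp : Fact p.Prime]
  {D : ℕ → Subgroup G} {d : ℕ} {h : Fin d → G}

omit hp in
theorem IsUniformFiltration.isRingFiltration (hD : IsUniformFiltration p κ D) :
    IsRingFiltration (augFilt p κ D) where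
  mem_zero := mem_augFilt_zero
  mul_mem := mul_mem_augFilt hD.zero

namespace IsUniformFiltration

/-- The representation of the group in the Banach algebra of operators. -/
def rep (hD : IsUniformFiltration p κ D) : G →* OperatorAlgebra p (augFilt p κ D) :=
  (hD.isRingFiltration.opHom (p := p)).toMonoidHom.comp (MonoidAlgebra.of ℤ G)

theorem norm_rep_sub_one_le (hD : IsUniformFiltration p κ D) {n : ℕ} {g : G} (hg : g ∈ D n) :
    ‖hD.rep g - 1‖ ≤ ((p : ℝ) ^ n)⁻¹ := by
  have e : hD.rep g - 1 = hD.isRingFiltration.opHom (p := p) (MonoidAlgebra.of ℤ G g - 1) := by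
    rw [map_sub, map_one]; rfl
  rw [e]
  exact hD.isRingFiltration.norm_opHom_le (augFilt_antitone (by omega) (sub_one_mem_augFilt hg))

theorem continuous_rep [IsTopologicalGroup G] (hD : IsUniformFiltration p κ D) :
    Continuous hD.rep := by
  refine continuous_of_continuousAt_one hD.rep ?_
  rw [ContinuousAt, map_one, Metric.tendsto_nhds]
  intro ε hε
  have hp1 : (1 : ℝ) < p := by exact_mod_cast hp.out.one_lt
  obtain ⟨n, hn⟩ := exists_pow_lt_of_lt_one hε (inv_lt_one_of_one_lt₀ hp1)
  filter_upwards [hD.mem_nhds_one n] with g hg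
  rw [dist_eq_norm]
  refine (hD.norm_rep_sub_one_le hg).trans_lt ?_
  rwa [← inv_pow]

section Coord

variable [IsTopologicalGroup G] [CompactSpace G] [T2Space G]

/-- The coordinates with respect to an ordered basis. -/
def coord (hD : IsUniformFiltration p κ D) (hb : IsFrattiniBasis p D h) (i : Fin d) (g : G) :
    ℤ_[p] := (hD.orderedProdHomeomorph hb).symm g i

theorem orderedProd_coord (hD : IsUniformFiltration p κ D) (hb : IsFrattiniBasis p D h) (g : G) :
    orderedProd h (fun i => hD.coord hb i g) = g :=
  (hD.orderedProdHomeomorph hb).apply_symm_apply g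

theorem coord_orderedProd (hD : IsUniformFiltration p κ D) (hb : IsFrattiniBasis p D h)
    (x : Fin d → ℤ_[p]) (i : Fin d) : hD.coord hb i (orderedProd h x) = x i :=
  congrFun ((hD.orderedProdHomeomorph hb).symm_apply_apply x) i

theorem pow_dvd_groupRingLift_coord (hD : IsUniformFiltration p κ D) (hb : IsFrattiniBasis p D h)
    (i : Fin d) {n : ℕ} {x : MonoidAlgebra ℤ G} (hx : x ∈ augFilt p κ D n) :
    (p : ℤ_[p]) ^ (n - κ) ∣ groupRingLift (hD.coord hb i) x := by
  refine hD.pow_dvd_groupRingLift hb (i := i) (fun s hs => ?_) (fun m g k hk => ?_) hx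
  · rw [prod_map_sorted h hs, ← hD.orderedProd_natCast, hD.coord_orderedProd]
  · refine (hD.orderedProd_inv_mul_mem hb (x := fun i => hD.coord hb i g)
      (y := fun i => hD.coord hb i (g * k))).mp ?_ i
    rw [hD.orderedProd_coord, hD.orderedProd_coord]
    simpa using hk

/-- The coordinate functions extend to continuous functionals on the operator algebra. -/
theorem exists_coord_functional (hD : IsUniformFiltration p κ D) (hb : IsFrattiniBasis p D h)
    (i : Fin d) : ∃ l : OperatorAlgebra p (augFilt p κ D) →L[ℚ_[p]] ℚ_[p],
      ∀ g, l (hD.rep g) = (hD.coord hb i g : ℚ_[p]) := by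
  have hp0 : (p : ℝ) ≠ 0 := by exact_mod_cast hp.out.ne_zero
  have hp1 : (1 : ℝ) ≤ p := by exact_mod_cast hp.out.one_le
  let f : MonoidAlgebra ℤ G →+ ℚ_[p] :=
    (PadicInt.Coe.ringHom (p := p)).toAddMonoidHom.comp (groupRingLift (hD.coord hb i))
  -- The divisibility by p^(n-κ) says precisely that the coordinate belongs to the dual, with bound
  -- p^κ.
  have hf : ∀ n, ∀ u ∈ augFilt p κ D n, ‖((p : ℚ_[p]) ^ n)⁻¹ * f u‖ ≤ (p : ℝ) ^ κ := by
    intro n u hu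
    obtain ⟨z, hz⟩ := hD.pow_dvd_groupRingLift_coord hb i hu
    have e : f u = (p : ℚ_[p]) ^ (n - κ) * (z : ℚ_[p]) := by
      change ((groupRingLift (hD.coord hb i) u : ℤ_[p]) : ℚ_[p]) = _
      rw [hz]; push_cast; rfl
    rw [e, norm_mul, norm_inv, norm_mul, norm_pow, norm_pow, Padic.norm_p, inv_pow, inv_inv,
      ← mul_assoc]
    have h1 : (p : ℝ) ^ n * (p⁻¹ : ℝ) ^ (n - κ) ≤ (p : ℝ) ^ κ := by
      rw [inv_pow, ← div_eq_mul_inv, div_le_iff₀ (by positivity), ← pow_add]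
      exact pow_le_pow_right₀ hp1 (by omega)
    calc _ ≤ (p : ℝ) ^ κ * 1 := mul_le_mul h1 z.norm_le_one (norm_nonneg _) (by positivity)
      _ = _ := mul_one _
  let ξ : filtDual p (augFilt p κ D) := filtDualMk f _ hf
  let ev : filtDual p (augFilt p κ D) →L[ℚ_[p]] ℚ_[p] :=
    LinearMap.mkContinuous
      { toFun := fun b => b.1 (.mk 0 1 (mem_augFilt_zero 1))
        map_add' := fun _ _ => rfl
        map_smul' := fun _ _ => rfl } 1
      (fun b => by rw [one_mul]; exact norm_filtDual_apply_le b _)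
  -- The functional sends T to (Tξ)(1): translating ξ by g and evaluating at 1 returns ξ(g).
  refine ⟨ev.comp (ContinuousLinearMap.apply ℚ_[p] _ ξ), fun g => ?_⟩
  change (hD.isRingFiltration.opCLM (MonoidAlgebra.of ℤ G g) ξ).1
    (.mk 0 1 (mem_augFilt_zero 1)) = _
  rw [IsRingFiltration.opCLM_apply]
  simp only [one_mul]
  refine (filtDualMk_apply_zero f _ hf _ _).trans ?_
  change ((groupRingLift (hD.coord hb i) (MonoidAlgebra.of ℤ G g) : ℤ_[p]) : ℚ_[p]) = _
  rw [groupRingLift_of]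

end Coord

end IsUniformFiltration

end GroupOperators

end UniformPro
end

/-! ### Continuous characters of `ℤ_p` in Banach algebras -/

noncomputable section
namespace UniformPro

section PadicExp

open NormedSpace

variable {p : ℕ} [hp : Fact p.Prime]

/-- The crude bound v_p(n!) ≤ n suffices, since only a positive radius of convergence of the
exponential is needed. -/
theorem norm_inv_factorial_le (n : ℕ) : ‖((n.factorial : ℚ_[p]))⁻¹‖ ≤ (p : ℝ) ^ n := by
  have hp1 : (1 : ℝ) < p := by exact_mod_cast hp.out.one_lt
  have hn : (n.factorial : ℚ_[p]) ≠ 0 := by exact_mod_cast n.factorial_ne_zero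
  have hle : padicValNat p n.factorial ≤ n := by
    have h1 := sub_one_mul_padicValNat_factorial (p := p) n
    have h2 := hp.out.two_le
    have h3 : 1 * padicValNat p n.factorial ≤ (p - 1) * padicValNat p n.factorial :=
      Nat.mul_le_mul_right _ (by omega)
    omega
  rw [norm_inv, Padic.norm_eq_zpow_neg_valuation hn, zpow_neg, inv_inv, Padic.valuation_natCast,
    zpow_natCast]
  exact pow_le_pow_right₀ hp1.le hle

variable {A : Type*} [NormedRing A] [NormedAlgebra ℚ_[p] A]

theorem expSeries_radius_pos_padic : 0 < (expSeries ℚ_[p] A).radius := by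
  have hp0 : (0 : ℝ) < p := by exact_mod_cast hp.out.pos
  have h := (expSeries ℚ_[p] A).le_radius_of_bound (max 1 ‖(1 : A)‖) (r := (p : NNReal)⁻¹)
    (fun n => by
      have h1 : ‖expSeries ℚ_[p] A n‖ ≤ (p : ℝ) ^ n * max 1 ‖(1 : A)‖ := by
        rw [expSeries]
        refine (ContinuousMultilinearMap.opNorm_smul_le _ _).trans ?_
        exact mul_le_mul (norm_inv_factorial_le n) ContinuousMultilinearMap.norm_mkPiAlgebraFin_le
          (ContinuousMultilinearMap.opNorm_nonneg _) (by positivity)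
      calc _ ≤ ((p : ℝ) ^ n * max 1 ‖(1 : A)‖) * ((p : ℝ)⁻¹) ^ n := by
            push_cast
            gcongr
        _ = _ := by
          rw [mul_right_comm, ← mul_pow, mul_inv_cancel₀ hp0.ne', one_pow, one_mul])
  refine lt_of_lt_of_le ?_ h
  simp

/-- The extension by zero of the identity to a retraction of `ℚ_p` onto `ℤ_p`. -/
def toPadicInt (y : ℚ_[p]) : ℤ_[p] := if hy : ‖y‖ ≤ 1 then ⟨y, hy⟩ else 0

@[simp]
theorem toPadicInt_coe (x : ℤ_[p]) : toPadicInt (x : ℚ_[p]) = x := by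
  apply Subtype.coe_injective
  simp [toPadicInt, x.norm_le_one]

theorem coe_toPadicInt {y : ℚ_[p]} (hy : ‖y‖ ≤ 1) : (toPadicInt y : ℚ_[p]) = y := by
  simp [toPadicInt, hy]

theorem isOpen_norm_le_one : IsOpen {y : ℚ_[p] | ‖y‖ ≤ 1} := by
  have := IsUltrametricDist.isOpen_closedBall (0 : ℚ_[p]) one_ne_zero
  convert this using 1
  ext; simp

variable [CompleteSpace A]

theorem exp_nsmul_of_forall_mem_ball {v : A}
    (hv : ∀ n : ℕ, n • v ∈ Metric.eball (0 : A) (expSeries ℚ_[p] A).radius) (n : ℕ) :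
    exp (n • v) = exp v ^ n := by
  induction n with
  | zero => simp
  | succ n ih =>
    rw [succ_nsmul, exp_add_of_commute_of_mem_ball (𝕂 := ℚ_[p])
      ((Commute.refl v).smul_left n) (hv n) (by simpa using hv 1), ih, pow_succ]

/-- A continuous multiplicative character of `ℤ_p` with values in a Banach algebra over `ℚ_p` is
analytic. -/
theorem analyticAt_of_map_add {φ : ℤ_[p] → A} (hc : Continuous φ) (h0 : φ 0 = 1)
    (hadd : ∀ x y, φ (x + y) = φ x * φ y) {y : ℚ_[p]} (hy : ‖y‖ ≤ 1) :
    AnalyticAt ℚ_[p] (fun t => φ (toPadicInt t)) y := by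
  have hp0 : (p : ℚ_[p]) ≠ 0 := by exact_mod_cast hp.out.ne_zero
  have hp1 : (1 : ℝ) < p := by exact_mod_cast hp.out.one_lt
  have hr := expSeries_radius_pos_padic (p := p) (A := A)
  have hball : Metric.eball (0 : A) (expSeries ℚ_[p] A).radius ∈ 𝓝 (0 : A) :=
    Metric.eball_mem_nhds _ hr
  obtain ⟨ε, hε, hεb⟩ := Metric.mem_nhds_iff.mp hball
  -- By the inverse function theorem exp is open at 0, so φ(p^m), being close to 1 for large m,
  -- equals exp v for a small v.
  have hstrict : HasStrictFDerivAt (exp : A → A)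
      ((ContinuousLinearEquiv.refl ℚ_[p] A : A ≃L[ℚ_[p]] A) : A →L[ℚ_[p]] A) 0 :=
    hasStrictFDerivAt_exp_zero_of_radius_pos hr
  have hmap := hstrict.map_nhds_eq_of_equiv
  rw [exp_zero] at hmap
  have himg : exp '' Metric.ball (0 : A) ε ∈ 𝓝 (1 : A) := by
    rw [← hmap]
    exact Filter.image_mem_map (Metric.ball_mem_nhds _ hε)
  have htend : Filter.Tendsto (fun m : ℕ => φ ((p : ℤ_[p]) ^ m)) Filter.atTop (𝓝 1) := by
    rw [← h0]
    refine (hc.tendsto 0).comp (tendsto_pow_atTop_nhds_zero_of_norm_lt_one ?_)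
    rw [PadicInt.norm_p]; exact inv_lt_one_of_one_lt₀ hp1
  obtain ⟨m, v, hv, hvm⟩ := (htend.eventually himg).exists
  have hmem : ∀ t : ℚ_[p], ‖t‖ ≤ 1 → t • v ∈ Metric.eball (0 : A) (expSeries ℚ_[p] A).radius := by
    intro t ht
    apply hεb
    rw [mem_ball_zero_iff] at hv ⊢
    rw [norm_smul]
    exact (mul_le_of_le_one_left (norm_nonneg _) ht).trans_lt hv
  have hnat : ∀ n : ℕ, φ ((p : ℤ_[p]) ^ m * n) = exp ((n : ℚ_[p]) • v) := by
    intro n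
    have e : ∀ k : ℕ, φ ((p : ℤ_[p]) ^ m * k) = φ ((p : ℤ_[p]) ^ m) ^ k := by
      intro k
      induction k with
      | zero => simp [h0]
      | succ k ih => rw [Nat.cast_succ, mul_add, mul_one, hadd, ih, pow_succ]
    rw [e, ← hvm, Nat.cast_smul_eq_nsmul, exp_nsmul_of_forall_mem_ball (p := p)]
    intro k
    rw [← Nat.cast_smul_eq_nsmul ℚ_[p]]
    exact hmem _ (by exact_mod_cast (k : ℤ_[p]).norm_le_one)
  -- Both sides are continuous and agree on the dense subset of natural numbers.
  have hexp : ∀ x : ℤ_[p], φ ((p : ℤ_[p]) ^ m * x) = exp ((x : ℚ_[p]) • v) := by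
    intro x
    refine congrFun (DenseRange.equalizer (f := ((↑) : ℕ → ℤ_[p])) PadicInt.denseRange_natCast
      (g := fun x => φ ((p : ℤ_[p]) ^ m * x))
      (h := fun x : ℤ_[p] => exp ((x : ℚ_[p]) • v)) (by fun_prop) ?_ ?_) x
    · refine (continuousOn_exp (𝕂 := ℚ_[p]) (𝔸 := A)).comp_continuous
        (continuous_subtype_val.smul continuous_const)
        fun x => hmem _ x.norm_le_one
    · funext n
      simpa using hnat n
  -- Near y one has t = y + p^m x with x ∈ ℤ_p, so φ is locally a constant times an exponential.
  have hev : (fun t => φ (toPadicInt t)) =ᶠ[𝓝 y]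
      fun t => φ (toPadicInt y) * exp (((p : ℚ_[p]) ^ m)⁻¹ • (t - y) • v) := by
    have hnear : ∀ᶠ t in 𝓝 y, ‖((p : ℚ_[p]) ^ m)⁻¹ * (t - y)‖ ≤ 1 := by
      have hcont : ContinuousAt (fun t : ℚ_[p] => ((p : ℚ_[p]) ^ m)⁻¹ * (t - y)) y := by fun_prop
      have := hcont.preimage_mem_nhds (t := {z : ℚ_[p] | ‖z‖ ≤ 1})
        (isOpen_norm_le_one.mem_nhds (by simp))
      exact this
    filter_upwards [hnear, isOpen_norm_le_one.mem_nhds hy] with t ht ht1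
    have e : toPadicInt t = toPadicInt y +
        (p : ℤ_[p]) ^ m * toPadicInt (((p : ℚ_[p]) ^ m)⁻¹ * (t - y)) := by
      apply Subtype.coe_injective
      push_cast
      rw [coe_toPadicInt ht, coe_toPadicInt hy, coe_toPadicInt ht1]
      field_simp
      ring
    rw [e, hadd, hexp, coe_toPadicInt ht, mul_smul]
  refine AnalyticAt.congr ?_ hev.symm
  refine analyticAt_const.mul ?_
  refine AnalyticAt.fun_comp (g := exp) (f := fun t : ℚ_[p] => ((p : ℚ_[p]) ^ m)⁻¹ • (t - y) • v)
    (analyticAt_exp_of_mem_ball (𝕂 := ℚ_[p]) _ ?_) (by fun_prop)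
  simpa using hr

end PadicExp

end UniformPro
end

/-! ### The analytic structure -/

noncomputable section
namespace UniformPro

open Topology

theorem analyticAt_prod_ofFn {𝕜 E A : Type*} [NontriviallyNormedField 𝕜] [NormedAddCommGroup E]
    [NormedSpace 𝕜 E] [NormedRing A] [NormedAlgebra 𝕜 A] {y : E} {n : ℕ} (f : Fin n → E → A)
    (hf : ∀ i, AnalyticAt 𝕜 (f i) y) :
    AnalyticAt 𝕜 (fun x => (List.ofFn fun i => f i x).prod) y := by
  induction n with
  | zero => simpa using analyticAt_const
  | succ n ih =>
    simp only [List.ofFn_succ, List.prod_cons]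
    exact (hf 0).mul (ih _ fun i => hf i.succ)

namespace IsUniformFiltration

variable {G : Type*} [Group G] [TopologicalSpace G] {p κ : ℕ} [hp : Fact p.Prime]
  {D : ℕ → Subgroup G} {d : ℕ} {h h' : Fin d → G}
  [IsTopologicalGroup G] [CompactSpace G] [T2Space G]

/-- The chart with values in `ℚ_p ^ d` defined by an ordered basis. -/
def chart (hD : IsUniformFiltration p κ D) (hb : IsFrattiniBasis p D h) (g : G) :
    Fin d → ℚ_[p] := fun i => (hD.coord hb i g : ℚ_[p])

theorem isOpenEmbedding_chart (hD : IsUniformFiltration p κ D) (hb : IsFrattiniBasis p D h) :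
    IsOpenEmbedding (hD.chart hb) :=
  (IsOpenEmbedding.piMap fun _ : Fin d => PadicInt.isOpenEmbedding_coe (p := p)).comp
    (hD.orderedProdHomeomorph hb).symm.isOpenEmbedding

theorem chart_orderedProd (hD : IsUniformFiltration p κ D) (hb : IsFrattiniBasis p D h)
    (x : Fin d → ℤ_[p]) : hD.chart hb (orderedProd h x) = fun i => (x i : ℚ_[p]) := by
  funext i
  rw [chart, hD.coord_orderedProd]

theorem orderedProd_toPadicInt_chart (hD : IsUniformFiltration p κ D)
    (hb : IsFrattiniBasis p D h) (g : G) :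
    orderedProd h (fun i => toPadicInt (hD.chart hb g i)) = g := by
  simp only [chart, toPadicInt_coe]
  exact hD.orderedProd_coord hb g

theorem norm_chart_le (hD : IsUniformFiltration p κ D) (hb : IsFrattiniBasis p D h) (g : G)
    (i : Fin d) : ‖hD.chart hb g i‖ ≤ 1 := (hD.coord hb i g).norm_le_one

theorem range_chart (hD : IsUniformFiltration p κ D) (hb : IsFrattiniBasis p D h) :
    Set.range (hD.chart hb) = {y | ∀ i, ‖y i‖ ≤ 1} := by
  ext y
  constructor
  · rintro ⟨g, rfl⟩
    exact hD.norm_chart_le hb g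
  · intro hy
    refine ⟨orderedProd h fun i => toPadicInt (y i), ?_⟩
    rw [chart_orderedProd]
    exact funext fun i => coe_toPadicInt (hy i)

theorem continuous_padicPow (hD : IsUniformFiltration p κ D) (g : G) :
    Continuous (padicPow g : ℤ_[p] → G) := by
  rw [continuous_iff_continuousAt]
  intro x
  rw [ContinuousAt, Filter.tendsto_iff_forall_eventually_mem]
  intro U hU
  have hV : (fun z : G => padicPow g x * z) ⁻¹' U ∈ 𝓝 (1 : G) :=
    ContinuousAt.preimage_mem_nhds (by fun_prop) (by simpa using hU)
  obtain ⟨n, hn⟩ := hD.small _ hV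
  have hopen : {y : ℤ_[p] | y - x ∈ Ideal.span {(p : ℤ_[p]) ^ n}} ∈ 𝓝 x := by
    have : {y : ℤ_[p] | y - x ∈ Ideal.span {(p : ℤ_[p]) ^ n}} =
        Metric.closedBall x ((p : ℝ) ^ (-n : ℤ)) := by
      ext y
      rw [Set.mem_ofPred_eq, ← PadicInt.norm_le_pow_iff_mem_span_pow, mem_closedBall_iff_norm]
    rw [this]
    have hp0 : (0 : ℝ) < p := by exact_mod_cast hp.out.pos
    exact Metric.closedBall_mem_nhds _ (by positivity)
  filter_upwards [hopen] with y hy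
  have e : padicPow g y = padicPow g x * padicPow g (y - x) := by
    rw [← hD.padicPow_add, add_sub_cancel]
  rw [e]
  exact hn (by simpa using hD.padicPow_mem (hD.mem_zero g) hy)

/-- The image under `rep` is a product of continuous characters of ℤ_p, one in each variable, each
analytic by `analyticAt_of_map_add`. -/
theorem analyticAt_rep_orderedProd (hD : IsUniformFiltration p κ D) (h : Fin d → G)
    {y : Fin d → ℚ_[p]} (hy : ∀ i, ‖y i‖ ≤ 1) :
    AnalyticAt ℚ_[p] (fun y : Fin d → ℚ_[p] => hD.rep (orderedProd h fun i => toPadicInt (y i)))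
      y := by
  have e : (fun y : Fin d → ℚ_[p] => hD.rep (orderedProd h fun i => toPadicInt (y i))) =
      fun y => (List.ofFn fun i => hD.rep (padicPow (h i) (toPadicInt (y i)))).prod := by
    funext y
    rw [orderedProd, map_list_prod, List.map_ofFn]
    rfl
  rw [e]
  refine analyticAt_prod_ofFn _ fun i => ?_
  have h1 : AnalyticAt ℚ_[p] (fun t => hD.rep (padicPow (h i) (toPadicInt t))) (y i) :=
    analyticAt_of_map_add (φ := fun x => hD.rep (padicPow (h i) x))
      (hD.continuous_rep.comp (hD.continuous_padicPow (h i)))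
      (by have := hD.padicPow_natCast (h i) 0
          simp only [Nat.cast_zero, pow_zero] at this
          rw [this, map_one])
      (fun x y => by rw [hD.padicPow_add, map_mul]) (hy i)
  exact AnalyticAt.fun_comp (f := fun y : Fin d → ℚ_[p] => y i) h1
    ((ContinuousLinearMap.proj (R := ℚ_[p]) (φ := fun _ : Fin d => ℚ_[p]) i).analyticAt y)

theorem exists_chart_functional (hD : IsUniformFiltration p κ D) (hb : IsFrattiniBasis p D h) :
    ∃ l : OperatorAlgebra p (augFilt p κ D) →L[ℚ_[p]] (Fin d → ℚ_[p]),
      ∀ g, l (hD.rep g) = hD.chart hb g := by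
  choose l hl using hD.exists_coord_functional hb
  exact ⟨ContinuousLinearMap.pi l, fun g => funext fun i => hl i g⟩

theorem contDiffOn_transition (hD : IsUniformFiltration p κ D) (h : Fin d → G)
    (hb' : IsFrattiniBasis p D h') :
    ContDiffOn ℚ_[p] ω (fun y : Fin d → ℚ_[p] => hD.chart hb' (orderedProd h fun i => toPadicInt (y i)))
      {y | ∀ i, ‖y i‖ ≤ 1} := by
  intro y hy
  obtain ⟨l, hl⟩ := hD.exists_chart_functional hb'
  simp only [← hl]
  exact (l.contDiff.contDiffAt.comp y (hD.analyticAt_rep_orderedProd h hy).contDiffAt)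
    |>.contDiffWithinAt

/-- The charted space structure given by an ordered basis. -/
abbrev chartedSpace (hD : IsUniformFiltration p κ D) (hb : IsFrattiniBasis p D h) :
    ChartedSpace (Fin d → ℚ_[p]) G := (hD.isOpenEmbedding_chart hb).singletonChartedSpace

theorem contMDiff_rep (hD : IsUniformFiltration p κ D) (hb : IsFrattiniBasis p D h) :
    letI := hD.chartedSpace hb
    ContMDiff 𝓘(ℚ_[p], Fin d → ℚ_[p]) 𝓘(ℚ_[p], OperatorAlgebra p (augFilt p κ D)) ω hD.rep := by
  let _ := hD.chartedSpace hb
  intro g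
  have e : (hD.rep : G → _) = (fun y : Fin d → ℚ_[p] =>
      hD.rep (orderedProd h fun i => toPadicInt (y i))) ∘ hD.chart hb := by
    funext g
    rw [Function.comp_apply, hD.orderedProd_toPadicInt_chart]
  rw [e]
  exact (hD.analyticAt_rep_orderedProd h (hD.norm_chart_le hb g)).contDiffAt.comp_contMDiffAt
    (contMDiff_isOpenEmbedding (hD.isOpenEmbedding_chart hb) g)

/-- In the chart the operations are l(rep x · rep y) and l((rep x)⁻¹) with l linear and continuous,
and multiplication and inversion of units are analytic in a Banach algebra. -/
theorem lieGroup (hD : IsUniformFiltration p κ D) (hb : IsFrattiniBasis p D h) :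
    letI := hD.chartedSpace hb
    LieGroup 𝓘(ℚ_[p], Fin d → ℚ_[p]) ω G := by
  let _ := hD.chartedSpace hb
  have hrep := hD.contMDiff_rep hb
  obtain ⟨l, hl⟩ := hD.exists_chart_functional hb
  have hman : IsManifold 𝓘(ℚ_[p], Fin d → ℚ_[p]) ω G :=
    (hD.isOpenEmbedding_chart hb).isManifold_singleton
  exact
    { hman with
      contMDiff_mul := by
        apply ContMDiff.of_comp_isOpenEmbedding (hD.isOpenEmbedding_chart hb)
        have e : hD.chart hb ∘ (fun x : G × G => x.1 * x.2) =
            (fun a : OperatorAlgebra p (augFilt p κ D) × OperatorAlgebra p (augFilt p κ D) =>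
              l (a.1 * a.2)) ∘ fun x : G × G => (hD.rep x.1, hD.rep x.2) := by
          funext x
          simp only [Function.comp_apply, ← map_mul, hl]
        rw [e]
        exact (l.contDiff.comp contDiff_mul).comp_contMDiff
          ((hrep.comp contMDiff_fst).prodMk_space (hrep.comp contMDiff_snd))
      contMDiff_inv := by
        apply ContMDiff.of_comp_isOpenEmbedding (hD.isOpenEmbedding_chart hb)
        have e : hD.chart hb ∘ (fun x : G => x⁻¹) =
            (fun a : OperatorAlgebra p (augFilt p κ D) => l (Ring.inverse a)) ∘ hD.rep := by
          funext x
          have h1 : hD.rep x = ((Units.map hD.rep (toUnits x) : (OperatorAlgebra p _)ˣ) :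
            OperatorAlgebra p (augFilt p κ D)) := rfl
          rw [Function.comp_apply, Function.comp_apply, h1, Ring.inverse_unit, ← map_inv,
            ← map_inv, Units.coe_map, ← hl]
          rfl
        rw [e]
        intro x
        refine ContDiffAt.comp_contMDiffAt (l.contDiff.contDiffAt.comp _ ?_) (hrep x)
        exact contDiffAt_ringInverse ℚ_[p] (Units.map hD.rep (toUnits x)) }

theorem isGlobalChart_orderedProd (hD : IsUniformFiltration p κ D) (hb : IsFrattiniBasis p D h)
    (hb' : IsFrattiniBasis p D h') :
    letI := hD.chartedSpace hb
    IsGlobalChart (p := p) (orderedProd h') := by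
  let _ := hD.chartedSpace hb
  have key : ∀ {h₁ h₂ : Fin d → G} (hb₁ : IsFrattiniBasis p D h₁) (hb₂ : IsFrattiniBasis p D h₂),
      ContDiffOn ℚ_[p] ω (hD.chart hb₂ ∘
        ((hD.isOpenEmbedding_chart hb₁).toOpenPartialHomeomorph _).symm) {y | ∀ i, ‖y i‖ ≤ 1} := by
    intro h₁ h₂ hb₁ hb₂
    refine (hD.contDiffOn_transition h₁ hb₂).congr fun y hy => ?_
    rw [← hD.range_chart hb₁] at hy
    obtain ⟨g, rfl⟩ := hy
    rw [Function.comp_apply, IsOpenEmbedding.toOpenPartialHomeomorph_left_inv,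
      hD.orderedProd_toPadicInt_chart]
  have hmem : ∀ {h₁ h₂ : Fin d → G} (hb₁ : IsFrattiniBasis p D h₁) (hb₂ : IsFrattiniBasis p D h₂),
      ((hD.isOpenEmbedding_chart hb₁).toOpenPartialHomeomorph _).symm ≫ₕ
        (hD.isOpenEmbedding_chart hb₂).toOpenPartialHomeomorph _ ∈
        contDiffGroupoid ω 𝓘(ℚ_[p], Fin d → ℚ_[p]) := by
    intro h₁ h₂ hb₁ hb₂
    refine mem_groupoid_of_pregroupoid.mpr ⟨?_, ?_⟩
    · refine (key hb₁ hb₂).mono fun y hy => ?_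
      rw [← hD.range_chart hb₁]
      simpa using hy.1
    · refine (key hb₂ hb₁).mono fun y hy => ?_
      rw [← hD.range_chart hb₂]
      simpa using hy.1
  refine ⟨(hD.isOpenEmbedding_chart hb').toOpenPartialHomeomorph _, ?_, by simp, ?_, fun x => ?_⟩
  · rw [IsManifold.mem_maximalAtlas_iff, mem_maximalAtlas_iff]
    rintro _ rfl
    exact ⟨hmem hb' hb, hmem hb hb'⟩
  · rw [IsOpenEmbedding.toOpenPartialHomeomorph_target, hD.range_chart]
  · rw [← hD.chart_orderedProd hb', IsOpenEmbedding.toOpenPartialHomeomorph_left_inv]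

end IsUniformFiltration

end UniformPro
end

/-! ### Uniform groups satisfy (HYP) -/

noncomputable section
namespace UniformPro

section UniformGroup

variable {G : Type*} [Group G] [TopologicalSpace G] {p : ℕ} [hp : Fact p.Prime] {d : ℕ}

theorem IsUniform.isLowerPSeriesVal (hG : IsUniform p G) :
    IsLowerPSeriesVal p (filtrationVal (kappa p) fun i => lowerPSeries p G (i + 1)) := by
  have := hG.isProP.isTopologicalGroup
  have := hG.isProP.t2Space
  refine ⟨fun g hg => ?_, fun g i hi h1 h2 => ?_⟩
  · obtain ⟨n, h1, h2⟩ := hG.isUniformFiltration.exists_mem_notMem hg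
    exact ⟨n + 1, by omega, h1, h2⟩
  · obtain ⟨n, rfl⟩ : ∃ n, i = n + 1 := ⟨i - 1, by omega⟩
    rw [hG.isUniformFiltration.filtrationVal_eq h1 h2]
    congr 2
    unfold kappa
    split_ifs <;> omega

theorem IsUniform.exists_pValuation (hG : IsUniform p G) (hd : HasDim G d) :
    ∃ w : G → WithTop ℝ,
      IsPValuation p w ∧ IsLowerPSeriesVal p w ∧
      (∀ g : G, g ≠ 1 → ∃ n : ℤ, w g = ((n : ℝ) : WithTop ℝ)) ∧
      ∃ _ : ChartedSpace (Fin d → ℚ_[p]) G,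
        LieGroup 𝓘(ℚ_[p], Fin d → ℚ_[p]) ω G ∧
        (∃ h : Fin d → G, HYP p w h) ∧
        ∀ h : Fin d → G, TopGenerates h →
          HYP p w h ∧ ∀ i, w (h i) = ((kappa p : ℝ) : WithTop ℝ) := by
  have := hG.isProP.isTopologicalGroup
  have := hG.isProP.t2Space
  have := hG.isProP.compactSpace
  have hD := hG.isUniformFiltration
  obtain ⟨h₀, hh₀⟩ := hd.1
  have hb₀ := hD.isFrattiniBasis hd hh₀
  -- One generating family fixes the analytic structure; the other families give charts of the same
  -- maximal atlas.
  let _ := hD.chartedSpace hb₀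
  have hall : ∀ h : Fin d → G, TopGenerates h →
      HYP p (filtrationVal (kappa p) fun i => lowerPSeries p G (i + 1)) h ∧
      ∀ i, filtrationVal (kappa p) (fun i => lowerPSeries p G (i + 1)) (h i) =
        ((kappa p : ℝ) : WithTop ℝ) := by
    intro h hh
    have hb := hD.isFrattiniBasis hd hh
    refine ⟨⟨hD.isPSaturated rfl, ⟨hh, hD.isGlobalChart_orderedProd hb₀ hb, fun x => ?_⟩,
      fun i j _ => ?_⟩, hD.filtrationVal_basis hb⟩
    · simp only [hD.filtrationVal_basis hb]
      exact hD.filtrationVal_orderedProd hb x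
    · rw [hD.filtrationVal_basis hb, hD.filtrationVal_basis hb]
      exact IsUniformFiltration.lt_kappa_add_kappa
  refine ⟨_, hD.isPValuation, hG.isLowerPSeriesVal, fun g hg => ?_, hD.chartedSpace hb₀,
    hD.lieGroup hb₀, ⟨h₀, (hall h₀ hh₀).1⟩, hall⟩
  obtain ⟨n, h1, h2⟩ := hD.exists_mem_notMem hg
  exact ⟨(kappa p + n : ℕ), by rw [hD.filtrationVal_eq h1 h2]; norm_cast⟩

end UniformGroup

end UniformPro
end

/-! ### From saturated to uniform groups -/

noncomputable section
namespace UniformPro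

open Topology
open scoped commutatorElement

section RelIndex

variable {G : Type*} [Group G]

/-- Only compatibility of f with cosets is required, because the p-th power map is a homomorphism
merely up to deeper terms. -/
theorem relIndex_eq_of_map {A B A' B' : Subgroup G} (f : G → G) (hf : ∀ x ∈ A, f x ∈ A')
    (hsurj : ∀ y ∈ A', ∃ x ∈ A, f x = y)
    (hiff : ∀ x ∈ A, ∀ y ∈ A, x⁻¹ * y ∈ B ↔ (f x)⁻¹ * f y ∈ B') :
    B.relIndex A = B'.relIndex A' := by
  refine Nat.card_congr (Equiv.ofBijective (Quotient.map' (fun x : A => (⟨f x, hf x x.2⟩ : A'))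
    fun x y hxy => ?_) ⟨?_, ?_⟩)
  · rw [QuotientGroup.leftRel_apply] at hxy ⊢
    exact (hiff x x.2 y y.2).mp hxy
  · intro x y
    induction x using Quotient.inductionOn'
    induction y using Quotient.inductionOn'
    rename_i x y
    intro hxy
    have h1 := Quotient.exact hxy
    refine Quotient.sound ?_
    rw [← Quotient.eq_iff_equiv] at h1 ⊢
    rw [Quotient.eq, QuotientGroup.leftRel_apply] at h1 ⊢
    exact (hiff x x.2 y y.2).mpr h1
  · intro y
    induction y using Quotient.inductionOn'
    rename_i y
    obtain ⟨x, hx, hxy⟩ := hsurj y y.2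
    refine ⟨Quotient.mk'' ⟨x, hx⟩, ?_⟩
    rw [Quotient.map'_mk'']
    exact congrArg _ (Subtype.ext hxy)

end RelIndex

namespace IsPValuation

variable {G : Type*} [Group G] {p : ℕ} {w : G → WithTop ℝ}

theorem apply_one (hw : IsPValuation p w) : w 1 = ⊤ := (hw.eq_top_iff 1).mpr rfl

theorem le_inv (hw : IsPValuation p w) (g : G) : w g ≤ w g⁻¹ := by
  simpa [hw.apply_one] using hw.mul_inv 1 g

theorem le_mul (hw : IsPValuation p w) (g h : G) : min (w g) (w h) ≤ w (g * h) := by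
  have := hw.mul_inv g h⁻¹
  rw [inv_inv] at this
  exact (min_le_min le_rfl (hw.le_inv h)).trans this

theorem pos [hp : Fact p.Prime] (hw : IsPValuation p w) (g : G) : 0 < w g := by
  refine lt_of_le_of_lt ?_ (hw.lt g)
  have : (1 : ℝ) < p := by exact_mod_cast hp.out.one_lt
  exact_mod_cast (by have := sub_pos.mpr this; positivity : (0 : ℝ) ≤ 1 / ((p : ℝ) - 1))

/-- The subgroup of the elements of valuation greater than `c`. -/
def valGt (hw : IsPValuation p w) (c : ℝ) : Subgroup G where
  carrier := {g | (c : WithTop ℝ) < w g}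
  mul_mem' := fun ha hb => (lt_min ha hb).trans_le (hw.le_mul _ _)
  one_mem' := by simp [hw.apply_one]
  inv_mem' := fun ha => lt_of_lt_of_le ha (hw.le_inv _)

theorem mem_valGt (hw : IsPValuation p w) {c : ℝ} {g : G} :
    g ∈ hw.valGt c ↔ (c : WithTop ℝ) < w g := Iff.rfl

theorem valGt_normal [Fact p.Prime] (hw : IsPValuation p w) (c : ℝ) : (hw.valGt c).Normal := by
  refine ⟨fun x hx g => ?_⟩
  have e : g * x * g⁻¹ = x * (x⁻¹ * (g⁻¹)⁻¹ * x * g⁻¹) := by group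
  rw [e]
  refine mul_mem hx (hw.mem_valGt.mpr ?_)
  exact (lt_of_lt_of_le hx (le_add_of_nonneg_right (hw.pos g⁻¹).le)).trans_le
    (hw.commutator x g⁻¹)

theorem eq_one_of_forall_mem_valGt (hw : IsPValuation p w) {g : G}
    (h : ∀ n : ℕ, g ∈ hw.valGt n) : g = 1 := by
  rw [← hw.eq_top_iff]
  cases hg : w g with
  | top => rfl
  | coe r =>
    obtain ⟨n, hn⟩ := exists_nat_gt r
    have := hw.mem_valGt.mp (h n)
    rw [hg] at this
    exact absurd (WithTop.coe_lt_coe.mp this) (not_lt.mpr hn.le)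

theorem add_lt_add_coe {a b : ℝ} {x y : WithTop ℝ} (hx : (a : WithTop ℝ) < x)
    (hy : (b : WithTop ℝ) < y) : ((a + b : ℝ) : WithTop ℝ) < x + y := by
  cases x with
  | top => simp
  | coe x =>
    cases y with
    | top => simp
    | coe y =>
      rw [WithTop.coe_lt_coe] at hx hy
      rw [← WithTop.coe_add, WithTop.coe_lt_coe]
      exact add_lt_add hx hy

theorem pow_mem_valGt_iff (hw : IsPValuation p w) {c : ℝ} {g : G} :
    g ^ p ∈ hw.valGt (c + 1) ↔ g ∈ hw.valGt c := by
  rw [mem_valGt, mem_valGt, hw.pow_p]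
  cases w g with
  | top => simp
  | coe r => norm_cast; simp

theorem commutator_mem_valGt (hw : IsPValuation p w) {a b : ℝ} {g h : G} (hg : g ∈ hw.valGt a)
    (hh : h ∈ hw.valGt b) : ⁅g, h⁆ ∈ hw.valGt (a + b) := by
  have := hw.commutator g⁻¹ h⁻¹
  rw [inv_inv, inv_inv] at this
  exact (add_lt_add_coe (lt_of_lt_of_le hg (hw.le_inv g)) (lt_of_lt_of_le hh (hw.le_inv h))).trans_le
    this

/-- Each step gains at least 1/(p-1): p-th powers add 1, and brackets add a valuation exceeding
1/(p-1). This coarse bound serves to show that the series shrinks to 1. -/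
theorem lowerPSeries_le_valGt [hp : Fact p.Prime] (hw : IsPValuation p w) (n : ℕ) :
    lowerPSeries p G (n + 1) ≤ hw.valGt ((n + 1) * (1 / ((p : ℝ) - 1))) := by
  have h2 : (2 : ℝ) ≤ p := by exact_mod_cast hp.out.two_le
  have h1 : 1 / ((p : ℝ) - 1) ≤ 1 := by
    rw [div_le_one (by linarith)]; linarith
  have mono : ∀ {a b : ℝ}, a ≤ b → hw.valGt b ≤ hw.valGt a := fun hab g hg =>
    lt_of_le_of_lt (WithTop.coe_le_coe.mpr hab) hg
  induction n with
  | zero =>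
    intro g _
    rw [mem_valGt]
    simpa using hw.lt g
  | succ n ih =>
    refine sup_le (powSubgroup_le fun g hg => ?_) (Subgroup.commutator_le.mpr fun g hg k _ => ?_)
    · refine mono ?_ (hw.pow_mem_valGt_iff.mpr (ih hg))
      push_cast
      linarith
    · refine mono ?_ (hw.commutator_mem_valGt (ih hg) (hw.mem_valGt.mpr (hw.lt k)))
      push_cast
      linarith

end IsPValuation

section Saturated

variable {G : Type*} [Group G] [TopologicalSpace G] {p : ℕ} [hp : Fact p.Prime] {d : ℕ}
  {w : G → WithTop ℝ} {h : Fin d → G}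

theorem le_vp_of_norm_le {x : ℤ_[p]} {N : ℕ} (hx : ‖x‖ ≤ (p : ℝ) ^ (-N : ℤ)) :
    ((N : ℝ) : WithTop ℝ) ≤ vp x := by
  unfold vp
  split_ifs with h0
  · exact le_top
  · rw [PadicInt.norm_le_pow_iff_le_valuation x h0] at hx
    exact_mod_cast hx

/-- As the valuations w (h i) are positive, w g is at least the minimum of the v_p(x_i), which is
large near the origin of the chart. -/
theorem IsOrderedBasis.valGt_mem_nhds [ChartedSpace (Fin d → ℚ_[p]) G] (hw : IsPValuation p w)
    (hb : IsOrderedBasis p w h) (c : ℝ) : (hw.valGt c : Set G) ∈ 𝓝 (1 : G) := by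
  have hp0 : (0 : ℝ) < p := by exact_mod_cast hp.out.pos
  obtain ⟨e, -, hs, ht, he⟩ := hb.isGlobalChart
  have hF0 : orderedProd h (0 : Fin d → ℤ_[p]) = 1 := by
    rw [← hw.eq_top_iff, hb.apply_eq, Finset.inf_eq_top_iff]
    intro i _
    simp [vp]
  have h0t : (0 : Fin d → ℚ_[p]) ∈ e.target := by rw [ht]; simp
  have he1 : e 1 = 0 := by
    have := he 0
    rw [hF0] at this
    rw [← this]
    exact e.right_inv h0t
  obtain ⟨N, hN⟩ := exists_nat_gt c
  have hnhds : e ⁻¹' Metric.closedBall 0 ((p : ℝ) ^ (-N : ℤ)) ∈ 𝓝 (1 : G) := by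
    refine (e.continuousAt (by rw [hs]; trivial)).preimage_mem_nhds ?_
    rw [he1]
    exact Metric.closedBall_mem_nhds _ (by positivity)
  filter_upwards [hnhds] with g hg
  have hgt : e g ∈ e.target := e.map_source (by rw [hs]; trivial)
  rw [ht] at hgt
  obtain ⟨x, hx⟩ : ∃ x : Fin d → ℤ_[p], e g = fun i => (x i : ℚ_[p]) :=
    ⟨fun i => toPadicInt (e g i), funext fun i => (coe_toPadicInt (hgt i)).symm⟩
  have hgx : g = orderedProd h x := by
    rw [← he, ← hx]
    exact (e.left_inv (by rw [hs]; trivial)).symm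
  change (c : WithTop ℝ) < w g
  rw [hgx, hb.apply_eq, Finset.lt_inf_iff (WithTop.coe_lt_top c)]
  intro i _
  rw [Set.mem_preimage, mem_closedBall_zero_iff, pi_norm_le_iff_of_nonneg (by positivity)] at hg
  have hi := hg i
  rw [hx] at hi
  calc (c : WithTop ℝ) < ((N : ℝ) : WithTop ℝ) := WithTop.coe_lt_coe.mpr hN
    _ ≤ vp (x i) := le_vp_of_norm_le hi
    _ ≤ w (h i) + vp (x i) := le_add_of_nonneg_left (hw.pos (h i)).le

variable [CompactSpace G] [T2Space G] [IsTopologicalGroup G]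
  [ChartedSpace (Fin d → ℚ_[p]) G]

omit [CompactSpace G] [T2Space G] in
theorem IsOrderedBasis.isOpen_valGt (hw : IsPValuation p w) (hb : IsOrderedBasis p w h) (c : ℝ) :
    IsOpen (hw.valGt c : Set G) :=
  (hw.valGt c).isOpen_of_mem_nhds (hb.valGt_mem_nhds hw c)

omit [T2Space G] in
theorem IsOrderedBasis.exists_valGt_subset (hw : IsPValuation p w) (hb : IsOrderedBasis p w h)
    {U : Set G} (hU : U ∈ 𝓝 (1 : G)) : ∃ n : ℕ, (hw.valGt n : Set G) ⊆ U := by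
  have hcl : ∀ n : ℕ, IsClosed (hw.valGt n : Set G) := fun n =>
    Subgroup.isClosed_of_isOpen _ (hb.isOpen_valGt hw n)
  refine exists_subset_nhds_of_isCompact' (V := fun n : ℕ => (hw.valGt n : Set G)) ?_
    (fun n => (hcl n).isCompact) hcl ?_
  · refine directed_of_isDirected_le fun m n hmn g hg => ?_
    exact lt_of_le_of_lt (WithTop.coe_le_coe.mpr (Nat.cast_le.mpr hmn)) (hw.mem_valGt.mp hg)
  · intro g hg
    rw [Set.mem_iInter] at hg
    rw [hw.eq_one_of_forall_mem_valGt hg]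
    exact hU

/-- Clopen cosets of the `valGt n` separate points. An open subgroup contains some `valGt m`, and
this contains all p^m-th powers. -/
theorem IsOrderedBasis.isProP (hw : IsPValuation p w) (hb : IsOrderedBasis p w h) :
    IsProP p G := by
  refine ⟨inferInstance, inferInstance, inferInstance, ?_, fun N hN hNo => ?_⟩
  · suffices TotallySeparatedSpace G from inferInstance
    refine totallySeparatedSpace_iff_exists_isClopen.mpr fun x y hxy => ?_
    obtain ⟨n, hn⟩ : ∃ n : ℕ, x⁻¹ * y ∉ hw.valGt n := by
      by_contra! hcon
      exact hxy (inv_mul_eq_one.mp (hw.eq_one_of_forall_mem_valGt hcon))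
    refine ⟨(fun z => x⁻¹ * z) ⁻¹' (hw.valGt n : Set G), ⟨?_, ?_⟩, by simp, hn⟩
    · exact (Subgroup.isClosed_of_isOpen _ (hb.isOpen_valGt hw n)).preimage (by fun_prop)
    · exact (hb.isOpen_valGt hw n).preimage (by fun_prop)
  · obtain ⟨m, hm⟩ := hb.exists_valGt_subset hw (hNo.mem_nhds (one_mem N))
    have hpg : IsPGroup p (G ⧸ N) := by
      intro g
      induction g using QuotientGroup.induction_on with | H g => ?_
      refine ⟨m, ?_⟩
      rw [← QuotientGroup.mk_pow, QuotientGroup.eq_one_iff]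
      apply hm
      have : ∀ k : ℕ, g ^ p ^ k ∈ hw.valGt k := by
        intro k
        induction k with
        | zero => rw [hw.mem_valGt]; simpa using hw.pos g
        | succ k ih => rw [pow_succ, pow_mul, Nat.cast_succ, hw.pow_mem_valGt_iff]; exact ih
      exact this m
    have := N.quotient_finite_of_isOpen hNo
    exact IsPGroup.iff_card.mp hpg

omit [CompactSpace G] [T2Space G] in
-- Modulo the open normal subgroup N the generators commute by (HYP), hence so does the subgroup
-- they generate, and by density this subgroup together with N is all of G.
theorem HYP.commutator_le_valGt (hw : IsPValuation p w) (hh : HYP p w h) :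
    ⁅(⊤ : Subgroup G), (⊤ : Subgroup G)⁆ ≤ hw.valGt ((p : ℝ) / ((p : ℝ) - 1)) := by
  have hb := hh.isOrderedBasis
  set N := hw.valGt ((p : ℝ) / ((p : ℝ) - 1)) with hN
  have hNn : N.Normal := hw.valGt_normal _
  have htop : Subgroup.closure (Set.range h) ⊔ N = ⊤ := by
    rw [eq_top_iff]
    intro g _
    have hV : {z : G | z⁻¹ * g ∈ N} ∈ 𝓝 g :=
      ContinuousAt.preimage_mem_nhds (f := fun z : G => z⁻¹ * g) (by fun_prop)
        (by simpa using hb.valGt_mem_nhds hw _)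
    obtain ⟨k, hk, hk2⟩ := mem_closure_iff_nhds.mp (hb.topGenerates g) _ hV
    have := mul_mem (Subgroup.mem_sup_left (T := N) hk2) (Subgroup.mem_sup_right hk)
    rwa [mul_inv_cancel_left] at this
  have hgen : ∀ s ∈ Set.range h, ∀ t ∈ Set.range h, ⁅s, t⁆ ∈ N := by
    rintro _ ⟨i, rfl⟩ _ ⟨j, rfl⟩
    by_cases hij : i = j
    · rw [hij, commutatorElement_self]; exact one_mem _
    · have h1 := hw.commutator (h i)⁻¹ (h j)⁻¹
      rw [inv_inv, inv_inv] at h1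
      exact ((hh.lt_add i j hij).trans_le (add_le_add (hw.le_inv _) (hw.le_inv _))).trans_le h1
  have hcomm : ∀ s c : G, ⁅s, c⁆ ∈ N ↔ Commute (s : G ⧸ N) (c : G ⧸ N) := by
    intro s c
    rw [← commutatorElement_eq_one_iff_commute, ← QuotientGroup.eq_one_iff]
    rfl
  have hcc : ⁅Subgroup.closure (Set.range h), Subgroup.closure (Set.range h)⁆ ≤ N := by
    refine commutator_closure_le fun s hs c hc => ?_
    rw [hcomm]
    induction hc using Subgroup.closure_induction with
    | mem t ht => exact (hcomm s t).mp (hgen s hs t ht)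
    | one => exact Commute.one_right _
    | mul _ _ _ _ h1 h2 => exact h1.mul_right h2
    | inv _ _ h1 => exact h1.inv_right
  have hN1 : ∀ K : Subgroup G, ⁅N, K⁆ ≤ N := fun K => Subgroup.commutator_le_left N K
  rw [← htop]
  refine commutator_sup_le ?_ (hN1 _)
  rw [Subgroup.commutator_comm]
  refine commutator_sup_le hcc (hN1 _)

theorem HYP.isUniform (hp2 : p ≠ 2) (hw : IsPValuation p w) (hh : HYP p w h) : IsUniform p G := by
  have hb := hh.isOrderedBasis
  have hp1 : (1 : ℝ) < p := by exact_mod_cast hp.out.one_lt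
  have hpos : 0 < (p : ℝ) - 1 := sub_pos.mpr hp1
  have hdiv : (p : ℝ) / ((p : ℝ) - 1) = 1 / ((p : ℝ) - 1) + 1 := by field_simp; ring
  have hpow : ⁅(⊤ : Subgroup G), (⊤ : Subgroup G)⁆ ≤ powSubgroup ⊤ p := by
    intro g hg
    obtain ⟨k, rfl⟩ := hh.isPSaturated.exists_pow g (hh.commutator_le_valGt hw hg)
    exact pow_mem_powSubgroup (Subgroup.mem_top k)
  have h0 : ⁅(⊤ : Subgroup G), (⊤ : Subgroup G)⁆ ≤ lowerPSeries p G (1 + 1) :=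
    commutator_top_le_lowerPSeries 0
  have hsmall : ∀ U ∈ 𝓝 (1 : G), ∃ n, (lowerPSeries p G (n + 1) : Set G) ⊆ U := by
    intro U hU
    obtain ⟨m, hm⟩ := hb.exists_valGt_subset hw hU
    obtain ⟨n, hn⟩ := exists_nat_ge ((m : ℝ) * ((p : ℝ) - 1))
    refine ⟨n, fun g hg => hm ?_⟩
    refine lt_of_le_of_lt (WithTop.coe_le_coe.mpr ?_) 
      (hw.mem_valGt.mp (hw.lowerPSeries_le_valGt n hg))
    rw [mul_one_div, le_div_iff₀ hpos]
    linarith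
  have hroot := fun i => (lowerPSeries_eq_image_pow le_rfl (fun h => absurd h hp2) h0 hpow
    hsmall i).2
  -- Elements of P_{i+2} are p-th powers from P_{i+1}, and taking p-th powers adds 1 to w.
  -- Conversely, saturation provides roots, since 1/(p-1) + 1 = p/(p-1).
  have hser : ∀ i : ℕ, lowerPSeries p G (i + 1) = hw.valGt (1 / ((p : ℝ) - 1) + i) := by
    intro i
    induction i with
    | zero =>
      refine (eq_top_iff.mpr fun g _ => ?_).symm
      rw [hw.mem_valGt]
      simpa using hw.lt g
    | succ i ih =>
      have e : 1 / ((p : ℝ) - 1) + ((i + 1 : ℕ) : ℝ) = 1 / ((p : ℝ) - 1) + i + 1 := by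
        push_cast; ring
      rw [e]
      ext g
      constructor
      · intro hg
        obtain ⟨x, hx, rfl⟩ := hroot i g hg
        rw [ih] at hx
        exact hw.pow_mem_valGt_iff.mpr hx
      · intro hg
        obtain ⟨x, rfl⟩ := hh.isPSaturated.exists_pow g (by
          refine lt_of_le_of_lt (WithTop.coe_le_coe.mpr ?_) hg
          rw [hdiv]
          have : (0 : ℝ) ≤ i := i.cast_nonneg
          linarith)
        refine pow_mem_lowerPSeries ?_
        rw [ih]
        exact hw.pow_mem_valGt_iff.mp hg
  have hiff : ∀ (i : ℕ) (x : G), x ^ p ∈ lowerPSeries p G (i + 2) ↔ x ∈ lowerPSeries p G (i + 1) := by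
    intro i x
    have e : 1 / ((p : ℝ) - 1) + ((i + 1 : ℕ) : ℝ) = 1 / ((p : ℝ) - 1) + i + 1 := by
      push_cast; ring
    rw [show i + 2 = (i + 1) + 1 by omega, hser, hser, e, hw.pow_mem_valGt_iff]
  have hstep : ∀ i : ℕ, (lowerPSeries p G (i + 2)).relIndex (lowerPSeries p G (i + 1)) =
      (lowerPSeries p G (i + 3)).relIndex (lowerPSeries p G (i + 2)) := by
    intro i
    -- On P_{i+1} the elements x^(-p) y^p and (x⁻¹y)^p differ by an element of P_{i+3}, so the p-th
    -- power map respects and detects cosets.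
    refine relIndex_eq_of_map (fun x => x ^ p) (fun x hx => pow_mem_lowerPSeries hx) (hroot i)
      fun x hx y hy => ?_
    have h1 := mul_pow_lowerPSeries le_rfl (fun h => absurd h hp2) h0 hx
      (mul_mem (inv_mem hx) hy)
    rw [mul_inv_cancel_left] at h1
    have e : (x ^ p)⁻¹ * y ^ p =
        (x⁻¹ * y) ^ p * ((x ^ p * (x⁻¹ * y) ^ p)⁻¹ * y ^ p) := by group
    rw [e, Subgroup.mul_mem_cancel_right _ h1, hiff (i + 1)]
  have hconst : ∀ i : ℕ, (lowerPSeries p G (i + 2)).relIndex (lowerPSeries p G (i + 1)) =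
      (lowerPSeries p G 2).relIndex (lowerPSeries p G 1) := by
    intro i
    induction i with
    | zero => rfl
    | succ i ih => rw [← ih]; exact (hstep i).symm
  refine ⟨hb.isProP hw, ⟨d, h, hb.topGenerates⟩, ?_, fun i j hi hj => ?_⟩
  · rw [IsPowerful, if_neg hp2]; exact hpow
  · obtain ⟨i, rfl⟩ : ∃ k, i = k + 1 := ⟨i - 1, by omega⟩
    obtain ⟨j, rfl⟩ : ∃ k, j = k + 1 := ⟨j - 1, by omega⟩
    rw [hconst i, hconst j]

end Saturated

end UniformPro
end

theorem mainTheorem11 (p : ℕ) [Fact p.Prime] (G : Type*) [Group G] [TopologicalSpace G] :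
    (∀ d : ℕ, UniformPro.IsUniform p G → UniformPro.HasDim G d →
      ∃ w : G → WithTop ℝ,
        UniformPro.IsPValuation p w ∧
        UniformPro.IsLowerPSeriesVal p w ∧
        (∀ g : G, g ≠ 1 → ∃ n : ℤ, w g = ((n : ℝ) : WithTop ℝ)) ∧
        ∃ _ : ChartedSpace (Fin d → ℚ_[p]) G,
          LieGroup 𝓘(ℚ_[p], Fin d → ℚ_[p]) ω G ∧
          (∃ h : Fin d → G, UniformPro.HYP p w h) ∧
          ∀ h : Fin d → G, UniformPro.TopGenerates h →
            UniformPro.HYP p w h ∧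
            ∀ i, w (h i) = ((UniformPro.kappa p : ℝ) : WithTop ℝ)) ∧
    (p ≠ 2 → ∀ (d : ℕ) [ChartedSpace (Fin d → ℚ_[p]) G]
        [LieGroup 𝓘(ℚ_[p], Fin d → ℚ_[p]) ω G] [CompactSpace G] [T2Space G]
        (w : G → WithTop ℝ) (h : Fin d → G),
        UniformPro.IsPValuation p w → UniformPro.HYP p w h → UniformPro.IsUniform p G) := by
  refine ⟨fun d hG hd => hG.exists_pValuation hd, fun hp2 d _ _ _ _ w h hw hh => ?_⟩
  have := topologicalGroup_of_lieGroup 𝓘(ℚ_[p], Fin d → ℚ_[p]) ω (G := G)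
  exact hh.isUniform hp2 hw
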